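/- **Theorem 2.4.** Let $D\subset\mathbb R^d$ be a bounded convex domain of class $C^2$, let $\Pi(x)$ be the projection of $x\in\mathbb R^d$ on $\bar D$, and let $\mathbf n(x)$ be the inward unit normal vector at $x\in\partial D$. Let $y$ and $y^n$, $n\ge1$, be càdlàg functions $[0,\infty)\to\mathbb R^d$ with $y^n\to y$ in the Skorokhod $J_1$-topology. For a càdlàg $k:[0,\infty)\to\mathbb R^d$ of locally bounded variation let $|k|_t$ be its total variation on $[0,t]$ and $\|k\|_t=|k_0|+|k|_t$, with the convention $k_{0-}=0$, so that $\Delta k_0=k_0$ and the measure $d\|k\|$ on $[0,\infty)$ has mass $|k_0|$ at $0$; write $\int_0^T=\int_{(0,T]}$. Let $(x,k)$ be a solution of the Skorokhod problem associated with $y$: $x,k$ are càdlàg, $x_t=y_t+k_t$ for $t\ge0$, $x$ is $\bar D$-valued, $k$ has locally bounded variation, $k_0=\Pi(y_0)-y_0$, and for all $t\ge0$ $$k_t=k_0+\int_0^t\mathbf n(x_s)\,d|k|_s,\qquad |k|_t=\int_0^t\mathbf 1_{\{x_s\in\partial D\}}\,d|k|_s .$$ For $n\ge1$ let $x^n$ be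 a càdlàg solution of the penalized equation $$x^n_t=y^n_t+k^n_t,\qquad k^n_t=-n\int_0^t\bigl(x^n_s-\Pi(x^n_s)\bigr)\,ds,\qquad t\ge0 .$$ Let $g:[0,\infty)\times\mathbb R^d\to\mathbb R$ be continuous, put $\bar g(s,x)=g(s,x)-g(s,\Pi(x))$, and let $T>0$ be such that $\Delta y_T=0$. Then each $k^n$ has locally bounded variation, all integrals below exist, the sum converges absolutely, and $$\int_0^T g(s,x^n_s)\,d|k^n|_s\;\longrightarrow\; I_T(g,x,k):=\int_{[0,T]}g(s,x_s)\,d\|k\|_s+\sum_{0\le s\le T}\int_0^{|\Delta k_s|}\bar g\bigl(s,x_s-r\,\mathbf n(x_s)\bigr)\,dr\qquad(n\to\infty),$$ where terms with $\Delta k_s=0$ are zero ($x_s\in\partial D$ whenever $\Delta k_s\ne0$). -/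

import Mathlib

open Set Filter Topology MeasureTheory

namespace Reflection

noncomputable section

/-! Paths are functions `ℝ → ℝᵈ` of which only the values at times `t ≥ 0` are ever used. -/

/-- `y` is right continuous with left-hand limits on `[0, ∞)`. -/
def IsCadlag {d : ℕ} (y : ℝ → EuclideanSpace ℝ (Fin d)) : Prop :=
  (∀ t : ℝ, 0 ≤ t → ContinuousWithinAt y (Ici t) t) ∧
    ∀ t : ℝ, 0 < t → ∃ l, Tendsto y (𝓝[<] t) (𝓝 l)

/-- The jump `Δy_t = y_t - y_{t-}`, with the convention `y_{0-} = 0`. -/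
def jump {d : ℕ} (y : ℝ → EuclideanSpace ℝ (Fin d)) (t : ℝ) : EuclideanSpace ℝ (Fin d) :=
  if t = 0 then y 0 else y t - Function.leftLim y t

/-- Convergence of sequences in the Skorokhod `J₁`-topology on càdlàg paths on `[0, ∞)`:
there are increasing bijections `τₙ` of `[0, ∞)` with `τₙ(t) → t` uniformly on `[0, ∞)` and
`yₙ(τₙ(t)) → y(t)` uniformly on every bounded interval `[0, N]`. -/
def TendstoJ1 {d : ℕ} (yn : ℕ → ℝ → EuclideanSpace ℝ (Fin d))
    (y : ℝ → EuclideanSpace ℝ (Fin d)) : Prop :=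
  ∃ τ : ℕ → ℝ → ℝ,
    (∀ n, StrictMonoOn (τ n) (Ici 0) ∧ BijOn (τ n) (Ici 0) (Ici 0)) ∧
    TendstoUniformlyOn τ id atTop (Ici 0) ∧
    ∀ N : ℝ, TendstoUniformlyOn (fun n t => yn n (τ n t)) y atTop (Icc 0 N)

/-- `ρ` is a `C²` defining function of `D` on the open neighbourhood `U` of `p`. For an open set
`D` and `p ∈ ∂D` this forces `ρ p = 0`, and near `p` the set `D` lies on one side of the
`C²` hypersurface `{ρ = 0}`. -/
structure IsLocalDefiningFunction {d : ℕ} (D : Set (EuclideanSpace ℝ (Fin d)))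
    (p : EuclideanSpace ℝ (Fin d)) (U : Set (EuclideanSpace ℝ (Fin d)))
    (ρ : EuclideanSpace ℝ (Fin d) → ℝ) : Prop where
  isOpen : IsOpen U
  mem : p ∈ U
  contDiffOn : ContDiffOn ℝ 2 ρ U
  gradient_ne_zero : gradient ρ p ≠ 0
  mem_iff : ∀ z ∈ U, z ∈ D ↔ 0 < ρ z

/-- `D` is a bounded convex domain with `C²` boundary. -/
structure IsBoundedConvexC2Domain {d : ℕ} (D : Set (EuclideanSpace ℝ (Fin d))) : Prop where
  isOpen : IsOpen D
  nonempty : D.Nonempty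
  convex : Convex ℝ D
  isBounded : Bornology.IsBounded D
  boundary : ∀ p ∈ frontier D, ∃ U ρ, IsLocalDefiningFunction D p U ρ

/-- `ν` is the inward unit normal vector to `∂D` at `p`: the normalized gradient of a local
defining function that is positive inside `D`. -/
def IsInwardUnitNormal {d : ℕ} (D : Set (EuclideanSpace ℝ (Fin d)))
    (p ν : EuclideanSpace ℝ (Fin d)) : Prop :=
  p ∈ frontier D ∧ ∃ U ρ, IsLocalDefiningFunction D p U ρ ∧
    ν = ‖gradient ρ p‖⁻¹ • gradient ρ p

/-- The inward unit normal `n(p)` for `p ∈ ∂D` (an irrelevant value elsewhere). -/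
def inwardNormal {d : ℕ} (D : Set (EuclideanSpace ℝ (Fin d)))
    (p : EuclideanSpace ℝ (Fin d)) : EuclideanSpace ℝ (Fin d) :=
  Classical.epsilon (IsInwardUnitNormal D p)

/-- The projection `Π(x)` of `x` on the closure of `D`: the point `p` of the closure of `D` with
`|p - x| = dist (x, closure D)`. -/
def proj {d : ℕ} (D : Set (EuclideanSpace ℝ (Fin d)))
    (x : EuclideanSpace ℝ (Fin d)) : EuclideanSpace ℝ (Fin d) :=
  Classical.epsilon fun p => p ∈ closure D ∧ dist p x = Metric.infDist x (closure D)

/-- `|k|_t`, the total variation of `k` on `[0, t]`; it is `0` for `t < 0`. -/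
def totalVariation {d : ℕ} (k : ℝ → EuclideanSpace ℝ (Fin d)) (t : ℝ) : ℝ :=
  variationOnFromTo k (Ici 0) 0 t

lemma monotone_totalVariation {d : ℕ} {k : ℝ → EuclideanSpace ℝ (Fin d)}
    (hk : LocallyBoundedVariationOn k (Ici 0)) : Monotone (totalVariation k) := by
  have h0 : ∀ t : ℝ, t ≤ 0 → totalVariation k t = 0 := by
    intro t ht
    unfold totalVariation
    rw [variationOnFromTo.eq_of_ge k (Ici 0) ht]
    have : (Ici (0 : ℝ) ∩ Icc t 0).Subsingleton := by
      intro a ha b hb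
      exact (le_antisymm ha.2.2 ha.1).trans (le_antisymm hb.1 hb.2.2)
    simp [eVariationOn.subsingleton k this]
  intro s t hst
  rcases le_total s 0 with hs | hs
  · rw [h0 s hs]
    rcases le_total t 0 with ht | ht
    · rw [h0 t ht]
    · exact variationOnFromTo.nonneg_of_le k (Ici 0) ht
  · exact variationOnFromTo.monotoneOn hk (mem_Ici.2 le_rfl) (mem_Ici.2 hs)
      (mem_Ici.2 (hs.trans hst)) hst

open scoped Classical in
/-- The Lebesgue--Stieltjes measure `d|k|` of a right continuous path `k` of locally bounded
variation on `[0, ∞)`; it is carried by `(0, ∞)` and gives mass `|k|_b - |k|_a` to `(a, b]`. -/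
def variationMeasure {d : ℕ} (k : ℝ → EuclideanSpace ℝ (Fin d)) : Measure ℝ :=
  if hk : LocallyBoundedVariationOn k (Ici 0) then
    (monotone_totalVariation hk).stieltjesFunction.measure
  else 0

/-- The measure `d‖k‖` on `[0, ∞)` associated with `‖k‖_t = |k_0| + |k|_t`: it has, in addition
to `d|k|`, an atom of mass `|k_0|` at time `0`. -/
def normVariationMeasure {d : ℕ} (k : ℝ → EuclideanSpace ℝ (Fin d)) : Measure ℝ :=
  ENNReal.ofReal ‖k 0‖ • Measure.dirac 0 + variationMeasure k

/-- `(x, k)` is a solution of the (generalized) Skorokhod problem in `D` associated with `y`. -/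
structure IsSkorokhodSolution {d : ℕ} (D : Set (EuclideanSpace ℝ (Fin d)))
    (y x k : ℝ → EuclideanSpace ℝ (Fin d)) : Prop where
  cadlag_x : IsCadlag x
  cadlag_k : IsCadlag k
  eq_add : ∀ t : ℝ, 0 ≤ t → x t = y t + k t
  mem_closure : ∀ t : ℝ, 0 ≤ t → x t ∈ closure D
  locallyBoundedVariation : LocallyBoundedVariationOn k (Ici 0)
  initial : k 0 = proj D (y 0) - y 0
  eq_integral : ∀ t : ℝ, 0 ≤ t →
    k t = k 0 + ∫ s in Ioc 0 t, inwardNormal D (x s) ∂(variationMeasure k)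
  variation_eq : ∀ t : ℝ, 0 ≤ t →
    totalVariation k t =
      ∫ s in Ioc 0 t, (frontier D).indicator (fun _ => (1 : ℝ)) (x s) ∂(variationMeasure k)

/-- `(x, k)` solves the `n`-th penalized equation driven by `y`:
`x_t = y_t + k_t` with `k_t = -n ∫_0^t (x_s - Π(x_s)) ds`. -/
structure IsPenalizedSolution {d : ℕ} (D : Set (EuclideanSpace ℝ (Fin d))) (n : ℕ)
    (y x k : ℝ → EuclideanSpace ℝ (Fin d)) : Prop where
  cadlag_x : IsCadlag x
  eq_add : ∀ t : ℝ, 0 ≤ t → x t = y t + k t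
  eq_integral : ∀ t : ℝ, 0 ≤ t → k t = -((n : ℝ) • ∫ s in (0 : ℝ)..t, (x s - proj D (x s)))

/-- The term `∫_0^{|Δk_s|} ḡ(s, x_s - r n(x_s)) dr` of the limit functional at time `s`, where
`ḡ(s, z) = g(s, z) - g(s, Π(z))`. -/
def jumpTerm {d : ℕ} (D : Set (EuclideanSpace ℝ (Fin d)))
    (g : ℝ → EuclideanSpace ℝ (Fin d) → ℝ) (x k : ℝ → EuclideanSpace ℝ (Fin d)) (s : ℝ) : ℝ :=
  ∫ r in (0 : ℝ)..‖jump k s‖,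
    (g s (x s - r • inwardNormal D (x s)) - g s (proj D (x s - r • inwardNormal D (x s))))

/-- The limit functional `I_T(g, x, k)`. -/
def limitFunctional {d : ℕ} (D : Set (EuclideanSpace ℝ (Fin d))) (T : ℝ)
    (g : ℝ → EuclideanSpace ℝ (Fin d) → ℝ) (x k : ℝ → EuclideanSpace ℝ (Fin d)) : ℝ :=
  (∫ s in Icc 0 T, g s (x s) ∂(normVariationMeasure k)) + ∑' s : Icc (0 : ℝ) T, jumpTerm D g x k s

end

end Reflection

open Reflection

namespace Reflection

/-! ### Projection on a convex set and inward normals -/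

section Geometry

variable {d : ℕ} {D : Set (EuclideanSpace ℝ (Fin d))}

/-! Write e(z) = z - Π(z). The force -n e(xⁿ) points along the inward normal at Π(xⁿ), so d|kⁿ| =
n|e(xⁿ)| ds. Cut [0, T] into finitely many cells [s, t) on which y and x oscillate little. At time s
the limit jumps from y_s + k_{s-} to its projection x_s. The penalized path crosses the same gap
continuously, close to the exponential ray x_s - exp(-n(u - a)) Δk_s, where a is the image of s
under the time change. Hence d|kⁿ| charges the whole segment by arc length, and the limit sees ∫
g(s, x_s - r n(x_s)) dr over [0, |Δk_s|] rather than |Δk_s| g(s, x_s). Since Π is constantly x_s on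
this segment, the difference is exactly the jump term.

Two properties of e control kⁿ. Coercivity around an interior ball (`mul_norm_excess_le_inner`)
yields a Lyapunov function on each cell, hence a bound on |kⁿ|_T uniform in large n
(`exists_variation_bound`). Monotonicity of e (`inner_excess_sub_nonneg`) bounds the distance of kⁿ
to the exponential ray (`IsPenalizedSolution.comparison`). Combined with the supporting inequality
for the normals, which handles the reflection of the limit inside a cell, this gives a one-cell
estimate (`IsSkorokhodSolution.step`). Its errors add up over the cells, so kⁿ at the time-changed
point s tends to the left limit k_{s-} (`tendsto_preValue`): the jump at s is carried out inside the
cell that starts at s.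

For the integral, let ν be the normal at x_s and f(u) = ⟨ν, kⁿ_u - kⁿ_a⟩. On the cell |dkⁿ/du| is
close to f', because Π(xⁿ) stays near x_s, and xⁿ_u is close to x_s - (|Δk_s| - f(u))ν. Substituting
v = f(u) turns the cell integral into one that depends on n only through f at the right end, which
converges (`integral_near_segment`, `integral_penalized_near`). The limiting cell integral is the
jump term at s plus the integral of g(r, x_r) over [s, t) against d‖k‖, up to a small multiple of
the mass of [s, t) (`integral_segment_near`). Jumps strictly inside cells are small, and their jump
terms are negligible in total. -/

lemma proj_spec (hne : D.Nonempty) (x : EuclideanSpace ℝ (Fin d)) :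
    proj D x ∈ closure D ∧ dist (proj D x) x = Metric.infDist x (closure D) := by
  have h := isClosed_closure.exists_infDist_eq_dist (hne.closure) x
  obtain ⟨p, hp, hpx⟩ := h
  exact Classical.epsilon_spec
    (p := fun p => p ∈ closure D ∧ dist p x = Metric.infDist x (closure D))
    ⟨p, hp, by rw [hpx, dist_comm]⟩

lemma proj_mem (hne : D.Nonempty) (x : EuclideanSpace ℝ (Fin d)) : proj D x ∈ closure D :=
  (proj_spec hne x).1

/-- The excess `z - Π(z)`, the gradient of half the squared distance to `D`. -/
noncomputable def excess (D : Set (EuclideanSpace ℝ (Fin d))) (z : EuclideanSpace ℝ (Fin d)) :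
    EuclideanSpace ℝ (Fin d) := z - proj D z

lemma norm_excess_le (hne : D.Nonempty) (x : EuclideanSpace ℝ (Fin d))
    {p : EuclideanSpace ℝ (Fin d)} (hp : p ∈ closure D) : ‖excess D x‖ ≤ ‖x - p‖ := by
  have h := (proj_spec hne x).2
  rw [excess, ← dist_eq_norm, dist_comm, h, ← dist_eq_norm]
  exact Metric.infDist_le_dist_of_mem hp

lemma inner_excess_le (hne : D.Nonempty) (hc : Convex ℝ D) (x : EuclideanSpace ℝ (Fin d))
    {p : EuclideanSpace ℝ (Fin d)} (hp : p ∈ closure D) :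
    inner ℝ (excess D x) (p - proj D x) ≤ 0 := by
  have hne' : Nonempty (closure D) := ⟨⟨proj D x, proj_mem hne x⟩⟩
  refine (norm_eq_iInf_iff_real_inner_le_zero hc.closure (proj_mem hne x)).1 ?_ p hp
  refine le_antisymm ?_ ?_
  · exact le_ciInf fun w => norm_excess_le hne x w.2
  · exact ciInf_le ⟨0, by rintro _ ⟨w, rfl⟩; exact norm_nonneg _⟩
      (⟨proj D x, proj_mem hne x⟩ : closure D)

/-- Adding the obtuse-angle inequalities at the two projections shows ⟨Πx - Πz, e(x) - e(z)⟩ ≥ 0.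
This firm monotonicity yields both the Lipschitz bound for the projection and the stability of the
penalized equation. -/
lemma inner_excess_sub_nonneg (hne : D.Nonempty) (hc : Convex ℝ D)
    (x z : EuclideanSpace ℝ (Fin d)) :
    ‖excess D x - excess D z‖ ^ 2 ≤ inner ℝ (x - z) (excess D x - excess D z) := by
  have h1 := inner_excess_le hne hc x (proj_mem hne z)
  have h2 := inner_excess_le hne hc z (proj_mem hne x)
  have e1 : x - z = (excess D x - excess D z) + (proj D x - proj D z) := by
    simp only [excess]; abel
  have e2 : inner ℝ (proj D x - proj D z) (excess D x - excess D z)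
      = - inner ℝ (excess D x) (proj D z - proj D x)
        - inner ℝ (excess D z) (proj D x - proj D z) := by
    simp only [inner_sub_left, inner_sub_right, real_inner_comm]; ring
  rw [e1, inner_add_left, real_inner_self_eq_norm_sq, e2]
  linarith

lemma norm_proj_sub_le (hne : D.Nonempty) (hc : Convex ℝ D)
    (x z : EuclideanSpace ℝ (Fin d)) : ‖proj D x - proj D z‖ ≤ ‖x - z‖ := by
  have h := inner_excess_sub_nonneg hne hc x z
  have e : proj D x - proj D z = (x - z) - (excess D x - excess D z) := by
    simp only [excess]; abel
  have h2 : ‖proj D x - proj D z‖ ^ 2 ≤ ‖x - z‖ ^ 2 := by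
    rw [e, norm_sub_sq_real]
    nlinarith [sq_nonneg ‖excess D x - excess D z‖]
  exact (sq_le_sq₀ (norm_nonneg _) (norm_nonneg _)).1 h2

lemma continuous_proj (hne : D.Nonempty) (hc : Convex ℝ D) : Continuous (proj D) :=
  (LipschitzWith.of_dist_le_mul (K := 1) fun x z => by
    simpa [dist_eq_norm] using norm_proj_sub_le hne hc x z).continuous

lemma continuous_excess (hne : D.Nonempty) (hc : Convex ℝ D) : Continuous (excess D) :=
  continuous_id.sub (continuous_proj hne hc)

/-- The squared distance between two solutions of the variational inequality is the sum of the two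
inequalities, each tested at the other point. -/
lemma proj_eq_of_inner_le (hne : D.Nonempty) (hc : Convex ℝ D)
    {x p : EuclideanSpace ℝ (Fin d)} (hp : p ∈ closure D)
    (h : ∀ z ∈ closure D, inner ℝ (x - p) (z - p) ≤ 0) : proj D x = p := by
  have h1 := inner_excess_le hne hc x hp
  have h2 := h _ (proj_mem hne x)
  have e : ‖proj D x - p‖ ^ 2 = inner ℝ (excess D x) (p - proj D x)
      + inner ℝ (x - p) (proj D x - p) := by
    rw [← real_inner_self_eq_norm_sq]
    simp only [excess, inner_sub_left, inner_sub_right, real_inner_comm]; ring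
  have h3 : ‖proj D x - p‖ ^ 2 = 0 := le_antisymm (by linarith) (sq_nonneg _)
  exact sub_eq_zero.1 (norm_eq_zero.1 (pow_eq_zero_iff (two_ne_zero) |>.1 h3))

lemma proj_eq_self (hne : D.Nonempty) {x : EuclideanSpace ℝ (Fin d)} (hx : x ∈ closure D) :
    proj D x = x := by
  have h := (proj_spec hne x).2
  rw [Metric.infDist_zero_of_mem hx] at h
  exact dist_eq_zero.1 h

/-- The variational inequality at p is positively homogeneous in q - p. This makes the exponential
ray solve the unforced penalized equation. -/
lemma excess_ray (hne : D.Nonempty) (hc : Convex ℝ D) {q p : EuclideanSpace ℝ (Fin d)}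
    (hq : proj D q = p) {l : ℝ} (hl : 0 ≤ l) :
    proj D (p + l • (q - p)) = p := by
  subst hq
  refine proj_eq_of_inner_le hne hc (proj_mem hne q) fun z hz => ?_
  rw [add_sub_cancel_left, real_inner_smul_left]
  exact mul_nonpos_of_nonneg_of_nonpos hl (inner_excess_le hne hc q hz)

/-- Around an interior point the excess is coercive. -/
lemma mul_norm_excess_le_inner (hne : D.Nonempty) (hc : Convex ℝ D)
    {c : EuclideanSpace ℝ (Fin d)} {r : ℝ} (hr : 0 ≤ r) (hball : Metric.closedBall c r ⊆ D)
    (z : EuclideanSpace ℝ (Fin d)) :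
    r * ‖excess D z‖ ≤ inner ℝ (z - c) (excess D z) := by
  rcases eq_or_ne (excess D z) 0 with h0 | h0
  · simp [h0]
  have hn : 0 < ‖excess D z‖ := norm_pos_iff.2 h0
  -- The point of the ball farthest in the direction of the excess gives the sharpest test of the
  -- obtuse-angle inequality.
  have hp : c + (r / ‖excess D z‖) • excess D z ∈ closure D := by
    apply subset_closure; apply hball
    rw [Metric.mem_closedBall, dist_eq_norm, add_sub_cancel_left, norm_smul, Real.norm_eq_abs,
      abs_of_nonneg (by positivity)]
    field_simp; exact le_rfl
  have h := inner_excess_le hne hc z hp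
  have e : inner ℝ (excess D z) (c + (r / ‖excess D z‖) • excess D z - proj D z)
      = r * ‖excess D z‖ + ‖excess D z‖ ^ 2 - inner ℝ (z - c) (excess D z) := by
    have : c + (r / ‖excess D z‖) • excess D z - proj D z
      = (r / ‖excess D z‖) • excess D z + excess D z - (z - c) := by
      simp only [excess]; abel
    rw [this, inner_sub_right, inner_add_right, real_inner_smul_right, real_inner_self_eq_norm_sq,
      real_inner_comm]
    field_simp
  nlinarith [sq_nonneg ‖excess D z‖]

/-- If the projection were interior, a small move from it towards z would stay in D and violate the
obtuse-angle inequality. -/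
lemma proj_mem_frontier (hD : IsOpen D) (hne : D.Nonempty) (hc : Convex ℝ D)
    {z : EuclideanSpace ℝ (Fin d)} (hz : excess D z ≠ 0) : proj D z ∈ frontier D := by
  rw [frontier, hD.interior_eq]
  refine ⟨proj_mem hne z, fun hmem => hz ?_⟩
  have hcont : Tendsto (fun t : ℝ => proj D z + t • excess D z) (𝓝[>] 0) (𝓝 (proj D z)) := by
    have : Continuous (fun t : ℝ => proj D z + t • excess D z) := by fun_prop
    simpa using (this.tendsto 0).mono_left nhdsWithin_le_nhds
  obtain ⟨t, ht, ht0⟩ := ((hcont.eventually (hD.mem_nhds hmem)).and self_mem_nhdsWithin).exists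
  have h := inner_excess_le hne hc z (subset_closure ht)
  rw [add_sub_cancel_left, real_inner_smul_right, real_inner_self_eq_norm_sq] at h
  have : ‖excess D z‖ ^ 2 ≤ 0 := by
    by_contra hcon
    push Not at hcon
    exact absurd h (not_le.2 (mul_pos ht0 hcon))
  exact norm_eq_zero.1 (pow_eq_zero_iff (two_ne_zero) |>.1 (le_antisymm this (sq_nonneg _)))

/-! ### Supporting vectors at a smooth boundary point -/

lemma IsLocalDefiningFunction.hasDerivAt_line {p : EuclideanSpace ℝ (Fin d)}
    {U : Set (EuclideanSpace ℝ (Fin d))} {ρ : EuclideanSpace ℝ (Fin d) → ℝ}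
    (h : IsLocalDefiningFunction D p U ρ) (v : EuclideanSpace ℝ (Fin d)) :
    HasDerivAt (fun t : ℝ => ρ (p + t • v)) (inner ℝ (gradient ρ p) v) 0 := by
  have hd : DifferentiableAt ℝ ρ p :=
    ((h.contDiffOn.contDiffAt (h.isOpen.mem_nhds h.mem)).differentiableAt (by norm_num))
  have hg := hd.hasGradientAt.hasFDerivAt
  have hl : HasDerivAt (fun t : ℝ => p + t • v) v 0 := by
    simpa using ((hasDerivAt_id (0 : ℝ)).smul_const v).const_add p
  have hg' : HasFDerivAt ρ (InnerProductSpace.toDual ℝ _ (gradient ρ p)) (p + (0 : ℝ) • v) := by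
    simpa using hg
  have := hg'.comp_hasDerivAt 0 hl
  rwa [InnerProductSpace.toDual_apply_apply] at this

lemma IsLocalDefiningFunction.eventually_line {p : EuclideanSpace ℝ (Fin d)}
    {U : Set (EuclideanSpace ℝ (Fin d))} {ρ : EuclideanSpace ℝ (Fin d) → ℝ}
    (h : IsLocalDefiningFunction D p U ρ) (v : EuclideanSpace ℝ (Fin d)) :
    ∀ᶠ t : ℝ in 𝓝[>] 0, p + t • v ∈ U := by
  have : Continuous (fun t : ℝ => p + t • v) := by fun_prop
  have h2 : Tendsto (fun t : ℝ => p + t • v) (𝓝[>] 0) (𝓝 p) := by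
    simpa using (this.tendsto 0).mono_left nhdsWithin_le_nhds
  exact h2.eventually (h.isOpen.mem_nhds h.mem)

/-- A positive value would put p in the open set D, and a negative one would keep a whole
neighbourhood of p out of D. -/
lemma IsLocalDefiningFunction.apply_eq_zero {p : EuclideanSpace ℝ (Fin d)}
    {U : Set (EuclideanSpace ℝ (Fin d))} {ρ : EuclideanSpace ℝ (Fin d) → ℝ} (hD : IsOpen D)
    (h : IsLocalDefiningFunction D p U ρ) (hp : p ∈ frontier D) : ρ p = 0 := by
  have hp' := hp
  rw [frontier, hD.interior_eq] at hp'
  refine le_antisymm (not_lt.1 fun hlt => hp'.2 ((h.mem_iff p h.mem).2 hlt)) ?_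
  have hcont : ContinuousAt ρ p :=
    (h.contDiffOn.contDiffAt (h.isOpen.mem_nhds h.mem)).continuousAt
  by_contra hneg
  push Not at hneg
  have hev := (hcont.eventually (gt_mem_nhds hneg)).and (h.isOpen.mem_nhds h.mem)
  obtain ⟨w, ⟨hw1, hw2⟩, hw3⟩ := mem_closure_iff_nhds.1 hp'.1 _ hev
  exact absurd ((h.mem_iff w hw2).1 hw3) (not_lt.2 hw1.le)

lemma isInwardUnitNormal_inwardNormal (hD : IsBoundedConvexC2Domain D)
    {p : EuclideanSpace ℝ (Fin d)} (hp : p ∈ frontier D) :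
    IsInwardUnitNormal D p (inwardNormal D p) := by
  obtain ⟨U, ρ, h⟩ := hD.boundary p hp
  exact Classical.epsilon_spec (p := IsInwardUnitNormal D p) ⟨_, hp, U, ρ, h, rfl⟩

lemma norm_inwardNormal (hD : IsBoundedConvexC2Domain D)
    {p : EuclideanSpace ℝ (Fin d)} (hp : p ∈ frontier D) : ‖inwardNormal D p‖ = 1 := by
  obtain ⟨-, U, ρ, h, e⟩ := isInwardUnitNormal_inwardNormal hD hp
  rw [e, norm_smul, norm_inv, norm_norm, inv_mul_cancel₀ (norm_ne_zero_iff.2 h.gradient_ne_zero)]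

/-- By convexity the segment from p to a point of D lies in D after leaving p, so the defining
function rises from 0 along it and its directional derivative is nonnegative. The closure follows by
continuity. -/
lemma inner_sub_inwardNormal_nonneg (hD : IsBoundedConvexC2Domain D)
    {p z : EuclideanSpace ℝ (Fin d)} (hp : p ∈ frontier D) (hz : z ∈ closure D) :
    0 ≤ inner ℝ (z - p) (inwardNormal D p) := by
  obtain ⟨-, U, ρ, h, e⟩ := isInwardUnitNormal_inwardNormal hD hp
  have key : ∀ z ∈ D, 0 ≤ inner ℝ (z - p) (inwardNormal D p) := by
    intro z hz
    rw [e, real_inner_smul_right, real_inner_comm]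
    refine mul_nonneg (by positivity) ?_
    have hder := h.hasDerivAt_line (z - p)
    have hs := hder.tendsto_slope.mono_left
      (nhdsWithin_mono (0 : ℝ) (show Ioi (0 : ℝ) ⊆ {0}ᶜ from fun t ht => ne_of_gt ht))
    refine ge_of_tendsto hs ?_
    filter_upwards [h.eventually_line (z - p), self_mem_nhdsWithin,
      Ioc_mem_nhdsGT (zero_lt_one : (0 : ℝ) < 1)] with t htU ht0 ht1
    have hmem : p + t • (z - p) ∈ D := by
      have := hD.convex.combo_closure_interior_mem_interior (x := p) (y := z)
        (frontier_subset_closure hp) (by rwa [hD.isOpen.interior_eq])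
        (a := 1 - t) (b := t) (by linarith [ht1.2]) ht1.1 (by ring)
      rw [hD.isOpen.interior_eq] at this
      convert this using 1
      module
    have := (h.mem_iff _ htU).1 hmem
    rw [slope_def_field]
    simp only [zero_smul, add_zero, sub_zero, h.apply_eq_zero hD.isOpen hp]
    exact div_nonneg this.le ht1.1.le
  have hcl : IsClosed {z | 0 ≤ inner ℝ (z - p) (inwardNormal D p)} :=
    isClosed_le continuous_const (by fun_prop)
  exact closure_minimal (fun z hz => key z hz) hcl hz

/-- The inward unit normal is the only unit vector supporting `D` at a boundary point. -/
lemma eq_inwardNormal (hD : IsBoundedConvexC2Domain D)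
    {p v : EuclideanSpace ℝ (Fin d)} (hp : p ∈ frontier D) (hv : ‖v‖ = 1)
    (hs : ∀ z ∈ D, 0 ≤ inner ℝ (z - p) v) : v = inwardNormal D p := by
  have hn := norm_inwardNormal hD hp
  obtain ⟨-, U, ρ, h, e⟩ := isInwardUnitNormal_inwardNormal hD hp
  by_contra hne
  set ν := inwardNormal D p with hν
  have hlt : inner ℝ ν v < 1 := by
    refine lt_of_le_of_ne ((real_inner_le_norm _ _).trans (by simp [hn, hv])) fun h1 => hne ?_
    exact ((inner_eq_one_iff_of_norm_eq_one hn hv).1 h1).symm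
  -- The direction ν - v has positive product with the gradient, so it enters D, but negative
  -- product with v, so v cannot support D.
  have hder := h.hasDerivAt_line (ν - v)
  have hg : gradient ρ p = ‖gradient ρ p‖ • ν := by
    rw [e, smul_smul, mul_inv_cancel₀ (norm_ne_zero_iff.2 h.gradient_ne_zero), one_smul]
  have hpos : 0 < inner ℝ (gradient ρ p) (ν - v) := by
    rw [hg, real_inner_smul_left, inner_sub_right, real_inner_self_eq_norm_sq, hn]
    have := norm_pos_iff.2 h.gradient_ne_zero
    nlinarith
  have hs' := hder.tendsto_slope.mono_left
    (nhdsWithin_mono (0 : ℝ) (show Ioi (0 : ℝ) ⊆ {0}ᶜ from fun t ht => ne_of_gt ht))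
  obtain ⟨t, ⟨ht1, ht2⟩, ht0⟩ := ((hs'.eventually (lt_mem_nhds hpos)).and
    (h.eventually_line (ν - v))).and self_mem_nhdsWithin |>.exists
  have ht0 : 0 < t := ht0
  rw [slope_def_field] at ht1
  simp only [zero_smul, add_zero, sub_zero, h.apply_eq_zero hD.isOpen hp] at ht1
  have hmem := (h.mem_iff _ ht2).2 ((div_pos_iff_of_pos_right ht0).1 ht1)
  have := hs _ hmem
  rw [add_sub_cancel_left, real_inner_smul_left, inner_sub_left, real_inner_self_eq_norm_sq,
    hv] at this
  nlinarith

lemma excess_eq_smul_inwardNormal (hD : IsBoundedConvexC2Domain D)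
    (z : EuclideanSpace ℝ (Fin d)) :
    excess D z = -(‖excess D z‖ • inwardNormal D (proj D z)) := by
  rcases eq_or_ne (excess D z) 0 with h0 | h0
  · simp [h0]
  have hn : 0 < ‖excess D z‖ := norm_pos_iff.2 h0
  rw [← eq_inwardNormal hD (v := -(‖excess D z‖⁻¹ • excess D z))
    (proj_mem_frontier hD.isOpen hD.nonempty hD.convex h0), smul_neg, neg_neg, smul_smul,
    mul_inv_cancel₀ hn.ne', one_smul]
  · rw [norm_neg, norm_smul, norm_inv, norm_norm, inv_mul_cancel₀ hn.ne']
  · intro w hw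
    rw [inner_neg_right, real_inner_smul_right, real_inner_comm]
    have := inner_excess_le hD.nonempty hD.convex z (subset_closure hw)
    have h2 : 0 ≤ ‖excess D z‖⁻¹ := by positivity
    nlinarith

lemma proj_sub_smul_inwardNormal (hD : IsBoundedConvexC2Domain D)
    {p : EuclideanSpace ℝ (Fin d)} (hp : p ∈ frontier D) {r : ℝ} (hr : 0 ≤ r) :
    proj D (p - r • inwardNormal D p) = p := by
  refine proj_eq_of_inner_le hD.nonempty hD.convex (frontier_subset_closure hp) fun z hz => ?_
  have := inner_sub_inwardNormal_nonneg hD hp hz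
  rw [sub_sub_cancel_left, inner_neg_left, real_inner_smul_left, real_inner_comm]
  nlinarith

/-- By compactness of the unit ball it suffices to identify subsequential limits. Such a limit is a
unit vector supporting D at p, and that vector is unique; no comparison of local defining functions
is needed. -/
lemma continuousOn_inwardNormal (hD : IsBoundedConvexC2Domain D) :
    ContinuousOn (inwardNormal D) (frontier D) := by
  intro p hp
  rw [ContinuousWithinAt, tendsto_iff_seq_tendsto]
  intro q hq
  have hqf : ∀ᶠ j in atTop, q j ∈ frontier D := hq.eventually self_mem_nhdsWithin
  have hqp : Tendsto q atTop (𝓝 p) := tendsto_nhds_of_tendsto_nhdsWithin hq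
  refine tendsto_of_subseq_tendsto fun ns hns => ?_
  have hmem : ∃ᶠ j in atTop, inwardNormal D (q (ns j)) ∈
      Metric.closedBall (0 : EuclideanSpace ℝ (Fin d)) 1 := by
    refine Eventually.frequently ?_
    filter_upwards [hns.eventually hqf] with j hj
    simp [norm_inwardNormal hD hj]
  obtain ⟨v, -, φ, hφ, hv⟩ :=
    (isCompact_closedBall (0 : EuclideanSpace ℝ (Fin d)) 1).tendsto_subseq' hmem
  refine ⟨φ, ?_⟩
  have hsub : Tendsto (fun j => ns (φ j)) atTop atTop := hns.comp hφ.tendsto_atTop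
  have hv' : Tendsto (fun j => inwardNormal D (q (ns (φ j)))) atTop (𝓝 v) := hv
  suffices v = inwardNormal D p by simpa [this] using hv'
  refine eq_inwardNormal hD hp ?_ fun z hz => ?_
  · refine tendsto_nhds_unique hv'.norm (tendsto_const_nhds.congr' ?_)
    filter_upwards [hsub.eventually hqf] with j hj using (norm_inwardNormal hD hj).symm
  · refine ge_of_tendsto (((hqp.comp hsub).const_sub z).inner hv') ?_
    filter_upwards [hsub.eventually hqf] with j hj
    exact inner_sub_inwardNormal_nonneg hD hj (subset_closure hz)

/-- A continuous extension of the inward normal to the whole space, of norm at most one. -/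
lemma exists_normal_extension (hD : IsBoundedConvexC2Domain D) :
    ∃ N : EuclideanSpace ℝ (Fin d) → EuclideanSpace ℝ (Fin d), Continuous N ∧
      (∀ z, ‖N z‖ ≤ 1) ∧ ∀ p ∈ frontier D, N p = inwardNormal D p := by
  have : TietzeExtension (EuclideanSpace ℝ (Fin d)) :=
    TietzeExtension.of_homeo (EuclideanSpace.equiv (Fin d) ℝ).toHomeomorph
  obtain ⟨G, hG⟩ := ContinuousMap.exists_restrict_eq (Y := EuclideanSpace ℝ (Fin d))
    (isClosed_frontier (s := D))
    ⟨(frontier D).domRestrict (inwardNormal D), (continuousOn_inwardNormal hD).domRestrict⟩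
  -- The Tietze extension may be large off the boundary; radial truncation to the unit ball fixes
  -- the unit vectors prescribed on the boundary.
  refine ⟨fun z => (max 1 ‖G z‖)⁻¹ • G z, ?_, fun z => ?_, fun p hp => ?_⟩
  · refine Continuous.smul (Continuous.inv₀ (continuous_const.max G.continuous.norm) fun z => ?_)
      G.continuous
    positivity
  · rw [norm_smul, norm_inv, Real.norm_eq_abs, abs_of_pos (by positivity), inv_mul_le_iff₀
      (by positivity)]
    simp
  · have : G p = inwardNormal D p := DFunLike.congr_fun hG (⟨p, hp⟩ : frontier D)
    simp [this, norm_inwardNormal hD hp]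

end Geometry

/-! ### Càdlàg functions -/

section Cadlag

lemma measurable_comp_max_of_rightContinuous {M : Type*} [PseudoMetricSpace M]
    [MeasurableSpace M] [BorelSpace M] {f : ℝ → M}
    (hf : ∀ t : ℝ, 0 ≤ t → ContinuousWithinAt f (Ici t) t) :
    Measurable (fun t => f (max t 0)) := by
  -- These grid points approach t strictly from the right, where f is continuous, and take countably
  -- many values, so each approximation factors through ℤ.
  let a : ℕ → ℝ → ℝ := fun j t => ((⌊((j : ℝ) + 1) * t⌋ : ℤ) + 1) / ((j : ℝ) + 1)
  have ha1 : ∀ j t, t ≤ a j t := fun j t => by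
    have : (0 : ℝ) < (j : ℝ) + 1 := by positivity
    rw [le_div_iff₀ this, mul_comm]
    exact (Int.lt_floor_add_one _).le
  have ha2 : ∀ j t, a j t ≤ t + 1 / ((j : ℝ) + 1) := fun j t => by
    have : (0 : ℝ) < (j : ℝ) + 1 := by positivity
    rw [div_le_iff₀ this, add_mul t, one_div, inv_mul_cancel₀ this.ne', mul_comm t]
    linarith [Int.floor_le (((j : ℝ) + 1) * t)]
  have hlim : ∀ t, Tendsto (fun j => a j t) atTop (𝓝 t) := fun t => by
    refine tendsto_of_tendsto_of_tendsto_of_le_of_le tendsto_const_nhds ?_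
      (fun j => ha1 j t) (fun j => ha2 j t)
    simpa using (tendsto_one_div_add_atTop_nhds_zero_nat (𝕜 := ℝ)).const_add t
  refine measurable_of_tendsto_metrizable (f := fun j t => f (max (a j t) 0)) (fun j => ?_) ?_
  · have h1 : Measurable (fun z : ℤ => f (max (((z : ℝ) + 1) / ((j : ℝ) + 1)) 0)) :=
      measurable_from_top
    exact h1.comp (Int.measurable_floor.comp (measurable_const_mul ((j : ℝ) + 1)))
  · rw [tendsto_pi_nhds]
    intro t
    have h := hf (max t 0) (le_max_right _ _)
    refine h.tendsto.comp (tendsto_nhdsWithin_iff.2 ⟨(hlim t).max tendsto_const_nhds, ?_⟩)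
    exact Eventually.of_forall fun j => max_le_max (ha1 j t) le_rfl

variable {M : Type*} [PseudoMetricSpace M] {f : ℝ → M}

/-- `t 0 < ⋯ < t m` is a partition of `[0, S]` such that `f` stays `ε`-close to `f (t i)` on
`[t i, t (i + 1))`. -/
structure IsFinePartition (f : ℝ → M) (ε S : ℝ) (m : ℕ) (t : ℕ → ℝ) : Prop where
  zero : t 0 = 0
  last : t m = S
  lt : ∀ i < m, t i < t (i + 1)
  dist_le : ∀ i < m, ∀ s ∈ Ico (t i) (t (i + 1)), dist (f s) (f (t i)) ≤ ε

lemma IsFinePartition.extend {ε S S' : ℝ} {m : ℕ} {t : ℕ → ℝ} (h : IsFinePartition f ε S m t)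
    (hS : S < S') (hosc : ∀ s ∈ Ico S S', dist (f s) (f S) ≤ ε) :
    IsFinePartition f ε S' (m + 1) (fun i => if i ≤ m then t i else S') where
  zero := by simp [h.zero]
  last := by simp
  lt i hi := by
    rcases Nat.lt_succ_iff_lt_or_eq.1 hi with hi' | rfl
    · simp [hi'.le, Nat.succ_le_of_lt hi', h.lt i hi']
    · simp [h.last, hS]
  dist_le i hi := by
    rcases Nat.lt_succ_iff_lt_or_eq.1 hi with hi' | rfl
    · simpa [hi'.le, Nat.succ_le_of_lt hi'] using h.dist_le i hi'
    · simpa [h.last] using hosc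

lemma IsFinePartition.le_of_le {ε S : ℝ} {m : ℕ} {t : ℕ → ℝ} (h : IsFinePartition f ε S m t)
    {i j : ℕ} (hij : i ≤ j) (hj : j ≤ m) : t i ≤ t j := by
  induction j, hij using Nat.le_induction with
  | base => exact le_rfl
  | succ j hij ih => exact (ih (by omega)).trans (h.lt j (by omega)).le

lemma IsFinePartition.nonneg {ε S : ℝ} {m : ℕ} {t : ℕ → ℝ} (h : IsFinePartition f ε S m t)
    {i : ℕ} (hi : i ≤ m) : 0 ≤ t i := h.zero ▸ h.le_of_le (Nat.zero_le i) hi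

lemma IsFinePartition.le_last {ε S : ℝ} {m : ℕ} {t : ℕ → ℝ} (h : IsFinePartition f ε S m t)
    {i : ℕ} (hi : i ≤ m) : t i ≤ S := h.last ▸ h.le_of_le hi le_rfl

lemma exists_mem_Ico_of_mem {m : ℕ} {t : ℕ → ℝ} {s : ℝ} (h0 : t 0 ≤ s) (h1 : s < t m) :
    ∃ i < m, s ∈ Ico (t i) (t (i + 1)) := by
  induction m with
  | zero => exact absurd h0 (not_le.2 h1)
  | succ m ih =>
    rcases lt_or_ge s (t m) with h | h
    · obtain ⟨i, hi, his⟩ := ih h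
      exact ⟨i, by omega, his⟩
    · exact ⟨m, by omega, h, h1⟩

/-- Consider the supremum b of the endpoints that can be reached. The left limit at b shows that b
itself is reached, and right continuity extends the partition beyond b unless b = S. -/
lemma exists_isFinePartition (hr : ∀ t : ℝ, 0 ≤ t → ContinuousWithinAt f (Ici t) t)
    (hl : ∀ t : ℝ, 0 < t → ∃ l, Tendsto f (𝓝[<] t) (𝓝 l)) {ε S : ℝ} (hε : 0 < ε) (hS : 0 ≤ S) :
    ∃ m t, IsFinePartition f ε S m t := by
  let A : Set ℝ := {b | b ∈ Icc 0 S ∧ ∃ m t, IsFinePartition f ε b m t}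
  have h0 : (0 : ℝ) ∈ A := ⟨⟨le_rfl, hS⟩, 0, fun _ => 0, ⟨rfl, rfl, by simp, by simp⟩⟩
  have hbdd : BddAbove A := ⟨S, fun b hb => hb.1.2⟩
  set b := sSup A with hb
  have hb0 : 0 ≤ b := le_csSup hbdd h0
  have hbS : b ≤ S := csSup_le ⟨0, h0⟩ fun c hc => hc.1.2
  have hbA : b ∈ A := by
    rcases hb0.eq_or_lt with hb0 | hb0
    · rw [← hb0]; exact h0
    obtain ⟨l, hl⟩ := hl b hb0
    have hev := hl.eventually (Metric.ball_mem_nhds l (half_pos hε))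
    obtain ⟨c, hc, hcl⟩ := (mem_nhdsLT_iff_exists_Ioo_subset).1 hev
    obtain ⟨a, haA, hca⟩ := exists_lt_of_lt_csSup ⟨0, h0⟩ (show c < sSup A from hc)
    have hab : a ≤ b := le_csSup hbdd haA
    rcases hab.eq_or_lt with rfl | hab
    · exact haA
    obtain ⟨m, t, ht⟩ := haA.2
    refine ⟨⟨hb0.le, hbS⟩, _, _, ht.extend hab fun s hs => ?_⟩
    have h1 : dist (f s) l < ε / 2 := hcl ⟨hca.trans_le hs.1, hs.2⟩
    have h2 : dist (f a) l < ε / 2 := hcl ⟨hca, hab⟩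
    linarith [dist_triangle_right (f s) (f a) l]
  rcases hbS.eq_or_lt with hbS | hbS
  · rw [← hbS]; exact hbA.2
  exfalso
  have hev := (hr b hb0).eventually (Metric.ball_mem_nhds (f b) hε)
  obtain ⟨c, hc, hcl⟩ := (mem_nhdsGE_iff_exists_Ico_subset).1 hev
  obtain ⟨m, t, ht⟩ := hbA.2
  have hlt : b < min c S := lt_min hc hbS
  have : min c S ∈ A := ⟨⟨hb0.trans hlt.le, min_le_right _ _⟩, _, _, ht.extend hlt fun s hs =>
    (hcl ⟨hs.1, hs.2.trans_le (min_le_left _ _)⟩ : dist (f s) (f b) < ε).le⟩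
  exact absurd (le_csSup hbdd this) (not_le.2 hlt)

variable {d : ℕ} {y : ℝ → EuclideanSpace ℝ (Fin d)}

lemma IsCadlag.exists_bound (hy : IsCadlag y) (S : ℝ) :
    ∃ C, 0 ≤ C ∧ ∀ s ∈ Icc 0 S, ‖y s‖ ≤ C := by
  obtain ⟨m, t, ht⟩ := exists_isFinePartition hy.1 hy.2 zero_lt_one
    (show 0 ≤ max S 0 + 1 by positivity)
  refine ⟨∑ i ∈ Finset.range m, (‖y (t i)‖ + 1), Finset.sum_nonneg fun i _ => by positivity,
    fun s hs => ?_⟩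
  obtain ⟨i, hi, his⟩ := exists_mem_Ico_of_mem (t := t) (m := m) (s := s)
    (by rw [ht.zero]; exact hs.1) (by rw [ht.last]; linarith [hs.2, le_max_left S 0])
  have h1 := ht.dist_le i hi s his
  rw [dist_eq_norm] at h1
  calc ‖y s‖ ≤ ‖y (t i)‖ + 1 := by
        linarith [norm_sub_norm_le (y s) (y (t i))]
    _ ≤ _ := Finset.single_le_sum (f := fun i => ‖y (t i)‖ + 1) (fun i _ => by positivity)
        (Finset.mem_range.2 hi)

lemma IsCadlag.measurable_comp_max (hy : IsCadlag y) : Measurable (fun t => y (max t 0)) :=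
  measurable_comp_max_of_rightContinuous hy.1

lemma IsCadlag.tendsto_leftLim (hy : IsCadlag y) {t : ℝ} (ht : 0 < t) :
    Tendsto y (𝓝[<] t) (𝓝 (Function.leftLim y t)) := by
  obtain ⟨l, hl⟩ := hy.2 t ht
  rwa [leftLim_eq_of_tendsto hl]

/-- The value before the jump, with the convention `k_{0-} = 0`. -/
noncomputable def preValue (k : ℝ → EuclideanSpace ℝ (Fin d)) (t : ℝ) :
    EuclideanSpace ℝ (Fin d) := if t = 0 then 0 else Function.leftLim k t

lemma jump_eq_sub_preValue (k : ℝ → EuclideanSpace ℝ (Fin d)) (t : ℝ) :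
    jump k t = k t - preValue k t := by
  unfold jump preValue
  split_ifs with h
  · simp [h]
  · rfl

lemma IsCadlag.tendsto_preValue (hy : IsCadlag y) {t : ℝ} (ht : 0 < t) :
    Tendsto y (𝓝[<] t) (𝓝 (preValue y t)) := by
  rw [preValue, if_neg ht.ne']
  exact hy.tendsto_leftLim ht

/-- The space-time paths of two càdlàg functions admit fine partitions. -/
lemma exists_isFinePartition_prod {x : ℝ → EuclideanSpace ℝ (Fin d)} (hy : IsCadlag y)
    (hx : IsCadlag x) {ε S : ℝ} (hε : 0 < ε) (hS : 0 ≤ S) :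
    ∃ m t, IsFinePartition (fun s => (s, y s, x s)) ε S m t := by
  refine exists_isFinePartition (fun t ht => ?_) (fun t ht => ?_) hε hS
  · exact continuousWithinAt_id.prodMk ((hy.1 t ht).prodMk (hx.1 t ht))
  · obtain ⟨l, hl⟩ := hy.2 t ht
    obtain ⟨l', hl'⟩ := hx.2 t ht
    exact ⟨(t, l, l'), (tendsto_id.mono_left nhdsWithin_le_nhds).prodMk_nhds
      (hl.prodMk_nhds hl')⟩

end Cadlag

/-! ### Primitives of right continuous functions -/

section Primitive

/-- `G` is right continuous and locally bounded on `[0, ∞)`. -/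
def IsRightRegular {F : Type*} [NormedAddCommGroup F] (G : ℝ → F) : Prop :=
  (∀ t : ℝ, 0 ≤ t → ContinuousWithinAt G (Ici t) t) ∧
    ∀ S : ℝ, ∃ C, ∀ s ∈ Icc 0 S, ‖G s‖ ≤ C

variable {F : Type*} [NormedAddCommGroup F] {G : ℝ → F}

lemma IsRightRegular.norm (hG : IsRightRegular G) : IsRightRegular (fun s => ‖G s‖) :=
  ⟨fun t ht => (hG.1 t ht).norm, fun S => by simpa using hG.2 S⟩

lemma IsRightRegular.mul {a b : ℝ → ℝ} (ha : IsRightRegular a) (hb : IsRightRegular b) :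
    IsRightRegular (fun s => a s * b s) :=
  ⟨fun t ht => (ha.1 t ht).mul (hb.1 t ht), fun S => by
    obtain ⟨C, hC⟩ := ha.2 S
    obtain ⟨C', hC'⟩ := hb.2 S
    refine ⟨C * C', fun s hs => ?_⟩
    rw [norm_mul]
    exact mul_le_mul (hC s hs) (hC' s hs) (norm_nonneg _) ((norm_nonneg _).trans (hC s hs))⟩

lemma IsCadlag.isRightRegular_comp {d : ℕ} {z : ℝ → EuclideanSpace ℝ (Fin d)} (hz : IsCadlag z)
    {H : ℝ → EuclideanSpace ℝ (Fin d) → F}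
    (hH : ContinuousOn (Function.uncurry H) (Ici 0 ×ˢ univ)) :
    IsRightRegular (fun s => H s (z s)) := by
  refine ⟨fun t ht => ?_, fun S => ?_⟩
  · have h := hH (t, z t) ⟨ht, mem_univ _⟩
    exact h.comp (f := fun s => (s, z s)) (continuousWithinAt_id.prodMk (hz.1 t ht))
      fun s hs => ⟨ht.trans hs, mem_univ _⟩
  · obtain ⟨C, -, hC⟩ := hz.exists_bound S
    have hK : IsCompact (Icc 0 S ×ˢ Metric.closedBall (0 : EuclideanSpace ℝ (Fin d)) C) :=
      isCompact_Icc.prod (isCompact_closedBall _ _)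
    obtain ⟨M, hM⟩ := hK.exists_bound_of_continuousOn
      (hH.mono (prod_mono Icc_subset_Ici_self (subset_univ _)))
    exact ⟨M, fun s hs => hM (s, z s) ⟨hs, by simpa using hC s hs⟩⟩

lemma IsCadlag.isRightRegular_continuous {d : ℕ} {z : ℝ → EuclideanSpace ℝ (Fin d)}
    (hz : IsCadlag z) {H : EuclideanSpace ℝ (Fin d) → F} (hH : Continuous H) :
    IsRightRegular (fun s => H (z s)) :=
  hz.isRightRegular_comp (H := fun _ z => H z) (hH.comp continuous_snd).continuousOn

variable [SecondCountableTopology F] [MeasurableSpace F] [BorelSpace F]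

lemma IsRightRegular.aestronglyMeasurable (hG : IsRightRegular G) (μ : Measure ℝ) :
    AEStronglyMeasurable G (μ.restrict (Ici 0)) :=
  (measurable_comp_max_of_rightContinuous hG.1).aestronglyMeasurable.congr <| by
    filter_upwards [ae_restrict_mem measurableSet_Ici] with s hs
    rw [max_eq_left hs]

lemma IsRightRegular.integrableOn (hG : IsRightRegular G) {μ : Measure ℝ} {S : ℝ}
    (hμ : μ (Icc 0 S) ≠ ⊤) : IntegrableOn G (Icc 0 S) μ := by
  obtain ⟨C, hC⟩ := hG.2 S
  have h1 : AEStronglyMeasurable G (μ.restrict (Icc 0 S)) :=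
    (hG.aestronglyMeasurable μ).mono_measure (Measure.restrict_mono Icc_subset_Ici_self le_rfl)
  have hfin : IsFiniteMeasure (μ.restrict (Icc 0 S)) := ⟨by
    rw [Measure.restrict_apply_univ]; exact hμ.lt_top⟩
  refine Integrable.of_bound h1 C ?_
  filter_upwards [ae_restrict_mem measurableSet_Icc] with s hs using hC s hs

lemma IsRightRegular.intervalIntegrable (hG : IsRightRegular G) {a b : ℝ} (ha : 0 ≤ a)
    (hb : 0 ≤ b) : IntervalIntegrable G volume a b := by
  rw [intervalIntegrable_iff]
  refine (hG.integrableOn (S := max a b) (by simp)).mono_set fun s hs => ?_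
  exact ⟨(le_min ha hb).trans hs.1.le, hs.2⟩

variable [NormedSpace ℝ F]

lemma IsRightRegular.hasDerivWithinAt [CompleteSpace F] (hG : IsRightRegular G) {t : ℝ} (ht : 0 ≤ t) :
    HasDerivWithinAt (fun u => ∫ s in (0 : ℝ)..u, G s) (G t) (Ici t) t := by
  refine intervalIntegral.integral_hasDerivWithinAt_right (t := Ioi t)
    (hG.intervalIntegrable le_rfl ht) ⟨Ioi t, self_mem_nhdsWithin, ?_⟩
    ((hG.1 t ht).mono Ioi_subset_Ici_self)
  exact (hG.aestronglyMeasurable volume).mono_measure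
    (Measure.restrict_mono (fun s hs => ht.trans (le_of_lt hs)) le_rfl)

lemma IsRightRegular.continuousOn (hG : IsRightRegular G) {a b : ℝ} (ha : 0 ≤ a) :
    ContinuousOn (fun u => ∫ s in (0 : ℝ)..u, G s) (Icc a b) := by
  rcases lt_or_ge b 0 with hb | hb
  · rw [Icc_eq_empty (by linarith)]; exact continuousOn_empty _
  have := intervalIntegral.continuousOn_primitive_interval' (a := 0)
    (hG.intervalIntegrable le_rfl hb) (by simp)
  rw [uIcc_of_le hb] at this
  exact this.mono (Icc_subset_Icc_left ha)

lemma IsRightRegular.integral_sub (hG : IsRightRegular G) {a b : ℝ} (ha : 0 ≤ a)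
    (hb : 0 ≤ b) :
    (∫ s in (0 : ℝ)..b, G s) - ∫ s in (0 : ℝ)..a, G s = ∫ s in a..b, G s :=
  intervalIntegral.integral_interval_sub_left (hG.intervalIntegrable le_rfl hb)
    (hG.intervalIntegrable le_rfl ha)

end Primitive

/-! ### The variation measure of a primitive -/

section Variation

variable {d : ℕ} {G K : ℝ → EuclideanSpace ℝ (Fin d)}

lemma totalVariation_of_nonpos (k : ℝ → EuclideanSpace ℝ (Fin d)) {t : ℝ} (ht : t ≤ 0) :
    totalVariation k t = 0 := by
  unfold totalVariation
  rw [variationOnFromTo.eq_of_ge k (Ici 0) ht]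
  have : (Ici (0 : ℝ) ∩ Icc t 0).Subsingleton := by
    intro a ha b hb
    exact (le_antisymm ha.2.2 ha.1).trans (le_antisymm hb.1 hb.2.2)
  simp [eVariationOn.subsingleton k this]

lemma norm_sub_le_integral_norm (hG : IsRightRegular G)
    (hK : ∀ t, 0 ≤ t → K t = K 0 + ∫ s in (0 : ℝ)..t, G s) {a b : ℝ} (ha : 0 ≤ a) (hab : a ≤ b) :
    ‖K b - K a‖ ≤ (∫ s in (0 : ℝ)..b, ‖G s‖) - ∫ s in (0 : ℝ)..a, ‖G s‖ := by
  rw [hK b (ha.trans hab), hK a ha, add_sub_add_left_eq_sub, hG.integral_sub ha (ha.trans hab),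
    hG.norm.integral_sub ha (ha.trans hab)]
  exact intervalIntegral.norm_integral_le_integral_norm hab

lemma monotoneOn_integral_norm (hG : IsRightRegular G) :
    MonotoneOn (fun t => ∫ s in (0 : ℝ)..t, ‖G s‖) (Ici 0) := by
  intro a ha b hb hab
  rw [← sub_nonneg, hG.norm.integral_sub ha hb]
  exact intervalIntegral.integral_nonneg hab fun s _ => norm_nonneg _

/-- Each increment of K is dominated by that of the monotone function ∫‖G‖, whose variation is its
total increment. -/
lemma eVariationOn_primitive_le (hG : IsRightRegular G)
    (hK : ∀ t, 0 ≤ t → K t = K 0 + ∫ s in (0 : ℝ)..t, G s) {a b : ℝ} (ha : 0 ≤ a) (hb : 0 ≤ b) :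
    eVariationOn K (Ici 0 ∩ Icc a b) ≤
      ENNReal.ofReal ((∫ s in (0 : ℝ)..b, ‖G s‖) - ∫ s in (0 : ℝ)..a, ‖G s‖) := by
  refine le_trans ?_ ((monotoneOn_integral_norm hG).eVariationOn_eq ha hb).le
  refine iSup_mono fun p => Finset.sum_le_sum fun i _ => ?_
  have h0 : 0 ≤ p.2.1 i := (p.2.2.2 i).1
  have h1 : p.2.1 i ≤ p.2.1 (i + 1) := p.2.2.1 (Nat.le_succ i)
  rw [edist_dist, edist_dist, dist_eq_norm, dist_eq_norm]
  exact ENNReal.ofReal_le_ofReal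
    ((norm_sub_le_integral_norm hG hK h0 h1).trans (Real.le_norm_self _))

lemma locallyBoundedVariationOn_primitive (hG : IsRightRegular G)
    (hK : ∀ t, 0 ≤ t → K t = K 0 + ∫ s in (0 : ℝ)..t, G s) :
    LocallyBoundedVariationOn K (Ici 0) := fun _ _ ha hb =>
  ne_top_of_le_ne_top ENNReal.ofReal_ne_top (eVariationOn_primitive_le hG hK ha hb)

lemma norm_sub_le_totalVariation_sub (hK : LocallyBoundedVariationOn K (Ici 0)) {a b : ℝ}
    (ha : 0 ≤ a) (hab : a ≤ b) : ‖K b - K a‖ ≤ totalVariation K b - totalVariation K a := by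
  have hb := ha.trans hab
  have h := variationOnFromTo.add hK (mem_Ici.2 le_rfl) (mem_Ici.2 ha) (mem_Ici.2 hb)
  have h2 : ‖K b - K a‖ ≤ variationOnFromTo K (Ici 0) a b := by
    rw [variationOnFromTo.eq_of_le K _ hab]
    have := eVariationOn.edist_le K (s := Ici 0 ∩ Icc a b) ⟨hb, right_mem_Icc.2 hab⟩
      ⟨ha, left_mem_Icc.2 hab⟩
    rw [edist_dist, dist_eq_norm] at this
    exact (ENNReal.ofReal_le_iff_le_toReal (hK a b ha hb)).1 this
  simp only [totalVariation]
  linarith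

lemma totalVariation_sub_le (hG : IsRightRegular G)
    (hK : ∀ t, 0 ≤ t → K t = K 0 + ∫ s in (0 : ℝ)..t, G s) {a b : ℝ} (ha : 0 ≤ a) (hab : a ≤ b) :
    totalVariation K b - totalVariation K a ≤
      (∫ s in (0 : ℝ)..b, ‖G s‖) - ∫ s in (0 : ℝ)..a, ‖G s‖ := by
  have hb := ha.trans hab
  have h := variationOnFromTo.add (locallyBoundedVariationOn_primitive hG hK)
    (mem_Ici.2 le_rfl) (mem_Ici.2 ha) (mem_Ici.2 hb)
  have h2 : variationOnFromTo K (Ici 0) a b ≤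
      (∫ s in (0 : ℝ)..b, ‖G s‖) - ∫ s in (0 : ℝ)..a, ‖G s‖ := by
    rw [variationOnFromTo.eq_of_le K _ hab]
    exact ENNReal.toReal_le_of_le_ofReal
      (sub_nonneg.2 (monotoneOn_integral_norm hG ha hb hab)) (eVariationOn_primitive_le hG hK ha hb)
  simp only [totalVariation]
  linarith

/-- For the lower bound, consider ∫‖G‖ - |K|. Its right difference quotients are at most those of
∫‖G‖ minus the norms of those of K, and both converge to ‖G‖ by right continuity. A continuous
function starting at 0 with nonpositive right slopes in the limit stays nonpositive. -/
lemma totalVariation_primitive (hG : IsRightRegular G)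
    (hK : ∀ t, 0 ≤ t → K t = K 0 + ∫ s in (0 : ℝ)..t, G s) {t : ℝ} (ht : 0 ≤ t) :
    totalVariation K t = ∫ s in (0 : ℝ)..t, ‖G s‖ := by
  set W : ℝ → ℝ := fun t => ∫ s in (0 : ℝ)..t, ‖G s‖ with hW
  have hBV := locallyBoundedVariationOn_primitive hG hK
  have hv0 : totalVariation K 0 = 0 := totalVariation_of_nonpos K le_rfl
  have hW0 : W 0 = 0 := by simp [hW]
  have hWc : ContinuousOn W (Icc 0 t) := hG.norm.continuousOn le_rfl
  refine le_antisymm (by simpa [hv0] using totalVariation_sub_le hG hK le_rfl ht) ?_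
  have hvc : ContinuousOn (totalVariation K) (Icc 0 t) := by
    have habs : ∀ a ∈ Icc 0 t, ∀ b ∈ Icc 0 t,
        |totalVariation K b - totalVariation K a| ≤ |W b - W a| := by
      intro a ha b hb
      have hm := monotone_totalVariation hBV
      rcases le_total a b with hab | hab
      · rw [abs_of_nonneg (sub_nonneg.2 (hm hab))]
        exact (totalVariation_sub_le hG hK ha.1 hab).trans (le_abs_self _)
      · rw [abs_sub_comm, abs_of_nonneg (sub_nonneg.2 (hm hab)), abs_sub_comm (W b)]
        exact (totalVariation_sub_le hG hK hb.1 hab).trans (le_abs_self _)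
    intro a ha
    have h1 := hWc a ha
    rw [ContinuousWithinAt, tendsto_iff_norm_sub_tendsto_zero] at h1 ⊢
    refine squeeze_zero' (Eventually.of_forall fun _ => norm_nonneg _) ?_ h1
    filter_upwards [self_mem_nhdsWithin] with b hb using habs a ha b hb
  have key := image_le_of_liminf_slope_right_le_deriv_boundary
    (f := fun s => W s - totalVariation K s) (B := fun _ => 0) (B' := fun _ => 0)
    (hWc.sub hvc) (by simp [hv0, hW0]) continuousOn_const
    (fun s _ => hasDerivWithinAt_const _ _ _) (fun s hs r hr => ?_) (right_mem_Icc.2 ht)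
  · linarith
  · refine Eventually.frequently ?_
    have hK' : HasDerivWithinAt K (G s) (Ici s) s := by
      refine ((hG.hasDerivWithinAt hs.1).const_add (K 0)).congr (fun u hu => ?_) (hK s hs.1)
      exact hK u (hs.1.trans hu)
    have hW' : HasDerivWithinAt W ‖G s‖ (Ici s) s := hG.norm.hasDerivWithinAt hs.1
    have h1 := (hasDerivWithinAt_iff_tendsto_slope' (by simp)).1
      (hK'.mono Ioi_subset_Ici_self)
    have h2 := (hasDerivWithinAt_iff_tendsto_slope' (by simp)).1
      (hW'.mono Ioi_subset_Ici_self)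
    have h3 := h2.sub h1.norm
    rw [sub_self] at h3
    filter_upwards [h3.eventually (gt_mem_nhds hr), self_mem_nhdsWithin] with u hu hsu
    refine lt_of_le_of_lt ?_ hu
    have hsu' : 0 < u - s := sub_pos.2 hsu
    have h4 := norm_sub_le_totalVariation_sub hBV hs.1 (le_of_lt hsu)
    rw [slope_def_field, slope_def_field, slope_def_module, norm_smul, norm_inv,
      Real.norm_of_nonneg hsu'.le, inv_mul_eq_div, ← sub_div]
    exact div_le_div_of_nonneg_right (by linarith) hsu'.le

lemma variationMeasure_primitive_Ioc (hG : IsRightRegular G)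
    (hK : ∀ t, 0 ≤ t → K t = K 0 + ∫ s in (0 : ℝ)..t, G s) {a b : ℝ} (ha : 0 ≤ a) :
    variationMeasure K (Ioc a b) = ENNReal.ofReal (∫ s in Ioc a b, ‖G s‖) := by
  rcases lt_or_ge b a with hab | hab
  · simp [Ioc_eq_empty (not_lt.2 hab.le)]
  have hBV := locallyBoundedVariationOn_primitive hG hK
  have hlim : ∀ t, 0 ≤ t → (monotone_totalVariation hBV).stieltjesFunction t =
      ∫ s in (0 : ℝ)..t, ‖G s‖ := by
    intro t ht
    rw [Monotone.stieltjesFunction_eq]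
    refine rightLim_eq_of_tendsto ?_
    have h := (hG.norm.hasDerivWithinAt ht).continuousWithinAt.tendsto.mono_left
      (nhdsWithin_mono t Ioi_subset_Ici_self)
    refine h.congr' ?_
    filter_upwards [self_mem_nhdsWithin] with u hu
    exact (totalVariation_primitive hG hK (ht.trans (le_of_lt hu))).symm
  rw [variationMeasure, dif_pos hBV, StieltjesFunction.measure_Ioc, hlim a ha,
    hlim b (ha.trans hab), hG.norm.integral_sub ha (ha.trans hab),
    intervalIntegral.integral_of_le hab]

lemma isLocallyFiniteMeasure_variationMeasure (k : ℝ → EuclideanSpace ℝ (Fin d)) :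
    IsLocallyFiniteMeasure (variationMeasure k) := by
  unfold variationMeasure
  split_ifs <;> infer_instance

lemma setIntegral_variationMeasure_primitive (hG : IsRightRegular G)
    (hK : ∀ t, 0 ≤ t → K t = K 0 + ∫ s in (0 : ℝ)..t, G s) (φ : ℝ → ℝ) {T : ℝ} (hT : 0 ≤ T) :
    ∫ s in Ioc 0 T, φ s ∂(variationMeasure K) = ∫ s in (0 : ℝ)..T, φ s * ‖G s‖ := by
  have := isLocallyFiniteMeasure_variationMeasure K
  -- Right continuity is known only on [0, ∞); replacing s by `max s 0` gives a density measurable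
  -- on the whole line without changing it on the domain of integration.
  set ρ : ℝ → ENNReal := fun s => ENNReal.ofReal ‖G (max s 0)‖ with hρ
  have hρm : Measurable ρ :=
    (measurable_comp_max_of_rightContinuous hG.1).norm.ennreal_ofReal
  have hmeas : (variationMeasure K).restrict (Ioc 0 T) =
      (volume.withDensity ρ).restrict (Ioc 0 T) := by
    refine Measure.ext_of_Ioc _ _ fun a b _ => ?_
    rw [Measure.restrict_apply measurableSet_Ioc, Measure.restrict_apply measurableSet_Ioc,
      Ioc_inter_Ioc, variationMeasure_primitive_Ioc hG hK le_sup_right,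
      withDensity_apply _ measurableSet_Ioc, ofReal_integral_eq_lintegral_ofReal]
    · refine setLIntegral_congr_fun measurableSet_Ioc fun s hs => ?_
      rw [hρ]
      dsimp only
      rw [max_eq_left]
      exact le_sup_right.trans hs.1.le
    · refine (hG.norm.integrableOn (S := b ⊓ T) (by simp)).mono_set ?_
      exact Ioc_subset_Icc_self.trans (Icc_subset_Icc_left le_sup_right)
    · exact Eventually.of_forall fun s => norm_nonneg _
  rw [hmeas, setIntegral_withDensity_eq_setIntegral_toReal_smul hρm
    (Eventually.of_forall fun s => ENNReal.ofReal_lt_top) _ measurableSet_Ioc,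
    intervalIntegral.integral_of_le hT]
  refine setIntegral_congr_fun measurableSet_Ioc fun s hs => ?_
  simp only [hρ, max_eq_left hs.1.le, ENNReal.toReal_ofReal (norm_nonneg _), smul_eq_mul, mul_comm]

end Variation

/-! ### A priori estimates for the penalized equation -/

section Penalized

variable {d : ℕ} {D : Set (EuclideanSpace ℝ (Fin d))} {n : ℕ}
  {Y z K : ℝ → EuclideanSpace ℝ (Fin d)}

/-- The drift `-n (z_s - Π(z_s))` of the penalized equation. -/
noncomputable def drift (D : Set (EuclideanSpace ℝ (Fin d))) (n : ℕ)
    (z : ℝ → EuclideanSpace ℝ (Fin d)) (s : ℝ) : EuclideanSpace ℝ (Fin d) :=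
  -((n : ℝ) • excess D (z s))

/-- The total variation on `[0, t]` of the penalization term. -/
noncomputable def penaltyVariation (D : Set (EuclideanSpace ℝ (Fin d))) (n : ℕ)
    (z : ℝ → EuclideanSpace ℝ (Fin d)) (t : ℝ) : ℝ := ∫ s in (0 : ℝ)..t, ‖drift D n z s‖

lemma norm_drift (s : ℝ) : ‖drift D n z s‖ = n * ‖excess D (z s)‖ := by
  rw [drift, norm_neg, norm_smul, Real.norm_natCast]

lemma isRightRegular_drift (hne : D.Nonempty) (hc : Convex ℝ D) (hz : IsCadlag z) :
    IsRightRegular (drift D n z) :=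
  hz.isRightRegular_continuous (H := fun w => -((n : ℝ) • excess D w))
    (by have := continuous_excess hne hc; fun_prop)

lemma IsPenalizedSolution.eq_integral_drift (h : IsPenalizedSolution D n Y z K) {t : ℝ}
    (ht : 0 ≤ t) : K t = ∫ s in (0 : ℝ)..t, drift D n z s := by
  rw [h.eq_integral t ht, ← intervalIntegral.integral_smul, ← intervalIntegral.integral_neg]
  rfl

lemma IsPenalizedSolution.zero (h : IsPenalizedSolution D n Y z K) : K 0 = 0 := by
  simp [h.eq_integral 0 le_rfl]

lemma IsPenalizedSolution.eq_zero_add (h : IsPenalizedSolution D n Y z K) (t : ℝ) (ht : 0 ≤ t) :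
    K t = K 0 + ∫ s in (0 : ℝ)..t, drift D n z s := by
  rw [h.zero, zero_add, h.eq_integral_drift ht]

lemma IsPenalizedSolution.hasDerivWithinAt (h : IsPenalizedSolution D n Y z K) (hne : D.Nonempty)
    (hc : Convex ℝ D) {t : ℝ} (ht : 0 ≤ t) : HasDerivWithinAt K (drift D n z t) (Ici t) t :=
  ((isRightRegular_drift hne hc h.cadlag_x).hasDerivWithinAt ht).congr
    (fun _ hu => h.eq_integral_drift (ht.trans hu)) (h.eq_integral_drift ht)

lemma IsPenalizedSolution.continuousOn (h : IsPenalizedSolution D n Y z K) (hne : D.Nonempty)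
    (hc : Convex ℝ D) {a b : ℝ} (ha : 0 ≤ a) : ContinuousOn K (Icc a b) :=
  ((isRightRegular_drift hne hc h.cadlag_x).continuousOn ha).congr
    fun _ hu => h.eq_integral_drift (ha.trans hu.1)

lemma hasDerivWithinAt_penaltyVariation (hne : D.Nonempty) (hc : Convex ℝ D) (hz : IsCadlag z)
    {t : ℝ} (ht : 0 ≤ t) :
    HasDerivWithinAt (penaltyVariation D n z) (n * ‖excess D (z t)‖) (Ici t) t := by
  rw [← norm_drift]
  exact (isRightRegular_drift hne hc hz).norm.hasDerivWithinAt ht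

lemma continuousOn_penaltyVariation (hne : D.Nonempty) (hc : Convex ℝ D) (hz : IsCadlag z)
    {a b : ℝ} (ha : 0 ≤ a) : ContinuousOn (penaltyVariation D n z) (Icc a b) :=
  (isRightRegular_drift hne hc hz).norm.continuousOn ha

lemma penaltyVariation_zero : penaltyVariation D n z 0 = 0 := by simp [penaltyVariation]

lemma penaltyVariation_mono (hne : D.Nonempty) (hc : Convex ℝ D) (hz : IsCadlag z) {a b : ℝ}
    (ha : 0 ≤ a) (hab : a ≤ b) : penaltyVariation D n z a ≤ penaltyVariation D n z b :=
  monotoneOn_integral_norm (isRightRegular_drift hne hc hz) ha (ha.trans hab) hab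

lemma IsPenalizedSolution.norm_sub_le (h : IsPenalizedSolution D n Y z K) (hne : D.Nonempty)
    (hc : Convex ℝ D) {a b : ℝ} (ha : 0 ≤ a) (hab : a ≤ b) :
    ‖K b - K a‖ ≤ penaltyVariation D n z b - penaltyVariation D n z a :=
  norm_sub_le_integral_norm (isRightRegular_drift hne hc h.cadlag_x) h.eq_zero_add ha hab

/-- While `Y` stays close to `Y a`, the variation of the penalization term is controlled by the
distance to an interior point. -/
lemma IsPenalizedSolution.variation_add_sq_le (h : IsPenalizedSolution D n Y z K)
    (hne : D.Nonempty) (hc : Convex ℝ D) {c : EuclideanSpace ℝ (Fin d)} {r a b : ℝ} (hr : 0 ≤ r)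
    (hball : Metric.closedBall c r ⊆ D) (ha : 0 ≤ a)
    (hY : ∀ s ∈ Ico a b, ‖Y s - Y a‖ ≤ r / 2) {t : ℝ} (ht : t ∈ Icc a b) :
    r * (penaltyVariation D n z t - penaltyVariation D n z a) + ‖Y a + K t - c‖ ^ 2 ≤
      ‖Y a + K a - c‖ ^ 2 := by
  have hK := h.continuousOn hne hc (b := b) ha
  -- The left side is a Lyapunov function. Its right derivative is r n|e| - 2n⟨Y a + K - c, e⟩.
  -- Coercivity supplies r|e| in the product and the oscillation of Y costs at most (r/2)|e|, so the
  -- derivative is nonpositive.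
  refine image_le_of_deriv_right_le_deriv_boundary
    (f := fun t => r * (penaltyVariation D n z t - penaltyVariation D n z a)
      + ‖Y a + K t - c‖ ^ 2)
    (f' := fun t => r * (n * ‖excess D (z t)‖) + 2 * inner ℝ (Y a + K t - c) (drift D n z t))
    (B := fun _ => ‖Y a + K a - c‖ ^ 2) (B' := fun _ => 0) ?_ ?_ (by simp) continuousOn_const
    (fun _ _ => hasDerivWithinAt_const _ _ _) ?_ ht
  · exact (((continuousOn_penaltyVariation hne hc h.cadlag_x ha).sub continuousOn_const).const_smul
      r).add (((continuousOn_const.add hK).sub continuousOn_const).norm.pow 2)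
  · intro s hs
    have hs0 := ha.trans hs.1
    exact (((hasDerivWithinAt_penaltyVariation hne hc h.cadlag_x hs0).sub_const _).const_mul r).add
      (((h.hasDerivWithinAt hne hc hs0).const_add (Y a)).sub_const c).norm_sq
  · intro s hs
    have hs0 := ha.trans hs.1
    have h1 := mul_norm_excess_le_inner hne hc hr hball (z s)
    have h2 : inner ℝ (Y s - Y a) (excess D (z s)) ≤ r / 2 * ‖excess D (z s)‖ :=
      (real_inner_le_norm _ _).trans (mul_le_mul_of_nonneg_right (hY s hs) (norm_nonneg _))
    have e : Y a + K s - c = (z s - c) - (Y s - Y a) := by rw [h.eq_add s hs0]; abel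
    have h3 : r / 2 * ‖excess D (z s)‖ ≤ inner ℝ (Y a + K s - c) (excess D (z s)) := by
      rw [e, inner_sub_left]; linarith
    have h4 := mul_le_mul_of_nonneg_left h3 (Nat.cast_nonneg (α := ℝ) n)
    rw [drift, inner_neg_right, real_inner_smul_right]
    linarith

/-- The exponential ray from `q` to `p`, which solves the penalized equation without input when
`p` is the projection of `q`. -/
noncomputable def expRay (n : ℕ) (p q : EuclideanSpace ℝ (Fin d)) (s : ℝ) :
    EuclideanSpace ℝ (Fin d) := p + Real.exp (-(n * s)) • (q - p)

lemma expRay_zero (p q : EuclideanSpace ℝ (Fin d)) : expRay n p q 0 = q := by simp [expRay]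

lemma hasDerivAt_exp_neg_mul_sub (c a s : ℝ) :
    HasDerivAt (fun s : ℝ => Real.exp (-(c * (s - a)))) (-(c * Real.exp (-(c * (s - a))))) s := by
  have h0 : HasDerivAt (fun s : ℝ => -(c * (s - a))) (-(c * 1)) s :=
    (((hasDerivAt_id s).sub_const a).const_mul c).neg
  exact h0.exp.congr_deriv (by ring)

lemma hasDerivAt_expRay (p q : EuclideanSpace ℝ (Fin d)) (a s : ℝ) :
    HasDerivAt (fun s => expRay n p q (s - a)) (-((n : ℝ) • (expRay n p q (s - a) - p))) s := by
  have h1 := ((hasDerivAt_exp_neg_mul_sub (n : ℝ) a s).smul_const (q - p)).const_add p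
  refine h1.congr_deriv ?_
  simp only [expRay]
  module

/-- Comparison of a penalized solution with an exponential ray. -/
lemma IsPenalizedSolution.comparison (h : IsPenalizedSolution D n Y z K)
    (hne : D.Nonempty) (hc : Convex ℝ D) {p q c : EuclideanSpace ℝ (Fin d)} {η a b : ℝ}
    (hq : proj D q = p) (ha : 0 ≤ a) (hη : 0 ≤ η) (hY : ∀ s ∈ Ico a b, ‖Y s - c‖ ≤ η) {t : ℝ}
    (ht : t ∈ Icc a b) :
    ‖K t - (expRay n p q (t - a) - c)‖ ^ 2 ≤ ‖K a - (q - c)‖ ^ 2 +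
      2 * η * (penaltyVariation D n z t - penaltyVariation D n z a + ‖q - p‖) := by
  have hK := h.continuousOn hne hc (b := b) ha
  have hu : ∀ s, HasDerivAt (fun s => expRay n p q (s - a))
    (-((n : ℝ) • (expRay n p q (s - a) - p))) s := hasDerivAt_expRay p q a
  have hexp := hasDerivAt_exp_neg_mul_sub (n : ℝ) a
  -- The boundary function is the primitive of 2ηn(|e(z)| + |e(u)|), where u is the ray and |e(u)| =
  -- exp(-n(s - a))|q - p|.
  have key := image_le_of_deriv_right_le_deriv_boundary
    (f := fun t => ‖K t - (expRay n p q (t - a) - c)‖ ^ 2)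
    (f' := fun t => 2 * inner ℝ (K t - (expRay n p q (t - a) - c))
      (drift D n z t - -((n : ℝ) • (expRay n p q (t - a) - p))))
    (B := fun t => ‖K a - (q - c)‖ ^ 2 + 2 * η * (penaltyVariation D n z t -
      penaltyVariation D n z a + (1 - Real.exp (-((n : ℝ) * (t - a)))) * ‖q - p‖))
    (B' := fun t => 2 * η * (n * ‖excess D (z t)‖ +
      (n * Real.exp (-((n : ℝ) * (t - a)))) * ‖q - p‖)) ?_ ?_ ?_ ?_ ?_ ?_ ht
  · refine key.trans ?_
    have : 0 ≤ Real.exp (-((n : ℝ) * (t - a))) * ‖q - p‖ := by positivity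
    nlinarith
  · refine (hK.sub (ContinuousOn.sub ?_ continuousOn_const)).norm.pow 2
    exact fun s _ => (hu s).continuousAt.continuousWithinAt
  · intro s hs
    have hs0 := ha.trans hs.1
    exact ((h.hasDerivWithinAt hne hc hs0).sub
      ((hu s).hasDerivWithinAt.sub_const c)).norm_sq
  · simp [expRay_zero]
  · refine continuousOn_const.add (continuousOn_const.mul (ContinuousOn.add
      ((continuousOn_penaltyVariation hne hc h.cadlag_x ha).sub continuousOn_const) ?_))
    exact Continuous.continuousOn (by fun_prop)
  · intro s hs
    have hs0 := ha.trans hs.1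
    have h1 := ((hasDerivWithinAt_penaltyVariation (n := n) hne hc h.cadlag_x hs0).sub_const
      (penaltyVariation D n z a)).add
        ((((hexp s).hasDerivWithinAt (s := Ici s)).const_sub 1).mul_const ‖q - p‖)
    refine ((h1.const_mul (2 * η)).const_add (‖K a - (q - c)‖ ^ 2)).congr_deriv ?_
    rw [neg_neg]
  · intro s hs
    have hs0 := ha.trans hs.1
    set u := expRay n p q (s - a) with hu'
    have hpu : proj D u = p := by
      rw [hu']; exact excess_ray hne hc hq (Real.exp_pos _).le
    have hxu : excess D u = u - p := by rw [excess, hpu]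
    have hnu : ‖excess D u‖ = Real.exp (-((n : ℝ) * (s - a))) * ‖q - p‖ := by
      rw [hxu, hu', expRay, add_sub_cancel_left, norm_smul, Real.norm_of_nonneg (Real.exp_pos _).le]
    have e1 : drift D n z s - -((n : ℝ) • (u - p)) =
        -((n : ℝ) • (excess D (z s) - excess D u)) := by
      rw [hxu, drift]; module
    have e2 : K s - (u - c) = (z s - u) - (Y s - c) := by rw [h.eq_add s hs0]; abel
    -- The vector K - (u - c) is z - u minus Y - c. Monotonicity makes the first part dissipative,
    -- so only the input error Y - c contributes.
    have h1 : 0 ≤ inner ℝ (z s - u) (excess D (z s) - excess D u) :=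
      (sq_nonneg _).trans (inner_excess_sub_nonneg hne hc _ _)
    have h2 : inner ℝ (Y s - c) (excess D (z s) - excess D u) ≤
        η * (‖excess D (z s)‖ + ‖excess D u‖) :=
      (real_inner_le_norm _ _).trans
        (mul_le_mul (hY s hs) (_root_.norm_sub_le _ _) (norm_nonneg _) hη)
    have h3 : -(η * (‖excess D (z s)‖ + ‖excess D u‖)) ≤
        inner ℝ (K s - (u - c)) (excess D (z s) - excess D u) := by
      rw [e2, inner_sub_left]; linarith
    have h4 := mul_le_mul_of_nonneg_left h3 (Nat.cast_nonneg (α := ℝ) n)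
    rw [e1, inner_neg_right, real_inner_smul_right, mul_assoc (n : ℝ), ← hnu]
    linarith

end Penalized

/-! ### Solutions of the Skorokhod problem -/

section Skorokhod

variable {d : ℕ} {D : Set (EuclideanSpace ℝ (Fin d))} {y x k : ℝ → EuclideanSpace ℝ (Fin d)}

lemma normVariationMeasure_Icc_ne_top (k : ℝ → EuclideanSpace ℝ (Fin d)) (S : ℝ) :
    normVariationMeasure k (Icc 0 S) ≠ ⊤ := by
  have := isLocallyFiniteMeasure_variationMeasure k
  rw [normVariationMeasure, Measure.add_apply, Measure.smul_apply, smul_eq_mul]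
  exact ENNReal.add_ne_top.2 ⟨ENNReal.mul_ne_top ENNReal.ofReal_ne_top (measure_ne_top _ _),
    isCompact_Icc.measure_lt_top.ne⟩

lemma normVariationMeasure_ne_top {A : Set ℝ} {S : ℝ} (hA : A ⊆ Icc 0 S) :
    normVariationMeasure k A ≠ ⊤ :=
  ne_top_of_le_ne_top (normVariationMeasure_Icc_ne_top k S) (measure_mono hA)

lemma isFiniteMeasure_restrict_normVariationMeasure {A : Set ℝ} {S : ℝ} (hA : A ⊆ Icc 0 S) :
    IsFiniteMeasure ((normVariationMeasure k).restrict A) :=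
  ⟨by rw [Measure.restrict_apply_univ]; exact (normVariationMeasure_ne_top hA).lt_top⟩

lemma measurableSet_Ioc_inter_preimage (hx : IsCadlag x) {A : Set (EuclideanSpace ℝ (Fin d))}
    (hA : MeasurableSet A) (t : ℝ) : MeasurableSet {s | s ∈ Ioc 0 t ∧ x s ∈ A} := by
  have : {s | s ∈ Ioc 0 t ∧ x s ∈ A} = Ioc 0 t ∩ (fun s => x (max s 0)) ⁻¹' A := by
    ext s
    simp only [mem_ofPred_eq, mem_inter_iff, mem_preimage]
    refine and_congr_right fun hs => ?_
    rw [max_eq_left hs.1.le]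
  rw [this]
  exact measurableSet_Ioc.inter (hx.measurable_comp_max hA)

lemma IsSkorokhodSolution.totalVariation_eq_measureReal (h : IsSkorokhodSolution D y x k) {t : ℝ}
    (ht : 0 ≤ t) :
    totalVariation k t = (variationMeasure k).real {s | s ∈ Ioc 0 t ∧ x s ∈ frontier D} := by
  have hm := measurableSet_Ioc_inter_preimage h.cadlag_x
    (isClosed_frontier (s := D)).measurableSet t
  rw [h.variation_eq t ht, ← integral_indicator measurableSet_Ioc, ← integral_indicator_one hm]
  refine integral_congr_ae (Eventually.of_forall fun s => ?_)
  by_cases h1 : s ∈ Ioc 0 t <;> by_cases h2 : x s ∈ frontier D <;>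
    simp only [indicator, mem_ofPred_eq, h1, h2, and_self, and_true, and_false, if_true, if_false,
      Pi.one_apply]

/-- Right continuity of |k| comes from the boundary condition: it expresses |k| through the measure
d|k|, so an increment of |k| over (t, u] is at most the d|k|-mass of that interval. Letting u
decrease to t, this mass vanishes. -/
lemma IsSkorokhodSolution.stieltjes_eq (h : IsSkorokhodSolution D y x k) {t : ℝ} (ht : 0 ≤ t) :
    (monotone_totalVariation h.locallyBoundedVariation).stieltjesFunction t =
      totalVariation k t := by
  have := isLocallyFiniteMeasure_variationMeasure k
  have hmono := monotone_totalVariation h.locallyBoundedVariation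
  set R := hmono.stieltjesFunction with hR
  have hle : ∀ u, t < u → totalVariation k u - totalVariation k t ≤ R u - R t := by
    intro u hu
    have h1 : (variationMeasure k).real (Ioc t u) = R u - R t := by
      rw [Measure.real, variationMeasure, dif_pos h.locallyBoundedVariation,
        StieltjesFunction.measure_Ioc, ENNReal.toReal_ofReal]
      exact sub_nonneg.2 (R.mono hu.le)
    rw [h.totalVariation_eq_measureReal ht, h.totalVariation_eq_measureReal (ht.trans hu.le), ← h1,
      sub_le_iff_le_add']
    have hfin : ∀ a b, variationMeasure k (Ioc a b) ≠ ⊤ := fun a b => measure_Ioc_lt_top.ne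
    refine (measureReal_mono (fun s hs => ?_) ?_).trans (measureReal_union_le _ _)
    · rcases le_or_gt s t with hst | hst
      · exact Or.inl ⟨⟨hs.1.1, hst⟩, hs.2⟩
      · exact Or.inr ⟨hst, hs.1.2⟩
    · refine ne_top_of_le_ne_top ?_ (measure_union_le _ _)
      exact ENNReal.add_ne_top.2
        ⟨ne_top_of_le_ne_top (hfin 0 t) (measure_mono fun s hs => hs.1), hfin t u⟩
  have hlim1 : Tendsto (totalVariation k) (𝓝[>] t) (𝓝 (R t)) := by
    rw [hR, Monotone.stieltjesFunction_eq]
    exact hmono.tendsto_rightLim t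
  have hlim2 : Tendsto R (𝓝[>] t) (𝓝 (R t)) :=
    (R.right_continuous t).tendsto.mono_left (nhdsWithin_mono t Ioi_subset_Ici_self)
  refine le_antisymm ?_ ?_
  · have := le_of_tendsto_of_tendsto (hlim1.sub_const (totalVariation k t)) (hlim2.sub_const (R t))
      (by filter_upwards [self_mem_nhdsWithin] with u hu using hle u hu)
    linarith
  · rw [hR, Monotone.stieltjesFunction_eq]
    exact hmono.le_rightLim le_rfl

lemma IsSkorokhodSolution.variationMeasure_Ioc (h : IsSkorokhodSolution D y x k) {t : ℝ}
    (ht : 0 ≤ t) : variationMeasure k (Ioc 0 t) = ENNReal.ofReal (totalVariation k t) := by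
  rw [variationMeasure, dif_pos h.locallyBoundedVariation, StieltjesFunction.measure_Ioc,
    h.stieltjes_eq le_rfl, h.stieltjes_eq ht, totalVariation_of_nonpos k le_rfl, sub_zero]

lemma IsSkorokhodSolution.variationMeasure_singleton_zero (h : IsSkorokhodSolution D y x k) :
    variationMeasure k {0} = 0 := by
  refine measure_mono_null (t := Ioc (-1) 0) (by simp) ?_
  rw [variationMeasure, dif_pos h.locallyBoundedVariation, StieltjesFunction.measure_Ioc,
    h.stieltjes_eq le_rfl, totalVariation_of_nonpos k le_rfl, Monotone.stieltjesFunction_eq,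
    rightLim_eq_of_tendsto (y := 0)]
  · simp
  · refine tendsto_const_nhds.congr' ?_
    filter_upwards [Ioo_mem_nhdsGT (show (-1 : ℝ) < 0 by norm_num)] with s hs
    rw [totalVariation_of_nonpos k hs.2.le]

/-- The total mass of (0, t] is |k|_t, and the boundary condition says that the times spent on the
boundary already carry all of it. -/
lemma IsSkorokhodSolution.variationMeasure_interior (h : IsSkorokhodSolution D y x k) {t : ℝ}
    (ht : 0 ≤ t) : variationMeasure k {s | s ∈ Ioc 0 t ∧ x s ∉ frontier D} = 0 := by
  have := isLocallyFiniteMeasure_variationMeasure k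
  have hm := measurableSet_Ioc_inter_preimage h.cadlag_x
    (isClosed_frontier (s := D)).measurableSet t
  have hfin : variationMeasure k (Ioc 0 t) ≠ ⊤ := measure_Ioc_lt_top.ne
  have hsub : {s | s ∈ Ioc 0 t ∧ x s ∈ frontier D} ⊆ Ioc 0 t := fun s hs => hs.1
  have e : {s | s ∈ Ioc 0 t ∧ x s ∉ frontier D} =
      Ioc 0 t \ {s | s ∈ Ioc 0 t ∧ x s ∈ frontier D} := by ext s; simp; tauto
  rw [e, measure_sdiff hsub hm.nullMeasurableSet (ne_top_of_le_ne_top hfin (measure_mono hsub)),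
    h.variationMeasure_Ioc ht, h.totalVariation_eq_measureReal ht, Measure.real,
    ENNReal.ofReal_toReal (ne_top_of_le_ne_top hfin (measure_mono hsub)), tsub_self]

lemma IsSkorokhodSolution.x_zero (h : IsSkorokhodSolution D y x k) : x 0 = proj D (y 0) := by
  rw [h.eq_add 0 le_rfl, h.initial]; abel

lemma IsSkorokhodSolution.k_zero (h : IsSkorokhodSolution D y x k) : k 0 = -excess D (y 0) := by
  rw [h.initial, excess]; abel

lemma IsSkorokhodSolution.zero_mem_frontier (hD : IsBoundedConvexC2Domain D)
    (h : IsSkorokhodSolution D y x k) (h0 : k 0 ≠ 0) : x 0 ∈ frontier D := by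
  rw [h.x_zero]
  refine proj_mem_frontier hD.isOpen hD.nonempty hD.convex fun he => h0 ?_
  rw [h.k_zero, he, neg_zero]

lemma IsSkorokhodSolution.measure_not_frontier (hD : IsBoundedConvexC2Domain D)
    (h : IsSkorokhodSolution D y x k) (t : ℝ) :
    normVariationMeasure k {s | s ∈ Icc 0 t ∧ x s ∉ frontier D} = 0 := by
  rcases lt_or_ge t 0 with ht | ht
  · simp [Icc_eq_empty (not_le.2 ht)]
  rw [normVariationMeasure, Measure.add_apply, Measure.smul_apply, smul_eq_mul, add_eq_zero]
  constructor
  · by_cases h0 : k 0 = 0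
    · simp [h0]
    · rw [Measure.dirac_apply, indicator_of_notMem, mul_zero]
      exact fun hs => hs.2 (h.zero_mem_frontier hD h0)
  · refine measure_mono_null (t := {0} ∪ {s | s ∈ Ioc 0 t ∧ x s ∉ frontier D}) ?_
      (measure_union_null h.variationMeasure_singleton_zero (h.variationMeasure_interior ht))
    rintro s ⟨hs1, hs2⟩
    rcases hs1.1.eq_or_lt with rfl | hs0
    · exact Or.inl rfl
    · exact Or.inr ⟨⟨hs0, hs1.2⟩, hs2⟩

lemma IsSkorokhodSolution.ae_mem_frontier (hD : IsBoundedConvexC2Domain D)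
    (h : IsSkorokhodSolution D y x k) {A : Set ℝ} {S : ℝ} (hA : A ⊆ Icc 0 S)
    (hAm : MeasurableSet A) :
    ∀ᵐ s ∂((normVariationMeasure k).restrict A), x s ∈ frontier D := by
  rw [ae_restrict_iff' hAm, ae_iff]
  refine measure_mono_null (fun s hs => ?_) (h.measure_not_frontier hD S)
  simp only [mem_ofPred_eq, Classical.not_imp] at hs
  exact ⟨hA hs.1, hs.2⟩

lemma IsSkorokhodSolution.mem_frontier_of_atom (hD : IsBoundedConvexC2Domain D)
    (h : IsSkorokhodSolution D y x k) {t : ℝ} (ht : 0 ≤ t)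
    (hμ : (normVariationMeasure k).real {t} ≠ 0) : x t ∈ frontier D := by
  by_contra hcon
  refine hμ ?_
  rw [Measure.real, measure_mono_null _ (h.measure_not_frontier hD t), ENNReal.toReal_zero]
  rintro s rfl
  exact ⟨⟨ht, le_rfl⟩, hcon⟩

variable {N : EuclideanSpace ℝ (Fin d) → EuclideanSpace ℝ (Fin d)}

lemma IsSkorokhodSolution.integrableOn {F : Type*} [NormedAddCommGroup F]
    [SecondCountableTopology F] [MeasurableSpace F] [BorelSpace F]
    (h : IsSkorokhodSolution D y x k) {N : EuclideanSpace ℝ (Fin d) → F} (hN : Continuous N)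
    {A : Set ℝ} {S : ℝ} (hA : A ⊆ Icc 0 S) :
    IntegrableOn (fun s => N (x s)) A (normVariationMeasure k) :=
  ((h.cadlag_x.isRightRegular_continuous hN).integrableOn
    (normVariationMeasure_Icc_ne_top k S)).mono_set hA

/-- The atom at 0 absorbs the initial value, since k_0 is the negative excess of y_0, that is |k_0|
times the normal at x_0. A continuous N in place of the normal keeps the integrand regular, and the
two agree almost everywhere. -/
lemma IsSkorokhodSolution.eq_setIntegral (hD : IsBoundedConvexC2Domain D)
    (h : IsSkorokhodSolution D y x k) (hN : Continuous N)
    (hNn : ∀ p ∈ frontier D, N p = inwardNormal D p) {t : ℝ} (ht : 0 ≤ t) :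
    k t = ∫ s in Icc 0 t, N (x s) ∂(normVariationMeasure k) := by
  have := isLocallyFiniteMeasure_variationMeasure k
  have hint := h.integrableOn hN (Subset.refl (Icc 0 t))
  have hint' : Integrable (fun s => N (x s))
      ((ENNReal.ofReal ‖k 0‖ • Measure.dirac (0 : ℝ)).restrict (Icc 0 t)) ∧
      Integrable (fun s => N (x s)) ((variationMeasure k).restrict (Icc 0 t)) := by
    rw [IntegrableOn, normVariationMeasure, Measure.restrict_add] at hint
    exact integrable_add_measure.1 hint
  rw [normVariationMeasure, Measure.restrict_add, integral_add_measure hint'.1 hint'.2,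
    Measure.restrict_smul, integral_smul_measure, restrict_dirac' measurableSet_Icc,
    if_pos (left_mem_Icc.2 ht), integral_dirac, ENNReal.toReal_ofReal (norm_nonneg _),
    h.eq_integral t ht]
  congr 1
  · by_cases h0 : k 0 = 0
    · simp [h0]
    · rw [hNn _ (h.zero_mem_frontier hD h0), h.x_zero, h.k_zero, norm_neg]
      nth_rewrite 1 [excess_eq_smul_inwardNormal hD (y 0)]
      rw [neg_neg]
  · have e : (variationMeasure k).restrict (Icc 0 t) = (variationMeasure k).restrict (Ioc 0 t) := by
      refine Measure.restrict_congr_set ?_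
      rw [← Ioc_union_left ht]
      exact union_ae_eq_left_of_ae_eq_empty
        (ae_eq_empty.2 h.variationMeasure_singleton_zero)
    rw [e]
    refine setIntegral_congr_ae measurableSet_Ioc ?_
    have := h.variationMeasure_interior ht
    rw [measure_eq_zero_iff_ae_notMem] at this
    filter_upwards [this] with s hs hst
    simp only [not_and, not_not] at hs
    exact (hNn _ (hs hst)).symm

/-- As u increases to t the intervals [0, u] exhaust [0, t), so dominated convergence with bound 1
applies. At t = 0 the convention k_{0-} = 0 matches the empty interval. -/
lemma IsSkorokhodSolution.preValue_eq_setIntegral (hD : IsBoundedConvexC2Domain D)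
    (h : IsSkorokhodSolution D y x k) (hN : Continuous N) (hN1 : ∀ z, ‖N z‖ ≤ 1)
    (hNn : ∀ p ∈ frontier D, N p = inwardNormal D p) {t : ℝ} (ht : 0 ≤ t) :
    preValue k t = ∫ s in Ico 0 t, N (x s) ∂(normVariationMeasure k) := by
  rcases ht.eq_or_lt with rfl | ht0
  · simp [preValue]
  have hfin := isFiniteMeasure_restrict_normVariationMeasure (k := k) (Subset.refl (Icc 0 t))
  refine tendsto_nhds_unique (h.cadlag_k.tendsto_preValue ht0) ?_
  have hE : ∀ A : Set ℝ, MeasurableSet A → A ⊆ Icc 0 t →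
      ∫ s in A, N (x s) ∂(normVariationMeasure k) =
      ∫ s in Icc 0 t, A.indicator (fun s => N (x s)) s ∂(normVariationMeasure k) := by
    intro A hA hAt
    rw [setIntegral_indicator hA, inter_eq_right.2 hAt]
  have hlim : Tendsto (fun u => ∫ s in Icc 0 t, (Icc 0 u).indicator (fun s => N (x s)) s
      ∂(normVariationMeasure k)) (𝓝[<] t) (𝓝 (∫ s in Icc 0 t,
        (Ico 0 t).indicator (fun s => N (x s)) s ∂(normVariationMeasure k))) := by
    refine tendsto_integral_filter_of_dominated_convergence (fun _ => (1 : ℝ)) ?_ ?_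
      (integrable_const _) ?_
    · refine Eventually.of_forall fun u => ?_
      exact ((h.integrableOn hN (Subset.refl (Icc 0 t))).indicator measurableSet_Icc).1
    · refine Eventually.of_forall fun u => Eventually.of_forall fun s => ?_
      exact (norm_indicator_le_norm_self _ _).trans (hN1 _)
    · refine Eventually.of_forall fun s => ?_
      refine tendsto_const_nhds.congr' ?_
      rcases lt_or_ge s t with hst | hst
      · filter_upwards [Ioo_mem_nhdsLT hst] with u hu
        simp only [indicator, mem_Ico, mem_Icc, hst, hu.1.le, and_true]
      · filter_upwards [self_mem_nhdsWithin] with u hu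
        have : ¬ s ≤ u := not_le.2 (lt_of_lt_of_le hu hst)
        simp [indicator, not_lt.2 hst, this]
  rw [hE _ measurableSet_Ico Ico_subset_Icc_self]
  refine hlim.congr' ?_
  filter_upwards [Ioo_mem_nhdsLT ht0] with u hu
  rw [h.eq_setIntegral hD hN hNn hu.1.le, hE _ measurableSet_Icc (Icc_subset_Icc_right hu.2.le)]

lemma IsSkorokhodSolution.preValue_sub_preValue (hD : IsBoundedConvexC2Domain D)
    (h : IsSkorokhodSolution D y x k) (hN : Continuous N) (hN1 : ∀ z, ‖N z‖ ≤ 1)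
    (hNn : ∀ p ∈ frontier D, N p = inwardNormal D p) {s t : ℝ} (hs : 0 ≤ s) (hst : s ≤ t) :
    preValue k t - preValue k s = ∫ r in Ico s t, N (x r) ∂(normVariationMeasure k) := by
  rw [h.preValue_eq_setIntegral hD hN hN1 hNn hs,
    h.preValue_eq_setIntegral hD hN hN1 hNn (hs.trans hst), ← Ico_union_Ico_eq_Ico hs hst,
    setIntegral_union (Ico_disjoint_Ico_same) measurableSet_Ico
      (h.integrableOn hN (S := s) Ico_subset_Icc_self)
      (h.integrableOn hN (S := t) fun r hr => ⟨hs.trans hr.1, hr.2.le⟩), add_sub_cancel_left]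

lemma IsSkorokhodSolution.preValue_sub (hD : IsBoundedConvexC2Domain D)
    (h : IsSkorokhodSolution D y x k) (hN : Continuous N) (hN1 : ∀ z, ‖N z‖ ≤ 1)
    (hNn : ∀ p ∈ frontier D, N p = inwardNormal D p) {s t : ℝ} (hs : 0 ≤ s) (hst : s < t) :
    preValue k t - k s = ∫ r in Ioo s t, N (x r) ∂(normVariationMeasure k) := by
  rw [h.eq_setIntegral hD hN hNn hs,
    h.preValue_eq_setIntegral hD hN hN1 hNn (hs.trans hst.le), ← Icc_union_Ioo_eq_Ico hs hst,
    setIntegral_union _ measurableSet_Ioo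
      (h.integrableOn hN (S := s) (Subset.refl _))
      (h.integrableOn hN (S := t) fun r hr => ⟨hs.trans hr.1.le, hr.2.le⟩), add_sub_cancel_left]
  exact disjoint_left.2 fun r hr hr' => absurd hr.2 (not_le.2 hr'.1)

/-- The integrals giving k_t and k_{t-} differ only by the atom at t, and an atom can occur only
while x is on the boundary. -/
lemma IsSkorokhodSolution.jump_eq (hD : IsBoundedConvexC2Domain D)
    (h : IsSkorokhodSolution D y x k) {t : ℝ} (ht : 0 ≤ t) :
    jump k t = (normVariationMeasure k).real {t} • inwardNormal D (x t) := by
  obtain ⟨N, hN, hN1, hNn⟩ := exists_normal_extension hD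
  rw [jump_eq_sub_preValue, h.eq_setIntegral hD hN hNn ht,
    h.preValue_eq_setIntegral hD hN hN1 hNn ht, ← Ico_union_right ht,
    setIntegral_union _ (measurableSet_singleton t)
      (h.integrableOn hN (S := t) Ico_subset_Icc_self)
      (h.integrableOn hN (S := t) (by simpa using ht)), add_sub_cancel_left, integral_singleton]
  · by_cases h0 : (normVariationMeasure k).real {t} = 0
    · simp [h0]
    · rw [hNn _ (h.mem_frontier_of_atom hD ht h0)]
  · simp

lemma IsSkorokhodSolution.norm_jump (hD : IsBoundedConvexC2Domain D)
    (h : IsSkorokhodSolution D y x k) {t : ℝ} (ht : 0 ≤ t) :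
    ‖jump k t‖ = (normVariationMeasure k).real {t} := by
  rw [h.jump_eq hD ht, norm_smul, Real.norm_of_nonneg measureReal_nonneg]
  by_cases h0 : (normVariationMeasure k).real {t} = 0
  · simp [h0]
  · rw [norm_inwardNormal hD (h.mem_frontier_of_atom hD ht h0), mul_one]

lemma IsSkorokhodSolution.jump_eq_norm_smul (hD : IsBoundedConvexC2Domain D)
    (h : IsSkorokhodSolution D y x k) {t : ℝ} (ht : 0 ≤ t) :
    jump k t = ‖jump k t‖ • inwardNormal D (x t) := by
  rw [h.norm_jump hD ht, h.jump_eq hD ht]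

lemma IsSkorokhodSolution.mem_frontier_of_jump (hD : IsBoundedConvexC2Domain D)
    (h : IsSkorokhodSolution D y x k) {t : ℝ} (ht : 0 ≤ t) (hj : jump k t ≠ 0) :
    x t ∈ frontier D :=
  h.mem_frontier_of_atom hD ht (by rw [← h.norm_jump hD ht]; exact norm_ne_zero_iff.2 hj)

/-- This is the position after the input has jumped and before the reflection acts, the starting
point of the exponential ray. -/
lemma IsSkorokhodSolution.sub_jump (h : IsSkorokhodSolution D y x k) {t : ℝ} (ht : 0 ≤ t) :
    x t - jump k t = y t + preValue k t := by
  rw [jump_eq_sub_preValue, h.eq_add t ht]; abel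

/-- The projection is constant along the segment followed by the reflection at a jump. -/
lemma IsSkorokhodSolution.proj_sub_smul_jump (hD : IsBoundedConvexC2Domain D)
    (h : IsSkorokhodSolution D y x k) {t l : ℝ} (ht : 0 ≤ t) (hl : 0 ≤ l) :
    proj D (x t - l • jump k t) = x t := by
  by_cases hj : jump k t = 0
  · rw [hj, smul_zero, sub_zero, proj_eq_self hD.nonempty (h.mem_closure t ht)]
  · rw [h.jump_eq_norm_smul hD ht, smul_smul]
    exact proj_sub_smul_inwardNormal hD (h.mem_frontier_of_jump hD ht hj)
      (mul_nonneg hl (norm_nonneg _))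

/-- Without a jump of y, the left limit of x at T is x_T - |Δk_T| n(x_T). It lies in the closure of
D, which the supporting inequality at x_T excludes unless Δk_T = 0. -/
lemma IsSkorokhodSolution.jump_eq_zero (hD : IsBoundedConvexC2Domain D) (hy : IsCadlag y)
    (h : IsSkorokhodSolution D y x k) {T : ℝ} (hT : 0 < T) (hyT : jump y T = 0) :
    jump k T = 0 := by
  by_contra hj
  have hf := h.mem_frontier_of_jump hD hT.le hj
  have hlim : Tendsto x (𝓝[<] T) (𝓝 (preValue y T + preValue k T)) := by
    refine ((hy.tendsto_preValue hT).add (h.cadlag_k.tendsto_preValue hT)).congr' ?_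
    filter_upwards [Ioo_mem_nhdsLT hT] with s hs using (h.eq_add s hs.1.le).symm
  have hmem : preValue y T + preValue k T ∈ closure D := by
    refine isClosed_closure.mem_of_tendsto hlim ?_
    filter_upwards [Ioo_mem_nhdsLT hT] with s hs using h.mem_closure s hs.1.le
  have e : preValue y T + preValue k T - x T = -jump k T := by
    rw [jump_eq_sub_preValue, sub_eq_zero] at hyT
    rw [jump_eq_sub_preValue, h.eq_add T hT.le, hyT]; abel
  have h1 := inner_sub_inwardNormal_nonneg hD hf hmem
  rw [e, h.jump_eq_norm_smul hD hT.le, inner_neg_left, real_inner_smul_left,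
    real_inner_self_eq_norm_sq, norm_inwardNormal hD hf] at h1
  have := norm_pos_iff.2 hj
  linarith

/-- Jump sizes are masses of distinct atoms of one measure that is finite on [0, T]. -/
lemma IsSkorokhodSolution.sum_norm_jump_le (hD : IsBoundedConvexC2Domain D)
    (h : IsSkorokhodSolution D y x k) {T : ℝ} (F : Finset (Icc (0 : ℝ) T)) :
    ∑ s ∈ F, ‖jump k s‖ ≤ (normVariationMeasure k).real (Icc 0 T) := by
  classical
  have e : ∑ s ∈ F, ‖jump k s‖ =
      ∑ s ∈ F.image Subtype.val, (normVariationMeasure k).real {s} := by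
    rw [Finset.sum_image Subtype.val_injective.injOn]
    exact Finset.sum_congr rfl fun s _ => h.norm_jump hD s.2.1
  have hsub : ((F.image Subtype.val : Finset ℝ) : Set ℝ) ⊆ Icc 0 T := by
    intro s hs
    simp only [Finset.coe_image, mem_image] at hs
    obtain ⟨a, -, rfl⟩ := hs
    exact a.2
  rw [e, Measure.real]
  have hfin : ∀ s ∈ F.image Subtype.val, normVariationMeasure k {s} ≠ ⊤ := fun s hs =>
    normVariationMeasure_ne_top (S := T) (singleton_subset_iff.2 (hsub hs))
  simp only [Measure.real]
  rw [← ENNReal.toReal_sum hfin, sum_measure_singleton]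
  exact ENNReal.toReal_mono (normVariationMeasure_Icc_ne_top k T) (measure_mono hsub)

lemma IsSkorokhodSolution.summable_norm_jump (hD : IsBoundedConvexC2Domain D)
    (h : IsSkorokhodSolution D y x k) (T : ℝ) :
    Summable (fun s : Icc (0 : ℝ) T => ‖jump k s‖) :=
  summable_of_sum_le (fun _ => norm_nonneg _) fun F => h.sum_norm_jump_le hD F

end Skorokhod

/-! ### Time changes of the Skorokhod topology -/

section TimeChange

variable {d : ℕ} {τ : ℕ → ℝ → ℝ} {T : ℝ}

/-- The time changes `τ n`, modified at `T` so as to fix this time. -/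
noncomputable def fixedTime (τ : ℕ → ℝ → ℝ) (T : ℝ) (n : ℕ) (t : ℝ) : ℝ :=
  if t < T then τ n t else T

lemma timeChange_zero (hτ : ∀ n, StrictMonoOn (τ n) (Ici 0) ∧ BijOn (τ n) (Ici 0) (Ici 0))
    (n : ℕ) : τ n 0 = 0 := by
  obtain ⟨r, hr, hr0⟩ := (hτ n).2.surjOn (mem_Ici.2 (le_refl (0 : ℝ)))
  refine le_antisymm ?_ ((hτ n).2.mapsTo (mem_Ici.2 le_rfl))
  calc τ n 0 ≤ τ n r := (hτ n).1.monotoneOn (mem_Ici.2 le_rfl) hr hr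
    _ = 0 := hr0

lemma tendsto_timeChange (hu : TendstoUniformlyOn τ id atTop (Ici 0)) {t : ℝ} (ht : 0 ≤ t) :
    Tendsto (fun n => τ n t) atTop (𝓝 t) := hu.tendsto_at ht

lemma tendsto_fixedTime (hu : TendstoUniformlyOn τ id atTop (Ici 0)) {t : ℝ} (ht : 0 ≤ t)
    (htT : t ≤ T) : Tendsto (fun n => fixedTime τ T n t) atTop (𝓝 t) := by
  rcases htT.lt_or_eq with h | rfl
  · simpa [fixedTime, h] using tendsto_timeChange hu ht
  · simp [fixedTime]

lemma fixedTime_self (n : ℕ) : fixedTime τ T n T = T := by simp [fixedTime]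

lemma fixedTime_zero (hτ : ∀ n, StrictMonoOn (τ n) (Ici 0) ∧ BijOn (τ n) (Ici 0) (Ici 0))
    (hT : 0 < T) (n : ℕ) : fixedTime τ T n 0 = 0 := by
  simp [fixedTime, hT, timeChange_zero hτ]

lemma fixedTime_nonneg (hτ : ∀ n, StrictMonoOn (τ n) (Ici 0) ∧ BijOn (τ n) (Ici 0) (Ici 0))
    (hT : 0 < T) (n : ℕ) {t : ℝ} (ht : 0 ≤ t) : 0 ≤ fixedTime τ T n t := by
  unfold fixedTime
  split_ifs
  · exact (hτ n).2.mapsTo ht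
  · exact hT.le

lemma eventually_fixedTime_le (hu : TendstoUniformlyOn τ id atTop (Ici 0)) {t : ℝ} (ht : 0 ≤ t)
    (htT : t ≤ T) : ∀ᶠ n in atTop, fixedTime τ T n t ≤ T := by
  rcases htT.lt_or_eq with h | rfl
  · filter_upwards [(tendsto_fixedTime hu ht htT).eventually (gt_mem_nhds h)] with n hn using hn.le
  · exact Eventually.of_forall fun n => (fixedTime_self n).le

variable {yn : ℕ → ℝ → EuclideanSpace ℝ (Fin d)} {y x : ℝ → EuclideanSpace ℝ (Fin d)}

/-- A cell ending at T needs room to the right: since `fixedTime` keeps T in place, times before T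
may be images under τ n of times beyond T. Continuity of y at T lets its oscillation bound extend to
T + h. -/
lemma exists_isFinePartition_near (hy : IsCadlag y) (hx : IsCadlag x) (hT : 0 < T)
    (hyT : jump y T = 0) {S ε : ℝ} (hS : 0 ≤ S) (hST : S ≤ T) (hε : 0 < ε) :
    ∃ m t, IsFinePartition (fun s => (s, y s, x s)) ε S m t ∧
      ∃ h ∈ Ioc (0 : ℝ) 1, ∀ i < m, t (i + 1) = T →
        ∀ r ∈ Ico (t i) (T + h), |r - t i| ≤ ε ∧ ‖y r - y (t i)‖ ≤ ε := by
  rcases hST.lt_or_eq with hST | rfl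
  · obtain ⟨m, t, ht⟩ := exists_isFinePartition_prod hy hx hε hS
    refine ⟨m, t, ht, 1, by norm_num, fun i hi hiT => ?_⟩
    have hle := ht.le_last (Nat.succ_le_of_lt hi)
    rw [Nat.succ_eq_add_one, hiT] at hle
    exact absurd hle (not_le.2 hST)
  have hc : ContinuousAt y S := by
    rw [continuousAt_iff_continuous_left'_right']
    refine ⟨?_, (hy.1 S hT.le).mono Ioi_subset_Ici_self⟩
    have := hy.tendsto_preValue hT
    rw [jump_eq_sub_preValue, sub_eq_zero] at hyT
    rwa [← hyT] at this
  obtain ⟨δ, hδ, hδy⟩ := Metric.continuousAt_iff.1 hc (ε / 2) (half_pos hε)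
  obtain ⟨l, hl⟩ := hx.2 S hT
  obtain ⟨c1, hc1, hc1x⟩ := mem_nhdsLT_iff_exists_Ioo_subset.1
    (hl.eventually (Metric.ball_mem_nhds l (half_pos hε)))
  have hc1 : c1 < S := hc1
  -- The last cell starts at a nonnegative c so near T that x is almost at its left limit, y almost
  -- at y(T), and the cell is short.
  obtain ⟨c, hcl, hcS⟩ := exists_between (show max (max c1 (S - δ)) (max (S - ε / 2) 0) < S from
    max_lt (max_lt hc1 (by linarith)) (max_lt (by linarith) hT))
  simp only [max_lt_iff] at hcl
  obtain ⟨⟨h1, h2⟩, h3, h4⟩ := hcl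
  have hyc : ∀ r ∈ Ico c (S + min (min δ (ε / 2)) 1), |r - c| ≤ ε ∧ dist (y r) (y c) ≤ ε := by
    intro r hr
    have hr2 := hr.2
    have hb1 : min (min δ (ε / 2)) 1 ≤ δ := (min_le_left _ _).trans (min_le_left _ _)
    have hb2 : min (min δ (ε / 2)) 1 ≤ ε / 2 := (min_le_left _ _).trans (min_le_right _ _)
    have e1 : dist (y r) (y S) < ε / 2 := hδy (by
      rw [Real.dist_eq, abs_lt]; constructor <;> linarith [hr.1])
    have e2 : dist (y c) (y S) < ε / 2 := hδy (by
      rw [Real.dist_eq, abs_lt]; constructor <;> linarith)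
    refine ⟨?_, by linarith [dist_triangle_right (y r) (y c) (y S)]⟩
    rw [abs_of_nonneg (by linarith [hr.1])]
    linarith
  have hmin : 0 < min (min δ (ε / 2)) 1 := by positivity
  obtain ⟨m, t, ht⟩ := exists_isFinePartition_prod hy hx hε h4.le
  refine ⟨m + 1, _, ht.extend hcS fun s hs => ?_, min (min δ (ε / 2)) 1,
    ⟨hmin, min_le_right _ _⟩, fun i hi hiT => ?_⟩
  · have e1 : dist (x s) l < ε / 2 := hc1x ⟨h1.trans_le hs.1, hs.2⟩
    have e2 : dist (x c) l < ε / 2 := hc1x ⟨h1, hcS⟩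
    obtain ⟨e3, e4⟩ := hyc s ⟨hs.1, by linarith [hs.2]⟩
    rw [Prod.dist_eq, Prod.dist_eq]
    exact max_le (by rwa [Real.dist_eq]) (max_le e4
      (by linarith [dist_triangle_right (x s) (x c) l]))
  · rcases Nat.lt_succ_iff_lt_or_eq.1 hi with hi' | rfl
    · have := ht.le_last (Nat.succ_le_of_lt hi')
      simp only [Nat.succ_le_of_lt hi', if_true] at hiT
      rw [Nat.succ_eq_add_one, hiT] at this
      linarith
    · simp only [le_refl, if_true, ht.last]
      intro r hr
      simpa [dist_eq_norm] using hyc r hr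

/-- Fine partitions of the limit path transfer to the approximating paths. -/
lemma exists_partition_transfer
    (hτ : ∀ n, StrictMonoOn (τ n) (Ici 0) ∧ BijOn (τ n) (Ici 0) (Ici 0))
    (hu : TendstoUniformlyOn τ id atTop (Ici 0))
    (hyn : ∀ N : ℝ, TendstoUniformlyOn (fun n t => yn n (τ n t)) y atTop (Icc 0 N))
    (hy : IsCadlag y) (hx : IsCadlag x) (hT : 0 < T) (hyT : jump y T = 0) {S ε : ℝ} (hS : 0 ≤ S)
    (hST : S ≤ T) (hε : 0 < ε) :
    ∃ m t, IsFinePartition (fun s => (s, y s, x s)) ε S m t ∧ ∀ᶠ n in atTop, ∀ i < m,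
      fixedTime τ T n (t i) < fixedTime τ T n (t (i + 1)) ∧
      ∀ s ∈ Ico (fixedTime τ T n (t i)) (fixedTime τ T n (t (i + 1))),
        |s - t i| ≤ 2 * ε ∧ ‖yn n s - y (t i)‖ ≤ 2 * ε := by
  obtain ⟨m, t, ht, h, hh, hlast⟩ := exists_isFinePartition_near hy hx hT hyT hS hST hε
  refine ⟨m, t, ht, ?_⟩
  have h1 : ∀ᶠ n in atTop, ∀ i ∈ Finset.range m,
      fixedTime τ T n (t i) < fixedTime τ T n (t (i + 1)) := by
    rw [Filter.eventually_all_finset]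
    intro i hi
    have hi := Finset.mem_range.1 hi
    exact (tendsto_fixedTime hu (ht.nonneg hi.le) ((ht.le_last hi.le).trans hST)).eventually_lt
      (tendsto_fixedTime hu (ht.nonneg (Nat.succ_le_of_lt hi))
        ((ht.le_last (Nat.succ_le_of_lt hi)).trans hST)) (ht.lt i hi)
  have h2 := Metric.tendstoUniformlyOn_iff.1 hu ε hε
  have h3 := Metric.tendstoUniformlyOn_iff.1 (hyn (T + 1)) ε hε
  have h4 : ∀ᶠ n in atTop, T < τ n (T + h) :=
    (tendsto_timeChange hu (by linarith [hh.1] : 0 ≤ T + h)).eventually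
      (lt_mem_nhds (by linarith [hh.1]))
  filter_upwards [h1, h2, h3, h4] with n h1 h2 h3 h4 i hi
  refine ⟨h1 i (Finset.mem_range.2 hi), fun s hs => ?_⟩
  have hti0 : 0 ≤ t i := ht.nonneg hi.le
  have hti1T : t (i + 1) ≤ T := (ht.le_last (Nat.succ_le_of_lt hi)).trans hST
  have hti1 : 0 ≤ t (i + 1) := ht.nonneg (Nat.succ_le_of_lt hi)
  have htiT : t i < T := (ht.lt i hi).trans_le hti1T
  have hs1 : τ n (t i) ≤ s := by simpa [fixedTime, htiT] using hs.1
  have hs0 : 0 ≤ s := le_trans ((hτ n).2.mapsTo hti0) hs1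
  obtain ⟨r, hr0, rfl⟩ := (hτ n).2.surjOn hs0
  have hir : t i ≤ r := ((hτ n).1.le_iff_le hti0 hr0).1 hs1
  -- A cell ending before T is the exact image under τ n of a limit cell. For a cell ending at T the
  -- preimage r may pass T, but stays below T + h because τ n (T + h) exceeds T.
  have key : r ≤ T + 1 ∧ |r - t i| ≤ ε ∧ ‖y r - y (t i)‖ ≤ ε := by
    rcases hti1T.lt_or_eq with hlt | heq
    · have hs2 : τ n r < τ n (t (i + 1)) := by simpa [fixedTime, hlt] using hs.2
      have hr1 : r < t (i + 1) := ((hτ n).1.lt_iff_lt hr0 hti1).1 hs2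
      have hd := ht.dist_le i hi r ⟨hir, hr1⟩
      rw [Prod.dist_eq, Prod.dist_eq, max_le_iff, max_le_iff] at hd
      exact ⟨by linarith, by simpa [Real.dist_eq] using hd.1, by
        simpa [dist_eq_norm] using hd.2.1⟩
    · have hs2 : τ n r < T := by simpa [heq, fixedTime] using hs.2
      have hr1 : r < T + h := ((hτ n).1.lt_iff_lt hr0
        (mem_Ici.2 (by linarith [hh.1] : 0 ≤ T + h))).1 (hs2.trans h4)
      exact ⟨by linarith [hh.2], hlast i hi heq r ⟨hir, hr1⟩⟩
  have e1 := h2 r hr0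
  have e2 := h3 r ⟨hr0, key.1⟩
  rw [dist_comm, Real.dist_eq, id] at e1
  rw [dist_comm, dist_eq_norm] at e2
  constructor
  · calc |τ n r - t i| ≤ |τ n r - r| + |r - t i| := abs_sub_le _ _ _
      _ ≤ 2 * ε := by linarith [key.2.1]
  · calc ‖yn n (τ n r) - y (t i)‖ ≤ ‖yn n (τ n r) - y r‖ + ‖y r - y (t i)‖ :=
        norm_sub_le_norm_sub_add_norm_sub _ _ _
      _ ≤ 2 * ε := by linarith [key.2.2]

end TimeChange

/-! ### Convergence of the penalization terms -/

section Convergence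

variable {d : ℕ} {D : Set (EuclideanSpace ℝ (Fin d))} {n : ℕ}
  {Y z K y x k : ℝ → EuclideanSpace ℝ (Fin d)}

lemma IsPenalizedSolution.norm_le_penaltyVariation (h : IsPenalizedSolution D n Y z K)
    (hne : D.Nonempty) (hc : Convex ℝ D) {a : ℝ} (ha : 0 ≤ a) :
    ‖K a‖ ≤ penaltyVariation D n z a := by
  simpa [h.zero, penaltyVariation_zero] using h.norm_sub_le hne hc le_rfl ha

lemma exists_closedBall_subset (hD : IsBoundedConvexC2Domain D) :
    ∃ c ∈ D, ∃ r > 0, Metric.closedBall c r ⊆ D := by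
  obtain ⟨c, hc⟩ := hD.nonempty
  obtain ⟨r, hr, hb⟩ := Metric.nhds_basis_closedBall.mem_iff.1 (hD.isOpen.mem_nhds hc)
  exact ⟨c, hc, r, hr, hb⟩

/-- Comparison of a penalized solution after a jump with the ray joining the endpoints of the
corresponding jump of the Skorokhod solution. -/
lemma IsSkorokhodSolution.comparison (hD : IsBoundedConvexC2Domain D)
    (hx : IsSkorokhodSolution D y x k) (h : IsPenalizedSolution D n Y z K) {s a b η : ℝ}
    (hs : 0 ≤ s) (ha : 0 ≤ a) (hη : 0 ≤ η) (hY : ∀ u ∈ Ico a b, ‖Y u - y s‖ ≤ η) {u : ℝ}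
    (hu : u ∈ Icc a b) :
    ‖K u - (k s - Real.exp (-(n * (u - a))) • jump k s)‖ ^ 2 ≤ ‖K a - preValue k s‖ ^ 2 +
      2 * η * (penaltyVariation D n z u - penaltyVariation D n z a + ‖jump k s‖) := by
  have hq : proj D (y s + preValue k s) = x s := by
    have := hx.proj_sub_smul_jump hD hs zero_le_one
    rwa [one_smul, hx.sub_jump hs] at this
  have key := h.comparison hD.nonempty hD.convex hq ha hη hY hu
  have e1 : y s + preValue k s - x s = -jump k s := by rw [← hx.sub_jump hs]; abel
  have e2 : expRay n (x s) (y s + preValue k s) (u - a) - y s =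
      k s - Real.exp (-(n * (u - a))) • jump k s := by
    rw [expRay, e1, hx.eq_add s hs, smul_neg]; abel
  rw [e2, e1, norm_neg, add_sub_cancel_left] at key
  exact key

lemma IsSkorokhodSolution.norm_le_measureReal (hD : IsBoundedConvexC2Domain D)
    (hx : IsSkorokhodSolution D y x k) {t T : ℝ} (ht : 0 ≤ t) (htT : t ≤ T) :
    ‖k t‖ ≤ (normVariationMeasure k).real (Icc 0 T) := by
  obtain ⟨N, hN, hN1, hNn⟩ := exists_normal_extension hD
  rw [hx.eq_setIntegral hD hN hNn ht]
  have := norm_setIntegral_le_of_norm_le_const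
    (normVariationMeasure_ne_top (k := k) (Subset.refl (Icc 0 t))).lt_top
    (fun s _ => hN1 (x s))
  rw [one_mul] at this
  exact this.trans (measureReal_mono (Icc_subset_Icc_right htT)
    (normVariationMeasure_Icc_ne_top k T))

lemma IsSkorokhodSolution.norm_jump_le (hD : IsBoundedConvexC2Domain D)
    (hx : IsSkorokhodSolution D y x k) {s t : ℝ} (hs : 0 ≤ s) (hst : s < t) :
    ‖jump k s‖ ≤ (normVariationMeasure k).real (Ico s t) := by
  rw [hx.norm_jump hD hs]
  exact measureReal_mono (singleton_subset_iff.2 ⟨le_rfl, hst⟩)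
    (normVariationMeasure_ne_top (S := t) fun r hr => ⟨hs.trans hr.1, hr.2.le⟩)

/-- Dropping |v|² leaves the one-sided cross term, which can be bounded above even when v, such as
the displacement of k over a cell, is not small. -/
lemma norm_sq_le_norm_add_sq_sub {F : Type*} [NormedAddCommGroup F] [InnerProductSpace ℝ F]
    (u v : F) : ‖u‖ ^ 2 ≤ ‖u + v‖ ^ 2 - 2 * inner ℝ u v := by
  rw [norm_add_sq_real]
  nlinarith [sq_nonneg ‖v‖]

/-- Distance to the domain after the relaxation following a jump. -/
lemma IsPenalizedSolution.norm_excess_le (h : IsPenalizedSolution D n Y z K)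
    (hne : D.Nonempty) (hc : Convex ℝ D) {a b η σ C R : ℝ} (ha : 0 ≤ a) (hab : a < b) (hη : 0 ≤ η)
    (hY : ∀ u ∈ Ico a b, ‖Y u - Y a‖ ≤ η) (hσ : Real.exp (-(n * (b - a))) ≤ σ)
    (hC : penaltyVariation D n z b ≤ C) (hR : ‖excess D (z a)‖ ≤ R) :
    ‖excess D (Y a + K b)‖ ≤ √(2 * η * (C + R)) + σ * R := by
  have hR0 : 0 ≤ R := (norm_nonneg _).trans hR
  have key := h.comparison hne hc (q := z a) (c := Y a) rfl ha hη hY (right_mem_Icc.2 hab.le)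
  have e0 : K a - (z a - Y a) = 0 := by rw [h.eq_add a ha]; abel
  have hVa : 0 ≤ penaltyVariation D n z a :=
    penaltyVariation_zero (D := D) (n := n) (z := z) ▸
      penaltyVariation_mono hne hc h.cadlag_x le_rfl ha
  rw [e0, norm_zero, zero_pow two_ne_zero, zero_add] at key
  have key2 : ‖K b - (expRay n (proj D (z a)) (z a) (b - a) - Y a)‖ ≤ √(2 * η * (C + R)) := by
    refine Real.le_sqrt_of_sq_le (key.trans ?_)
    refine mul_le_mul_of_nonneg_left ?_ (by positivity)
    exact add_le_add (by linarith) hR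
  refine (Reflection.norm_excess_le hne _ (proj_mem hne (z a))).trans ?_
  have e : Y a + K b - proj D (z a) = (K b - (expRay n (proj D (z a)) (z a) (b - a) - Y a)) +
      Real.exp (-(n * (b - a))) • excess D (z a) := by
    rw [expRay, excess]; abel
  rw [e]
  refine (norm_add_le _ _).trans (add_le_add key2 ?_)
  rw [norm_smul, Real.norm_of_nonneg (Real.exp_pos _).le]
  exact mul_le_mul hσ hR (norm_nonneg _) ((Real.exp_pos _).le.trans hσ)

/-- One step of the comparison of the penalization term with the limit. -/
lemma IsSkorokhodSolution.step (hD : IsBoundedConvexC2Domain D)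
    (hx : IsSkorokhodSolution D y x k) (h : IsPenalizedSolution D n Y z K)
    {s t a b ε σ C R T : ℝ} (hs : 0 ≤ s) (hst : s < t) (htT : t ≤ T) (ha : 0 ≤ a) (hab : a < b)
    (hy' : ∀ r ∈ Ico s t, ‖y r - y s‖ ≤ ε) (hx' : ∀ r ∈ Ico s t, ‖x r - x s‖ ≤ ε)
    (hY : ∀ u ∈ Ico a b, ‖Y u - y s‖ ≤ 2 * ε) (hσ : Real.exp (-(n * (b - a))) ≤ σ)
    (hC : penaltyVariation D n z b ≤ C) (hR : ‖excess D (z a)‖ ≤ R) :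
    ‖K b - preValue k t‖ ^ 2 ≤ ‖K a - preValue k s‖ ^ 2 +
      4 * ε * (penaltyVariation D n z b - penaltyVariation D n z a) +
      (4 * ε + 2 * (5 * ε + (√(8 * ε * (C + R)) + σ * R))) *
        (normVariationMeasure k).real (Ico s t) +
      2 * σ * ((C + (normVariationMeasure k).real (Icc 0 T)) *
        (normVariationMeasure k).real (Icc 0 T)) := by
  obtain ⟨N, hN, hN1, hNn⟩ := exists_normal_extension hD
  have hε : 0 ≤ ε := (norm_nonneg _).trans (hy' s ⟨le_rfl, hst⟩)
  have hR0 : 0 ≤ R := (norm_nonneg _).trans hR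
  have hσ0 : 0 ≤ σ := (Real.exp_pos _).le.trans hσ
  set μ := normVariationMeasure k with hμ
  set M := μ.real (Icc 0 T) with hM
  have hM0 : 0 ≤ M := measureReal_nonneg
  have hb : 0 ≤ b := ha.trans hab.le
  have hsub : Ico s t ⊆ Icc 0 T := fun r hr => ⟨hs.trans hr.1, hr.2.le.trans htT⟩
  have hj := hx.norm_jump_le hD hs hst
  have hjM : ‖jump k s‖ ≤ M :=
    hj.trans (measureReal_mono hsub (normVariationMeasure_Icc_ne_top k T))
  have hKb : ‖K b‖ ≤ C := (h.norm_le_penaltyVariation hD.nonempty hD.convex hb).trans hC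
  have hks : ‖k s‖ ≤ M := hx.norm_le_measureReal hD hs (hst.le.trans htT)
  -- relaxation after the jump
  have s1 := hx.comparison hD h hs ha (by positivity) hY (right_mem_Icc.2 hab.le)
  have s2 := norm_sq_le_norm_add_sq_sub (K b - k s) (Real.exp (-(n * (b - a))) • jump k s)
  have e1 : K b - k s + Real.exp (-(n * (b - a))) • jump k s =
      K b - (k s - Real.exp (-(n * (b - a))) • jump k s) := by abel
  rw [e1] at s2
  have s3 : -inner ℝ (K b - k s) (Real.exp (-(n * (b - a))) • jump k s) ≤ σ * ((C + M) * M) := by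
    refine (neg_le_abs _).trans ((abs_real_inner_le_norm _ _).trans ?_)
    rw [norm_smul, Real.norm_of_nonneg (Real.exp_pos _).le]
    calc ‖K b - k s‖ * (Real.exp (-(n * (b - a))) * ‖jump k s‖) ≤ (C + M) * (σ * M) := by
          refine mul_le_mul ((norm_sub_le _ _).trans (add_le_add hKb hks))
            (mul_le_mul hσ hjM (norm_nonneg _) hσ0) (by positivity) ?_
          exact add_nonneg ((norm_nonneg _).trans hKb) hM0
      _ = σ * ((C + M) * M) := by ring
  -- continuous part of the limit
  set ζ := 5 * ε + (√(8 * ε * (C + R)) + σ * R) with hζ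
  have hζ0 : 0 ≤ ζ := by positivity
  -- Two values of Y within 2ε of y s are within 4ε of each other, and 2·(4ε) gives the 8ε under the
  -- root.
  have hdist : ‖excess D (Y a + K b)‖ ≤ √(8 * ε * (C + R)) + σ * R := by
    have := h.norm_excess_le hD.nonempty hD.convex (η := 4 * ε) ha hab (by positivity)
      (fun u hu => ?_) hσ hC hR
    · convert this using 4; ring
    · calc ‖Y u - Y a‖ ≤ ‖Y u - y s‖ + ‖y s - Y a‖ := norm_sub_le_norm_sub_add_norm_sub _ _ _
        _ ≤ 4 * ε := by
          rw [norm_sub_rev (y s)]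
          linarith [hY u hu, hY a ⟨le_rfl, hab⟩]
  have hpre : ‖preValue k t - k s‖ ≤ 2 * ε := by
    refine le_of_tendsto ((hx.cadlag_k.tendsto_preValue (hs.trans_lt hst)).sub_const (k s)).norm ?_
    filter_upwards [Ioo_mem_nhdsLT hst] with r hr
    have hr' : r ∈ Ico s t := ⟨hr.1.le, hr.2⟩
    have e : k r - k s = (x r - x s) - (y r - y s) := by
      rw [hx.eq_add r (hs.trans hr.1.le), hx.eq_add s hs]; abel
    rw [e]
    linarith [norm_sub_le (x r - x s) (y r - y s), hx' r hr', hy' r hr']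
  have hpt : ∀ r ∈ Ioo s t, x r ∈ frontier D →
      inner ℝ (preValue k t - K b) (N (x r)) ≤ ζ := by
    intro r hr hf
    have hr' : r ∈ Ico s t := ⟨hr.1.le, hr.2⟩
    -- The first three differences have norms at most 2ε, ε and 2ε, whence the 5ε in ζ. The fourth
    -- points from a point of the closure of D to x r and has nonpositive product with the normal
    -- there; the last is the excess just bounded.
    have e : preValue k t - K b = (preValue k t - k s) + (x s - x r) + (Y a - y s) +
        (x r - proj D (Y a + K b)) - excess D (Y a + K b) := by
      rw [excess, hx.eq_add s hs]; abel
    have hle : ∀ v, inner ℝ v (N (x r)) ≤ ‖v‖ := fun v =>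
      (real_inner_le_norm _ _).trans (mul_le_of_le_one_right (norm_nonneg _) (hN1 _))
    have i1 := hle (preValue k t - k s)
    have i2 := hle (x s - x r)
    have i3 := hle (Y a - y s)
    have i4 : inner ℝ (x r - proj D (Y a + K b)) (N (x r)) ≤ 0 := by
      have := inner_sub_inwardNormal_nonneg hD hf (proj_mem hD.nonempty (Y a + K b))
      rw [hNn _ hf, ← neg_sub, inner_neg_left]
      linarith
    have i5 := hle (-excess D (Y a + K b))
    rw [norm_neg, inner_neg_left] at i5
    have i6 := hx' r hr'
    rw [norm_sub_rev] at i6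
    have i7 := hY a ⟨le_rfl, hab⟩
    rw [e, inner_sub_left, inner_add_left, inner_add_left, inner_add_left]
    linarith
  have hsubo : Ioo s t ⊆ Icc 0 T := fun r hr => hsub ⟨hr.1.le, hr.2⟩
  have hint := hx.integrableOn hN hsubo
  have s4 := norm_sq_le_norm_add_sq_sub (K b - preValue k t) (preValue k t - k s)
  rw [sub_add_sub_cancel] at s4
  have s5 : -inner ℝ (K b - preValue k t) (preValue k t - k s) ≤ ζ * μ.real (Ico s t) := by
    rw [← inner_neg_left, neg_sub, hx.preValue_sub hD hN hN1 hNn hs hst,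
      ← integral_inner hint]
    have hfin := isFiniteMeasure_restrict_normVariationMeasure (k := k) hsubo
    calc ∫ r in Ioo s t, inner ℝ (preValue k t - K b) (N (x r)) ∂μ
        ≤ ∫ r in Ioo s t, ζ ∂μ := by
          refine integral_mono_ae (hint.const_inner _) (integrable_const _) ?_
          filter_upwards [hx.ae_mem_frontier hD hsubo measurableSet_Ioo,
            ae_restrict_mem measurableSet_Ioo] with r hr1 hr2 using hpt r hr2 hr1
      _ = ζ * μ.real (Ioo s t) := by rw [setIntegral_const, smul_eq_mul, mul_comm]
      _ ≤ ζ * μ.real (Ico s t) := mul_le_mul_of_nonneg_left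
          (measureReal_mono Ioo_subset_Ico_self (normVariationMeasure_ne_top hsub)) hζ0
  have s6 := mul_le_mul_of_nonneg_left hj (show 0 ≤ 4 * ε by positivity)
  linarith

end Convergence

/-! ### Uniform variation bound and convergence at the partition times -/

section Scheme

variable {d : ℕ}

/-- Penalized solutions driven by a `J₁`-convergent sequence, with its time changes `τ`, and the
solution of the limiting Skorokhod problem. -/
structure IsPenalizationScheme (D : Set (EuclideanSpace ℝ (Fin d))) (T : ℝ) (τ : ℕ → ℝ → ℝ)
    (yn : ℕ → ℝ → EuclideanSpace ℝ (Fin d)) (y : ℝ → EuclideanSpace ℝ (Fin d))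
    (xn kn : ℕ → ℝ → EuclideanSpace ℝ (Fin d)) (x k : ℝ → EuclideanSpace ℝ (Fin d)) : Prop where
  domain : IsBoundedConvexC2Domain D
  pos : 0 < T
  timeChange : ∀ n, StrictMonoOn (τ n) (Ici 0) ∧ BijOn (τ n) (Ici 0) (Ici 0)
  tendsto_timeChange : TendstoUniformlyOn τ id atTop (Ici 0)
  tendsto_input : ∀ N : ℝ, TendstoUniformlyOn (fun n t => yn n (τ n t)) y atTop (Icc 0 N)
  cadlag : IsCadlag y
  jump_eq_zero : jump y T = 0
  penalized : ∀ n, 1 ≤ n → IsPenalizedSolution D n (yn n) (xn n) (kn n)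
  skorokhod : IsSkorokhodSolution D y x k

namespace IsPenalizationScheme

variable {D : Set (EuclideanSpace ℝ (Fin d))} {T : ℝ} {τ : ℕ → ℝ → ℝ}
  {yn xn kn : ℕ → ℝ → EuclideanSpace ℝ (Fin d)} {y x k : ℝ → EuclideanSpace ℝ (Fin d)}

lemma fixedTime_nonneg (hs : IsPenalizationScheme D T τ yn y xn kn x k) (n : ℕ) {t : ℝ}
    (ht : 0 ≤ t) : 0 ≤ fixedTime τ T n t := Reflection.fixedTime_nonneg hs.timeChange hs.pos n ht

lemma exists_partition (hs : IsPenalizationScheme D T τ yn y xn kn x k) {S ε : ℝ} (hS : 0 ≤ S)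
    (hST : S ≤ T) (hε : 0 < ε) :
    ∃ m t, IsFinePartition (fun s => (s, y s, x s)) ε S m t ∧ ∀ᶠ n in atTop, ∀ i < m,
      fixedTime τ T n (t i) < fixedTime τ T n (t (i + 1)) ∧
      ∀ s ∈ Ico (fixedTime τ T n (t i)) (fixedTime τ T n (t (i + 1))),
        |s - t i| ≤ 2 * ε ∧ ‖yn n s - y (t i)‖ ≤ 2 * ε :=
  exists_partition_transfer hs.timeChange hs.tendsto_timeChange hs.tendsto_input hs.cadlag
    hs.skorokhod.cadlag_x hs.pos hs.jump_eq_zero hS hST hε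

/-- Mesh r/8 makes the input oscillate by at most r/2 on each transferred cell, as the Lyapunov
estimate requires. The number of cells does not depend on n, so the bounds accumulate finitely
often. -/
lemma exists_variation_bound (hs : IsPenalizationScheme D T τ yn y xn kn x k) :
    ∃ C, 0 ≤ C ∧ ∀ᶠ n in atTop, penaltyVariation D n (xn n) T ≤ C := by
  obtain ⟨c, -, r, hr, hball⟩ := exists_closedBall_subset hs.domain
  have hne := hs.domain.nonempty
  have hc := hs.domain.convex
  obtain ⟨m, t, ht, hev⟩ := hs.exists_partition hs.pos.le le_rfl (show 0 < r / 8 by positivity)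
  have key : ∀ i ≤ m, ∃ C, 0 ≤ C ∧ ∀ᶠ n in atTop,
      penaltyVariation D n (xn n) (fixedTime τ T n (t i)) ≤ C := by
    intro i
    induction i with
    | zero =>
      intro _
      refine ⟨0, le_rfl, Eventually.of_forall fun n => ?_⟩
      rw [ht.zero, fixedTime_zero hs.timeChange hs.pos, penaltyVariation_zero]
    | succ i ih =>
      intro hi
      obtain ⟨C, hC0, hC⟩ := ih (by omega)
      -- The increment over a cell is at most the squared distance from yⁿ_a + kⁿ_a to c, divided by
      -- r; the variation bound C at a also bounds kⁿ_a.
      refine ⟨C + (‖y (t i)‖ + 2 * (r / 8) + C + ‖c‖) ^ 2 / r, by positivity, ?_⟩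
      filter_upwards [hev, hC, eventually_ge_atTop 1] with n hn hCn hn1
      obtain ⟨hlt, hosc⟩ := hn i (by omega)
      have h := hs.penalized n hn1
      set a := fixedTime τ T n (t i)
      set b := fixedTime τ T n (t (i + 1))
      have ha : 0 ≤ a := hs.fixedTime_nonneg n (ht.nonneg (by omega))
      have h1 := h.variation_add_sq_le hne hc (c := c) hr.le hball ha (fun s hsab => ?_)
        (right_mem_Icc.2 hlt.le)
      · have hYa := (hosc a ⟨le_rfl, hlt⟩).2
        have hKa := (h.norm_le_penaltyVariation hne hc ha).trans hCn
        have h2 : ‖yn n a + kn n a - c‖ ≤ ‖y (t i)‖ + 2 * (r / 8) + C + ‖c‖ := by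
          have e1 := norm_sub_le (yn n a + kn n a) c
          have e2 := norm_add_le (yn n a) (kn n a)
          have e3 := norm_sub_norm_le (yn n a) (y (t i))
          linarith
        have h3 := pow_le_pow_left₀ (norm_nonneg _) h2 2
        have h4 : r * (penaltyVariation D n (xn n) b - penaltyVariation D n (xn n) a) ≤
            (‖y (t i)‖ + 2 * (r / 8) + C + ‖c‖) ^ 2 := by
          have := sq_nonneg ‖yn n a + kn n b - c‖
          linarith
        rw [← le_div_iff₀' hr] at h4
        linarith
      · have e := norm_sub_le_norm_sub_add_norm_sub (yn n s) (y (t i)) (yn n a)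
        have e1 := (hosc s hsab).2
        have e2 := (hosc a ⟨le_rfl, hlt⟩).2
        rw [norm_sub_rev] at e2
        linarith
  simpa [ht.last, fixedTime_self] using key m le_rfl

/-- The transferred cells have lengths tending to t - s > 0, so n times the length tends to infinity
and the relaxation is complete by the end of the cell. -/
lemma eventually_exp_le (hs : IsPenalizationScheme D T τ yn y xn kn x k) {s t σ : ℝ} (h0 : 0 ≤ s)
    (hst : s < t) (htT : t ≤ T) (hσ : 0 < σ) :
    ∀ᶠ n : ℕ in atTop,
      Real.exp (-(n * (fixedTime τ T n t - fixedTime τ T n s))) ≤ σ := by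
  have h1 := (tendsto_fixedTime hs.tendsto_timeChange (h0.trans hst.le) htT).sub
    (tendsto_fixedTime hs.tendsto_timeChange h0 (hst.le.trans htT))
  have h2 := Real.tendsto_exp_neg_atTop_nhds_zero.comp
    (tendsto_natCast_atTop_atTop.atTop_mul_pos (sub_pos.2 hst) h1)
  filter_upwards [h2.eventually (gt_mem_nhds hσ)] with n hn using hn.le

/-- Before the time change reaches a limiting time, the penalization terms converge to the left
limit. -/
lemma tendsto_preValue (hs : IsPenalizationScheme D T τ yn y xn kn x k) {S : ℝ} (hS : 0 ≤ S)
    (hST : S ≤ T) :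
    Tendsto (fun n => kn n (fixedTime τ T n S)) atTop (𝓝 (preValue k S)) := by
  obtain ⟨C, hC0, hC⟩ := hs.exists_variation_bound
  obtain ⟨B, hB0, hB⟩ := hs.cadlag.exists_bound T
  obtain ⟨c, hcD⟩ := hs.domain.nonempty
  have hne := hs.domain.nonempty
  have hc := hs.domain.convex
  set μ := normVariationMeasure k with hμ
  set M := μ.real (Icc 0 T) with hM
  have hM0 : 0 ≤ M := measureReal_nonneg
  -- A bound for the distance from xⁿ to c at the start of a cell, hence for its excess; the 2 comes
  -- from the input error 2ε with ε ≤ 1.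
  set R := B + 2 + C + ‖c‖ with hR
  have hR0 : 0 ≤ R := by positivity
  rw [Metric.tendsto_atTop']
  suffices hmain : ∀ δ > 0, ∀ᶠ n in atTop,
      ‖kn n (fixedTime τ T n S) - preValue k S‖ ^ 2 < δ by
    intro δ hδ
    obtain ⟨n0, hn0⟩ := eventually_atTop.1 (hmain (δ ^ 2) (by positivity))
    refine ⟨n0, fun n hn => ?_⟩
    rw [dist_eq_norm]
    exact lt_of_pow_lt_pow_left₀ 2 hδ.le (hn0 n hn.le)
  intro δ hδ
  -- These errors are weighted by variation increments or by masses of cells, so they sum to a bound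
  -- free of the number of cells. The relaxation error occurs once per cell, so σ is chosen only
  -- after m is known.
  obtain ⟨ε, hε0, hε1, hεδ⟩ : ∃ ε > 0, ε ≤ 1 ∧
      4 * ε * C + (4 * ε + 2 * (5 * ε + √(8 * ε * (C + R)))) * M < δ / 2 := by
    have hcont : Continuous fun ε : ℝ =>
        4 * ε * C + (4 * ε + 2 * (5 * ε + √(8 * ε * (C + R)))) * M := by fun_prop
    have h0 := (hcont.tendsto 0).mono_left (nhdsWithin_le_nhds (s := Ioi 0))
    simp only [mul_zero, zero_mul, Real.sqrt_zero, add_zero] at h0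
    obtain ⟨ε, h1, h2⟩ := ((h0.eventually (gt_mem_nhds (half_pos hδ))).and
      (Ioc_mem_nhdsGT zero_lt_one)).exists
    exact ⟨ε, h2.1, h2.2, h1⟩
  obtain ⟨m, t, ht, hev⟩ := hs.exists_partition hS hST hε0
  obtain ⟨σ, hσ0, hσδ⟩ : ∃ σ > 0, 2 * (σ * R) * M + m * (2 * σ * ((C + M) * M)) < δ / 2 := by
    have hcont : Continuous fun σ : ℝ =>
        2 * (σ * R) * M + m * (2 * σ * ((C + M) * M)) := by fun_prop
    have h0 := (hcont.tendsto 0).mono_left (nhdsWithin_le_nhds (s := Ioi 0))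
    simp only [mul_zero, zero_mul, add_zero] at h0
    obtain ⟨σ, h1, h2⟩ := ((h0.eventually (gt_mem_nhds (half_pos hδ))).and
      self_mem_nhdsWithin).exists
    exact ⟨σ, h2, h1⟩
  have hexp : ∀ᶠ n : ℕ in atTop, ∀ i ∈ Finset.range m,
      Real.exp (-(n * (fixedTime τ T n (t (i + 1)) - fixedTime τ T n (t i)))) ≤ σ := by
    rw [Filter.eventually_all_finset]
    intro i hi
    have hi := Finset.mem_range.1 hi
    exact hs.eventually_exp_le (ht.nonneg hi.le) (ht.lt i hi)
      ((ht.le_last (Nat.succ_le_of_lt hi)).trans hST) hσ0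
  have hleT : ∀ᶠ n : ℕ in atTop, ∀ i ∈ Finset.range (m + 1), fixedTime τ T n (t i) ≤ T := by
    rw [Filter.eventually_all_finset]
    intro i hi
    have hi : i ≤ m := Nat.lt_succ_iff.1 (Finset.mem_range.1 hi)
    exact eventually_fixedTime_le hs.tendsto_timeChange (ht.nonneg hi) ((ht.le_last hi).trans hST)
  filter_upwards [hev, hexp, hleT, hC, eventually_ge_atTop 1] with n hn hexp hleT hC hn1
  have h := hs.penalized n hn1
  set V := penaltyVariation D n (xn n) with hV
  set Z := 4 * ε + 2 * (5 * ε + (√(8 * ε * (C + R)) + σ * R)) with hZ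
  have hVC : ∀ i ≤ m, V (fixedTime τ T n (t i)) ≤ C := fun i hi =>
    (penaltyVariation_mono hne hc h.cadlag_x (hs.fixedTime_nonneg n (ht.nonneg hi))
      (hleT i (Finset.mem_range.2 (by omega)))).trans hC
  have hind : ∀ i ≤ m, ‖kn n (fixedTime τ T n (t i)) - preValue k (t i)‖ ^ 2 ≤
      4 * ε * V (fixedTime τ T n (t i)) + Z * μ.real (Ico 0 (t i)) +
        i * (2 * σ * ((C + M) * M)) := by
    intro i
    induction i with
    | zero =>
      intro _
      rw [ht.zero, fixedTime_zero hs.timeChange hs.pos, h.zero, hV, penaltyVariation_zero]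
      simp [preValue]
    | succ i ih =>
      intro hi
      have him : i < m := by omega
      obtain ⟨hlt, hosc⟩ := hn i him
      have hti := ht.nonneg him.le
      have htT : t (i + 1) ≤ T := (ht.le_last hi).trans hST
      have ha := hs.fixedTime_nonneg n hti
      have hd : ∀ r ∈ Ico (t i) (t (i + 1)), ‖y r - y (t i)‖ ≤ ε ∧ ‖x r - x (t i)‖ ≤ ε := by
        intro r hr
        have hd := ht.dist_le i him r hr
        rw [Prod.dist_eq, Prod.dist_eq, max_le_iff, max_le_iff, dist_eq_norm, dist_eq_norm] at hd
        exact hd.2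
      have hstart : ‖excess D (xn n (fixedTime τ T n (t i)))‖ ≤ R := by
        refine (norm_excess_le hne _ (subset_closure hcD)).trans ?_
        have e1 := (hosc _ ⟨le_rfl, hlt⟩).2
        have e2 := (h.norm_le_penaltyVariation hne hc ha).trans (hVC i him.le)
        have e3 := hB (t i) ⟨hti, (ht.lt i him).le.trans htT⟩
        rw [h.eq_add _ ha]
        have e4 := norm_sub_le (yn n (fixedTime τ T n (t i)) + kn n (fixedTime τ T n (t i))) c
        have e5 := norm_add_le (yn n (fixedTime τ T n (t i))) (kn n (fixedTime τ T n (t i)))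
        have e6 := norm_sub_norm_le (yn n (fixedTime τ T n (t i))) (y (t i))
        linarith
      have hstep := hs.skorokhod.step hs.domain h hti (ht.lt i him) htT ha hlt
        (fun r hr => (hd r hr).1) (fun r hr => (hd r hr).2) (fun u hu => (hosc u hu).2)
        (hexp i (Finset.mem_range.2 him)) (hVC (i + 1) hi) hstart
      have hadd : μ.real (Ico 0 (t (i + 1))) =
          μ.real (Ico 0 (t i)) + μ.real (Ico (t i) (t (i + 1))) := by
        rw [← Ico_union_Ico_eq_Ico hti (ht.lt i him).le]
        exact measureReal_union Ico_disjoint_Ico_same measurableSet_Ico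
          (normVariationMeasure_ne_top (S := t i) Ico_subset_Icc_self)
          (normVariationMeasure_ne_top (S := t (i + 1)) fun r hr => ⟨hti.trans hr.1, hr.2.le⟩)
      have := ih him.le
      rw [hadd]
      push_cast
      rw [← hZ] at hstep
      linarith
  have hfinal := hind m le_rfl
  rw [ht.last] at hfinal
  refine hfinal.trans_lt ?_
  have hμS : μ.real (Ico 0 S) ≤ M :=
    measureReal_mono (fun r hr => ⟨hr.1, hr.2.le.trans hST⟩) (normVariationMeasure_Icc_ne_top k T)
  have hVS : V (fixedTime τ T n S) ≤ C := by simpa [ht.last] using hVC m le_rfl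
  have f1 := mul_le_mul_of_nonneg_left hVS (show 0 ≤ 4 * ε by positivity)
  have f2 := mul_le_mul_of_nonneg_left hμS (show 0 ≤ Z by positivity)
  have f3 : Z * M = (4 * ε + 2 * (5 * ε + √(8 * ε * (C + R)))) * M + 2 * (σ * R) * M := by
    rw [hZ]; ring
  linarith

end IsPenalizationScheme

end Scheme

/-! ### Integrals along the penalization term -/

section Integrals

variable {d : ℕ} {D : Set (EuclideanSpace ℝ (Fin d))} {n : ℕ}
  {Y z K y x k : ℝ → EuclideanSpace ℝ (Fin d)}
  {g : ℝ → EuclideanSpace ℝ (Fin d) → ℝ}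

lemma drift_eq_smul_inwardNormal (hD : IsBoundedConvexC2Domain D) (s : ℝ) :
    drift D n z s = ‖drift D n z s‖ • inwardNormal D (proj D (z s)) := by
  rw [norm_drift, drift]
  nth_rewrite 1 [excess_eq_smul_inwardNormal hD (z s)]
  rw [smul_neg, neg_neg, smul_smul]

/-- On a short time interval the penalization term moves along a fixed direction `ν`, and
integrals against its variation become integrals over a segment. -/
lemma IsPenalizedSolution.integral_near_segment (hD : IsBoundedConvexC2Domain D)
    (h : IsPenalizedSolution D n Y z K)
    (hg : ContinuousOn (Function.uncurry g) (Ici 0 ×ˢ univ))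
    {H : ℝ → ℝ} (hH : Continuous H) {ν : EuclideanSpace ℝ (Fin d)} {a b η Γ : ℝ} (ha : 0 ≤ a)
    (hab : a ≤ b)
    (hclose : ∀ u ∈ Ico a b, |g u (z u) - H (inner ℝ ν (K u - K a))| ≤ η)
    (hbound : ∀ u ∈ Ico a b, |H (inner ℝ ν (K u - K a))| ≤ Γ)
    (hν : ∀ u ∈ Ico a b, excess D (z u) ≠ 0 → ‖inwardNormal D (proj D (z u)) - ν‖ ≤ η) :
    |(∫ u in a..b, g u (z u) * ‖drift D n z u‖) - ∫ v in (0 : ℝ)..inner ℝ ν (K b - K a), H v| ≤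
      η * (1 + Γ) * (penaltyVariation D n z b - penaltyVariation D n z a) := by
  rcases hab.eq_or_lt with rfl | hlt
  · simp
  have hη : 0 ≤ η := (abs_nonneg _).trans (hclose a ⟨le_rfl, hlt⟩)
  have hΓ : 0 ≤ Γ := (abs_nonneg _).trans (hbound a ⟨le_rfl, hlt⟩)
  have hb : 0 ≤ b := ha.trans hab
  have hne := hD.nonempty
  have hc := hD.convex
  have hdr := isRightRegular_drift (n := n) hne hc h.cadlag_x
  set f : ℝ → ℝ := fun u => inner ℝ ν (K u - K a) with hf
  have hfd : ∀ u, 0 ≤ u → HasDerivWithinAt f (inner ℝ ν (drift D n z u)) (Ici u) u := by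
    intro u hu
    have h1 := (hasDerivWithinAt_const u (Ici u) ν).inner ℝ
      ((h.hasDerivWithinAt hne hc hu).sub_const (K a))
    simpa using h1
  have hfc : ContinuousOn f (Icc a b) :=
    continuousOn_const.inner ((h.continuousOn hne hc ha).sub continuousOn_const)
  have hreg1 : IsRightRegular (fun u => g u (z u) * ‖drift D n z u‖) :=
    (h.cadlag_x.isRightRegular_comp hg).mul hdr.norm
  have hin : IsRightRegular (fun u => inner ℝ ν (drift D n z u)) := by
    refine ⟨fun t ht => continuousWithinAt_const.inner (hdr.1 t ht), fun S => ?_⟩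
    obtain ⟨C, hC⟩ := hdr.2 S
    exact ⟨‖ν‖ * C, fun s hs => (norm_inner_le_norm _ _).trans
      (mul_le_mul_of_nonneg_left (hC s hs) (norm_nonneg _))⟩
  have hint2 : IntegrableOn (fun u => (H ∘ f) u * inner ℝ ν (drift D n z u)) (uIcc a b) := by
    rw [uIcc_of_le hab]
    have h1 : IntegrableOn (fun u => inner ℝ ν (drift D n z u)) (Icc a b) :=
      (hin.integrableOn (S := b) (by simp)).mono_set (Icc_subset_Icc_left ha)
    exact h1.continuousOn_mul (hH.comp_continuousOn hfc) isCompact_Icc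
  -- The function f need not be monotone: the substitution only needs its right derivative, and
  -- backtracking cancels in the oriented integral.
  have hsubst : ∫ u in a..b, (H ∘ f) u * inner ℝ ν (drift D n z u) = ∫ v in f a..f b, H v := by
    refine intervalIntegral.integral_comp_mul_deriv''' (by rwa [uIcc_of_le hab]) (fun u hu => ?_)
      hH.continuousOn ?_ hint2
    · rw [min_eq_left hab] at hu
      exact (hfd u (ha.trans hu.1.le)).mono Ioi_subset_Ici_self
    · refine hH.locallyIntegrable.integrableOn_isCompact ?_
      rw [uIcc_of_le hab]
      exact isCompact_Icc.image_of_continuousOn hfc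
  have hfa : f a = 0 := by simp [hf]
  rw [hfa] at hsubst
  have hint2' : IntervalIntegrable (fun u => (H ∘ f) u * inner ℝ ν (drift D n z u)) volume a b := by
    rw [intervalIntegrable_iff]
    exact hint2.mono_set uIoc_subset_uIcc
  rw [show (∫ v in (0 : ℝ)..inner ℝ ν (K b - K a), H v) = ∫ v in (0 : ℝ)..f b, H v from rfl,
    ← hsubst, ← intervalIntegral.integral_sub (hreg1.intervalIntegrable ha hb) hint2',
    penaltyVariation, penaltyVariation, hdr.norm.integral_sub ha hb,
    ← intervalIntegral.integral_const_mul, ← Real.norm_eq_abs]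
  refine intervalIntegral.norm_integral_le_of_norm_le hab ?_
    ((hdr.norm.intervalIntegrable ha hb).const_mul _)
  have hnb : ∀ᵐ u : ℝ, u ≠ b := by simp [ae_iff]
  filter_upwards [hnb] with u hub hu
  have hu' : u ∈ Ico a b := ⟨hu.1.le, lt_of_le_of_ne hu.2 hub⟩
  have e : g u (z u) * ‖drift D n z u‖ - (H ∘ f) u * inner ℝ ν (drift D n z u) =
      (g u (z u) - H (f u)) * ‖drift D n z u‖ +
        H (f u) * (‖drift D n z u‖ - inner ℝ ν (drift D n z u)) := by
    simp only [Function.comp]; ring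
  -- The drift is its norm times the normal at the projected point, so the defect is the product of
  -- the drift with the difference between that normal and ν.
  have h2 : |‖drift D n z u‖ - inner ℝ ν (drift D n z u)| ≤ η * ‖drift D n z u‖ := by
    by_cases he : excess D (z u) = 0
    · simp [drift, he]
    have hfr := proj_mem_frontier hD.isOpen hne hc he
    have e1 : ‖drift D n z u‖ - inner ℝ ν (drift D n z u) =
        inner ℝ (inwardNormal D (proj D (z u)) - ν) (drift D n z u) := by
      have e2 : inner ℝ (inwardNormal D (proj D (z u))) (drift D n z u) = ‖drift D n z u‖ := by
        nth_rewrite 1 [drift_eq_smul_inwardNormal hD u]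
        rw [real_inner_smul_right, real_inner_self_eq_norm_sq, norm_inwardNormal hD hfr]
        simp
      rw [inner_sub_left, e2]
    rw [e1]
    exact (abs_real_inner_le_norm _ _).trans
      (mul_le_mul_of_nonneg_right (hν u hu' he) (norm_nonneg _))
  rw [e, Real.norm_eq_abs]
  refine (abs_add_le _ _).trans ?_
  rw [abs_mul, abs_mul, abs_of_nonneg (norm_nonneg (drift D n z u))]
  have h3 := mul_le_mul_of_nonneg_right (hclose u hu') (norm_nonneg (drift D n z u))
  have h4 := mul_le_mul (hbound u hu') h2 (abs_nonneg _) hΓ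
  calc _ ≤ η * ‖drift D n z u‖ + Γ * (η * ‖drift D n z u‖) := add_le_add h3 h4
    _ = η * (1 + Γ) * ‖drift D n z u‖ := by ring

/-- The value at a jump of the integral along the reflecting segment. -/
lemma IsSkorokhodSolution.integral_segment (hD : IsBoundedConvexC2Domain D)
    (hx : IsSkorokhodSolution D y x k)
    (hg : ContinuousOn (Function.uncurry g) (Ici 0 ×ˢ univ)) {s : ℝ} (hs : 0 ≤ s)
    {ν : EuclideanSpace ℝ (Fin d)} (hν : x s ∈ frontier D → ν = inwardNormal D (x s)) :
    ∫ v in (0 : ℝ)..‖jump k s‖, g s (x s - (‖jump k s‖ - v) • ν) =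
      jumpTerm D g x k s + ‖jump k s‖ * g s (x s) := by
  by_cases hj : jump k s = 0
  · simp [hj, jumpTerm]
  have hf := hx.mem_frontier_of_jump hD hs hj
  rw [hν hf]
  have hgs : Continuous (g s) := by
    have : Continuous fun w => Function.uncurry g (s, w) := by
      refine ContinuousOn.comp_continuous hg (by fun_prop) fun w => ⟨hs, mem_univ _⟩
    exact this
  -- The penalized path runs towards the boundary, whereas the jump term measures r outwards from
  -- it; reflecting the segment reconciles the two.
  have h1 : ∫ v in (0 : ℝ)..‖jump k s‖, g s (x s - (‖jump k s‖ - v) • inwardNormal D (x s)) =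
      ∫ r in (0 : ℝ)..‖jump k s‖, g s (x s - r • inwardNormal D (x s)) := by
    rw [intervalIntegral.integral_comp_sub_left
      (fun r => g s (x s - r • inwardNormal D (x s)))]
    simp
  have h2 : jumpTerm D g x k s = ∫ r in (0 : ℝ)..‖jump k s‖,
      (g s (x s - r • inwardNormal D (x s)) - g s (x s)) := by
    refine intervalIntegral.integral_congr fun r hr => ?_
    rw [uIcc_of_le (norm_nonneg _)] at hr
    rw [proj_sub_smul_inwardNormal hD hf hr.1]
  rw [h1, h2, intervalIntegral.integral_sub, intervalIntegral.integral_const]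
  · simp
  · exact Continuous.intervalIntegrable (by fun_prop) _ _
  · exact Continuous.intervalIntegrable (by fun_prop) _ _

lemma IsSkorokhodSolution.abs_jumpTerm_le (hD : IsBoundedConvexC2Domain D)
    (hx : IsSkorokhodSolution D y x k) {s η : ℝ} (hs : 0 ≤ s)
    (hη : ∀ w, ‖w - x s‖ ≤ ‖jump k s‖ → |g s w - g s (x s)| ≤ η) :
    |jumpTerm D g x k s| ≤ η * ‖jump k s‖ := by
  by_cases hj : jump k s = 0
  · simp [hj, jumpTerm]
  have hf := hx.mem_frontier_of_jump hD hs hj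
  have := intervalIntegral.norm_integral_le_of_norm_le_const (a := 0) (b := ‖jump k s‖)
    (f := fun r => g s (x s - r • inwardNormal D (x s)) -
      g s (proj D (x s - r • inwardNormal D (x s)))) (C := η) (fun r hr => by
      rw [uIoc_of_le (norm_nonneg _)] at hr
      rw [proj_sub_smul_inwardNormal hD hf hr.1.le]
      refine hη _ ?_
      rw [sub_sub_cancel_left, norm_neg, norm_smul, norm_inwardNormal hD hf, mul_one,
        Real.norm_of_nonneg hr.1.le]
      exact hr.2)
  rw [sub_zero, abs_of_nonneg (norm_nonneg _)] at this
  exact this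

/-- On a short interval of the limit, the integral along the segment splits into the jump term
and the integral along the reflected path. -/
lemma IsSkorokhodSolution.integral_segment_near (hD : IsBoundedConvexC2Domain D)
    (hx : IsSkorokhodSolution D y x k)
    (hg : ContinuousOn (Function.uncurry g) (Ici 0 ×ˢ univ))
    {N : EuclideanSpace ℝ (Fin d) → EuclideanSpace ℝ (Fin d)} (hN : Continuous N)
    (hN1 : ∀ z, ‖N z‖ ≤ 1) (hNn : ∀ p ∈ frontier D, N p = inwardNormal D p)
    {s t η θ Γ : ℝ} (hs : 0 ≤ s) (hst : s < t)
    (hk : ‖preValue k t - k s‖ ≤ θ)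
    (hg1 : ∀ w, ‖w - x s‖ ≤ θ → |g s w - g s (x s)| ≤ η)
    (hg2 : ∀ r ∈ Ico s t, |g s (x s) - g r (x r)| ≤ η)
    (hΓ : |g s (x s)| ≤ Γ)
    (hNx : ∀ r ∈ Ico s t, ‖N (x s) - N (x r)‖ ≤ η) :
    |(∫ v in (0 : ℝ)..inner ℝ (N (x s)) (preValue k t - preValue k s),
        g s (x s - (‖jump k s‖ - v) • N (x s))) - (jumpTerm D g x k s +
          ∫ r in Ico s t, g r (x r) ∂(normVariationMeasure k))| ≤
      η * (2 + Γ) * (normVariationMeasure k).real (Ico s t) := by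
  set μ := normVariationMeasure k with hμ
  set ν := N (x s) with hν
  set F : ℝ := inner ℝ ν (preValue k t - preValue k s) with hF
  have hη : 0 ≤ η := (abs_nonneg _).trans (hg2 s ⟨le_rfl, hst⟩)
  have hsub : Ico s t ⊆ Icc 0 t := fun r hr => ⟨hs.trans hr.1, hr.2.le⟩
  have hsubo : Ioo s t ⊆ Icc 0 t := fun r hr => hsub ⟨hr.1.le, hr.2⟩
  have hfin := isFiniteMeasure_restrict_normVariationMeasure (k := k) hsub
  have hgs : Continuous (g s) := by
    have : Continuous fun w => Function.uncurry g (s, w) := by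
      refine ContinuousOn.comp_continuous hg (by fun_prop) fun w => ⟨hs, mem_univ _⟩
    exact this
  have hH : Continuous fun v => g s (x s - (‖jump k s‖ - v) • ν) := by fun_prop
  have hνj : inner ℝ ν (jump k s) = ‖jump k s‖ := by
    by_cases hj : jump k s = 0
    · simp [hj]
    have hf := hx.mem_frontier_of_jump hD hs hj
    nth_rewrite 1 [hx.jump_eq_norm_smul hD hs]
    rw [hν, hNn _ hf, real_inner_smul_right, real_inner_self_eq_norm_sq, norm_inwardNormal hD hf]
    simp
  have hFj : F - ‖jump k s‖ = inner ℝ ν (preValue k t - k s) := by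
    rw [← hνj, hF, ← inner_sub_right, jump_eq_sub_preValue]
    congr 1; abel
  have hFθ : |F - ‖jump k s‖| ≤ ‖preValue k t - k s‖ := by
    rw [hFj]
    exact (abs_real_inner_le_norm _ _).trans (mul_le_of_le_one_left (norm_nonneg _) (hN1 _))
  have hkμ : ‖preValue k t - k s‖ ≤ μ.real (Ico s t) := by
    rw [hx.preValue_sub hD hN hN1 hNn hs hst]
    refine (norm_setIntegral_le_of_norm_le_const
      (normVariationMeasure_ne_top (k := k) hsubo).lt_top (fun r _ => hN1 (x r))).trans ?_
    rw [one_mul]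
    exact measureReal_mono Ioo_subset_Ico_self (normVariationMeasure_ne_top hsub)
  -- the part of the segment outside the jump
  have s1 : |(∫ v in ‖jump k s‖..F, g s (x s - (‖jump k s‖ - v) • ν)) -
      (F - ‖jump k s‖) * g s (x s)| ≤ η * μ.real (Ico s t) := by
    have e : (F - ‖jump k s‖) * g s (x s) = ∫ v in ‖jump k s‖..F, g s (x s) := by simp
    rw [e, ← intervalIntegral.integral_sub (hH.intervalIntegrable _ _)
      (continuous_const.intervalIntegrable _ _)]
    have := intervalIntegral.norm_integral_le_of_norm_le_const (a := ‖jump k s‖) (b := F)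
      (f := fun v => g s (x s - (‖jump k s‖ - v) • ν) - g s (x s)) (C := η) (fun v hv => ?_)
    · exact this.trans (mul_le_mul_of_nonneg_left (hFθ.trans hkμ) hη)
    · refine hg1 _ ?_
      have h1 : |‖jump k s‖ - v| ≤ |F - ‖jump k s‖| := by
        have := abs_sub_left_of_mem_uIcc (uIoc_subset_uIcc hv)
        rwa [abs_sub_comm]
      rw [sub_sub_cancel_left, norm_neg, norm_smul, Real.norm_eq_abs]
      exact (mul_le_of_le_one_right (abs_nonneg _) (hN1 _)).trans (h1.trans (hFθ.trans hk))
  -- comparison with the integral along the path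
  have hNi := hx.integrableOn hN hsub
  have hgi : IntegrableOn (fun r => g r (x r)) (Ico s t) μ :=
    ((hx.cadlag_x.isRightRegular_comp hg).integrableOn
      (normVariationMeasure_Icc_ne_top k t)).mono_set hsub
  have s2 : |F * g s (x s) - ∫ r in Ico s t, g r (x r) ∂μ| ≤
      η * (1 + Γ) * μ.real (Ico s t) := by
    -- The number F is the integral of ⟨ν, N(x_r)⟩, which is nearly 1 since N(x_r) is a unit vector
    -- close to ν almost everywhere on [s, t).
    have e : F * g s (x s) = ∫ r in Ico s t, inner ℝ ν (N (x r)) * g s (x s) ∂μ := by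
      rw [integral_mul_const, integral_inner hNi, ← hx.preValue_sub_preValue hD hN hN1 hNn hs hst.le]
    have hNi' : Integrable (fun r => inner ℝ ν (N (x r)) * g s (x s)) (μ.restrict (Ico s t)) :=
      (hNi.const_inner ν).mul_const _
    rw [e, ← integral_sub hNi' hgi]
    have := norm_integral_le_of_norm_le_const (μ := μ.restrict (Ico s t))
      (f := fun r => inner ℝ ν (N (x r)) * g s (x s) - g r (x r)) (C := η * (1 + Γ)) ?_
    · rwa [measureReal_restrict_apply_univ] at this
    filter_upwards [hx.ae_mem_frontier hD hsub measurableSet_Ico,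
      ae_restrict_mem measurableSet_Ico] with r hr1 hr2
    have hn : inner ℝ (N (x r)) (N (x r)) = (1 : ℝ) := by
      rw [real_inner_self_eq_norm_sq, hNn _ hr1, norm_inwardNormal hD hr1]; norm_num
    have e1 : inner ℝ ν (N (x r)) * g s (x s) - g r (x r) =
        inner ℝ (ν - N (x r)) (N (x r)) * g s (x s) + (g s (x s) - g r (x r)) := by
      rw [inner_sub_left, hn]; ring
    rw [e1]
    refine (norm_add_le _ _).trans ?_
    rw [norm_mul, Real.norm_eq_abs, Real.norm_eq_abs, Real.norm_eq_abs]
    have h1 : |inner ℝ (ν - N (x r)) (N (x r))| ≤ η :=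
      (abs_real_inner_le_norm _ _).trans
        ((mul_le_of_le_one_right (norm_nonneg _) (hN1 _)).trans (hNx r hr2))
    have h2 := mul_le_mul h1 hΓ (abs_nonneg _) hη
    linarith [hg2 r hr2]
  have s3 := hx.integral_segment hD hg hs (ν := ν) (fun hf => hNn _ hf)
  rw [← intervalIntegral.integral_add_adjacent_intervals
    (hH.intervalIntegrable 0 ‖jump k s‖) (hH.intervalIntegrable ‖jump k s‖ F), s3]
  rw [abs_le] at s1 s2 ⊢
  constructor <;> nlinarith [s1.1, s1.2, s2.1, s2.2]

end Integrals

/-! ### Convergence of the integrals -/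

section Limit

variable {d : ℕ} {D : Set (EuclideanSpace ℝ (Fin d))} {T : ℝ} {τ : ℕ → ℝ → ℝ}
  {yn xn kn : ℕ → ℝ → EuclideanSpace ℝ (Fin d)} {y x k : ℝ → EuclideanSpace ℝ (Fin d)}
  {g : ℝ → EuclideanSpace ℝ (Fin d) → ℝ}
  {N : EuclideanSpace ℝ (Fin d) → EuclideanSpace ℝ (Fin d)}

/-- `Γ` bounds `g` on `[0, T] × B(0, R)`. -/
def IsBoundOn (g : ℝ → EuclideanSpace ℝ (Fin d) → ℝ) (T R Γ : ℝ) : Prop :=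
  ∀ s ∈ Icc 0 T, ∀ w, ‖w‖ ≤ R → |g s w| ≤ Γ

/-- On `[0, T] × B(0, R)`, `θ`-close points have `η`-close images under `g` and `N`. -/
def IsModulusOn (g : ℝ → EuclideanSpace ℝ (Fin d) → ℝ)
    (N : EuclideanSpace ℝ (Fin d) → EuclideanSpace ℝ (Fin d)) (T R η θ : ℝ) : Prop :=
  ∀ s ∈ Icc 0 T, ∀ s' ∈ Icc 0 T, ∀ w w', ‖w‖ ≤ R → ‖w'‖ ≤ R → |s - s'| ≤ θ → ‖w - w'‖ ≤ θ →
    |g s w - g s' w'| ≤ η ∧ ‖N w - N w'‖ ≤ η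

lemma exists_isBoundOn (hg : ContinuousOn (Function.uncurry g) (Ici 0 ×ˢ univ)) (T R : ℝ) :
    ∃ Γ, 0 ≤ Γ ∧ IsBoundOn g T R Γ := by
  have hK : IsCompact (Icc 0 T ×ˢ Metric.closedBall (0 : EuclideanSpace ℝ (Fin d)) R) :=
    isCompact_Icc.prod (isCompact_closedBall _ _)
  obtain ⟨Γ, hΓ⟩ := hK.exists_bound_of_continuousOn
    (hg.mono (prod_mono Icc_subset_Ici_self (subset_univ _)))
  exact ⟨max Γ 0, le_max_right _ _, fun s hs w hw =>
    (hΓ (s, w) ⟨hs, by simpa using hw⟩).trans (le_max_left _ _)⟩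

lemma exists_isModulusOn (hg : ContinuousOn (Function.uncurry g) (Ici 0 ×ˢ univ))
    (hN : Continuous N) (T R : ℝ) {η : ℝ} (hη : 0 < η) :
    ∃ θ > 0, IsModulusOn g N T R η θ := by
  have hK : IsCompact (Icc 0 T ×ˢ Metric.closedBall (0 : EuclideanSpace ℝ (Fin d)) R) :=
    isCompact_Icc.prod (isCompact_closedBall _ _)
  have h1 := hK.uniformContinuousOn_of_continuous
    (hg.mono (prod_mono Icc_subset_Ici_self (subset_univ _)))
  have h2 := (isCompact_closedBall (0 : EuclideanSpace ℝ (Fin d)) R).uniformContinuousOn_of_continuous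
    hN.continuousOn
  obtain ⟨θ1, hθ1, H1⟩ := Metric.uniformContinuousOn_iff.1 h1 η hη
  obtain ⟨θ2, hθ2, H2⟩ := Metric.uniformContinuousOn_iff.1 h2 η hη
  refine ⟨min θ1 θ2 / 2, by positivity, fun s hs s' hs' w w' hw hw' hss hww => ?_⟩
  have hlt : min θ1 θ2 / 2 < min θ1 θ2 := half_lt_self (by positivity)
  constructor
  · have := H1 (s, w) ⟨hs, by simpa using hw⟩ (s', w') ⟨hs', by simpa using hw'⟩ (by
      rw [Prod.dist_eq, Real.dist_eq, dist_eq_norm]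
      exact (max_le hss hww).trans_lt (hlt.trans_le (min_le_left _ _)))
    rw [Real.dist_eq] at this
    exact this.le
  · have := H2 w (by simpa using hw) w' (by simpa using hw') (by
      rw [dist_eq_norm]
      exact hww.trans_lt (hlt.trans_le (min_le_right _ _)))
    rw [dist_eq_norm] at this
    exact this.le

/-- With g bounded by Γ on a ball containing all the jump segments, each term is at most 2Γ|Δk_s|,
and the jump sizes are summable. -/
lemma IsSkorokhodSolution.summable_jumpTerm (hD : IsBoundedConvexC2Domain D)
    (hx : IsSkorokhodSolution D y x k)
    (hg : ContinuousOn (Function.uncurry g) (Ici 0 ×ˢ univ)) (T : ℝ) :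
    Summable (fun s : Icc (0 : ℝ) T => jumpTerm D g x k s) := by
  obtain ⟨B, -, hB⟩ := hx.cadlag_x.exists_bound T
  set M := (normVariationMeasure k).real (Icc 0 T)
  obtain ⟨Γ, hΓ0, hΓ⟩ := exists_isBoundOn hg T (B + M)
  refine Summable.of_norm_bounded ((hx.summable_norm_jump hD T).mul_left (Γ + Γ)) fun s => ?_
  refine hx.abs_jumpTerm_le hD s.2.1 fun w hw => ?_
  have hj : ‖jump k s‖ ≤ M := by simpa using hx.sum_norm_jump_le hD {s}
  have hxs := hB s s.2
  have hM0 : 0 ≤ M := measureReal_nonneg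
  refine (abs_sub _ _).trans (add_le_add (hΓ s s.2 _ ?_) (hΓ s s.2 _ (by linarith)))
  linarith [norm_sub_norm_le w (x s)]

lemma IsFinePartition.norm_le {ε S : ℝ} {m : ℕ} {t : ℕ → ℝ}
    (ht : IsFinePartition (fun s => (s, y s, x s)) ε S m t) {i : ℕ} (hi : i < m) {r : ℝ}
    (hr : r ∈ Ico (t i) (t (i + 1))) :
    |r - t i| ≤ ε ∧ ‖y r - y (t i)‖ ≤ ε ∧ ‖x r - x (t i)‖ ≤ ε := by
  have hd := ht.dist_le i hi r hr
  rw [Prod.dist_eq, Prod.dist_eq, max_le_iff, max_le_iff, dist_eq_norm, dist_eq_norm,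
    dist_eq_norm] at hd
  exact hd

lemma IsSkorokhodSolution.norm_sub_le (hx : IsSkorokhodSolution D y x k) {ε S : ℝ} {m : ℕ}
    {t : ℕ → ℝ} (ht : IsFinePartition (fun s => (s, y s, x s)) ε S m t) {i : ℕ} (hi : i < m)
    {r : ℝ} (hr : r ∈ Ico (t i) (t (i + 1))) : ‖k r - k (t i)‖ ≤ 2 * ε := by
  have hti := ht.nonneg hi.le
  obtain ⟨-, h1, h2⟩ := ht.norm_le hi hr
  have e : k r - k (t i) = (x r - x (t i)) - (y r - y (t i)) := by
    rw [hx.eq_add r (hti.trans hr.1), hx.eq_add _ hti]; abel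
  rw [e]
  linarith [_root_.norm_sub_le (x r - x (t i)) (y r - y (t i))]

lemma IsSkorokhodSolution.norm_preValue_sub_le (hx : IsSkorokhodSolution D y x k) {ε S : ℝ} {m : ℕ}
    {t : ℕ → ℝ} (ht : IsFinePartition (fun s => (s, y s, x s)) ε S m t) {i : ℕ} (hi : i < m)
    {r : ℝ} (hr : r ∈ Ioc (t i) (t (i + 1))) : ‖preValue k r - k (t i)‖ ≤ 2 * ε := by
  refine le_of_tendsto ((hx.cadlag_k.tendsto_preValue
    ((ht.nonneg hi.le).trans_lt hr.1)).sub_const (k (t i))).norm ?_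
  filter_upwards [Ioo_mem_nhdsLT hr.1] with u hu
  exact hx.norm_sub_le ht hi ⟨hu.1.le, hu.2.trans_le hr.2⟩

/-- Jumps at times outside a fine partition contribute little. -/
lemma IsSkorokhodSolution.abs_sum_jumpTerm_sub_le (hD : IsBoundedConvexC2Domain D)
    (hx : IsSkorokhodSolution D y x k)
    (hg : ContinuousOn (Function.uncurry g) (Ici 0 ×ˢ univ)) {B θ η ε : ℝ}
    (hB : ∀ s ∈ Icc 0 T, ‖x s‖ ≤ B) (hθ : IsModulusOn g N T (B + 1) η θ) (hθ1 : θ ≤ 1)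
    (hη : 0 ≤ η) (hε : 4 * ε ≤ θ) (hjT : jump k T = 0) {m : ℕ} {t : ℕ → ℝ}
    (ht : IsFinePartition (fun s => (s, y s, x s)) ε T m t) :
    |∑ i ∈ Finset.range m, jumpTerm D g x k (t i) - ∑' s : Icc (0 : ℝ) T, jumpTerm D g x k s| ≤
      η * (normVariationMeasure k).real (Icc 0 T) := by
  classical
  let e : Fin m → Icc (0 : ℝ) T := fun i =>
    ⟨t i, ht.nonneg i.2.le, ht.le_last i.2.le⟩
  have hinj : Function.Injective e := by
    have hlt : ∀ i j : Fin m, i < j → t i < t j := fun i j hij =>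
      (ht.lt i i.2).trans_le (ht.le_of_le (Nat.succ_le_of_lt hij) j.2.le)
    intro i j hij
    have hij : t i = t j := congrArg Subtype.val hij
    rcases lt_trichotomy i j with h | h | h
    · exact absurd hij (hlt i j h).ne
    · exact h
    · exact absurd hij (hlt j i h).ne'
  set F : Finset (Icc (0 : ℝ) T) := Finset.univ.image e with hF
  have hsumF : ∑ i ∈ Finset.range m, jumpTerm D g x k (t i) = ∑ s ∈ F, jumpTerm D g x k s := by
    rw [hF, Finset.sum_image hinj.injOn, Finset.sum_range]
  have hsum := hx.summable_jumpTerm hD hg T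
  rw [hsumF, ← hsum.sum_add_tsum_compl (s := F), sub_add_cancel_left, abs_neg]
  have hjs := hx.summable_norm_jump hD T
  have hle : ∀ s : ↥((F : Set (Icc (0 : ℝ) T))ᶜ), ‖jumpTerm D g x k s‖ ≤ η * ‖jump k s‖ := by
    rintro ⟨⟨s, hs⟩, hsF⟩
    simp only [mem_compl_iff, Finset.mem_coe] at hsF
    simp only
    rcases hs.2.lt_or_eq with hsT | rfl
    · obtain ⟨i, hi, his⟩ := exists_mem_Ico_of_mem (t := t) (m := m) (s := s)
        (by rw [ht.zero]; exact hs.1) (by rwa [ht.last])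
      have hne : t i < s := by
        refine lt_of_le_of_ne his.1 fun heq => hsF ?_
        rw [hF, Finset.mem_image]
        exact ⟨⟨i, hi⟩, Finset.mem_univ _, Subtype.ext heq⟩
      -- Strictly inside a cell both k_s and k_{s-} are within 2ε of the value at the left end, so
      -- the jump is at most 4ε ≤ θ.
      have hj : ‖jump k s‖ ≤ θ := by
        have h1 := hx.norm_sub_le ht hi his
        have h2 := hx.norm_preValue_sub_le ht hi ⟨hne, his.2.le⟩
        have h3 : jump k s = (k s - k (t i)) - (preValue k s - k (t i)) := by
          rw [jump_eq_sub_preValue]; abel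
        rw [h3]
        linarith [_root_.norm_sub_le (k s - k (t i)) (preValue k s - k (t i))]
      refine hx.abs_jumpTerm_le hD hs.1 fun w hw => ?_
      have hxs := hB s hs
      have hθ0 : 0 ≤ θ := (norm_nonneg _).trans hj
      refine (hθ s hs s hs w (x s) ?_ (by linarith) (by simpa using hθ0) (hw.trans hj)).1
      linarith [norm_sub_norm_le w (x s)]
    · simp [jumpTerm, hjT]
  have hb := tsum_of_norm_bounded (hjs.subtype _ |>.mul_left η).hasSum hle
  refine hb.trans ?_
  rw [tsum_mul_left]
  refine mul_le_mul_of_nonneg_left ?_ hη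
  refine (Summable.tsum_subtype_le (fun s : Icc (0 : ℝ) T => ‖jump k s‖) _
    (fun _ => norm_nonneg _) hjs).trans ?_
  exact hjs.tsum_le_of_sum_le fun F => hx.sum_norm_jump_le hD F

/-- The limit functional is approximated by integrals over the segments attached to a fine
partition. -/
lemma IsSkorokhodSolution.abs_sum_integral_segment_sub_le (hD : IsBoundedConvexC2Domain D)
    (hx : IsSkorokhodSolution D y x k)
    (hg : ContinuousOn (Function.uncurry g) (Ici 0 ×ˢ univ)) (hN : Continuous N)
    (hN1 : ∀ z, ‖N z‖ ≤ 1) (hNn : ∀ p ∈ frontier D, N p = inwardNormal D p) {B θ η ε Γ : ℝ}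
    (hB : ∀ s ∈ Icc 0 T, ‖x s‖ ≤ B) (hΓ : IsBoundOn g T (B + 1) Γ)
    (hθ : IsModulusOn g N T (B + 1) η θ) (hθ1 : θ ≤ 1)
    (hη : 0 ≤ η) (hε : 4 * ε ≤ θ) (hε0 : 0 ≤ ε) (hT : 0 ≤ T) (hjT : jump k T = 0)
    {m : ℕ} {t : ℕ → ℝ} (ht : IsFinePartition (fun s => (s, y s, x s)) ε T m t) :
    |∑ i ∈ Finset.range m, (∫ v in (0 : ℝ)..inner ℝ (N (x (t i)))
        (preValue k (t (i + 1)) - preValue k (t i)),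
        g (t i) (x (t i) - (‖jump k (t i)‖ - v) • N (x (t i)))) - limitFunctional D T g x k| ≤
      η * (3 + Γ) * (normVariationMeasure k).real (Icc 0 T) := by
  set μ := normVariationMeasure k with hμ
  -- The cells cover only [0, T); the absence of a jump of k at T means no mass is lost there.
  have hμT : μ {T} = 0 := by
    have := hx.norm_jump hD hT
    rw [hjT, norm_zero, Measure.real] at this
    exact (ENNReal.toReal_eq_zero_iff _).1 this.symm |>.resolve_right
      (normVariationMeasure_ne_top (S := T) (singleton_subset_iff.2 ⟨hT, le_rfl⟩))
  have hsub : ∀ i < m, Ico (t i) (t (i + 1)) ⊆ Icc 0 T := fun i hi r hr =>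
    ⟨(ht.nonneg hi.le).trans hr.1, hr.2.le.trans (ht.le_last (Nat.succ_le_of_lt hi))⟩
  have hgint := (hx.cadlag_x.isRightRegular_comp hg).integrableOn
      (normVariationMeasure_Icc_ne_top k T)
  have hpath : ∀ j ≤ m, ∑ i ∈ Finset.range j, ∫ r in Ico (t i) (t (i + 1)), g r (x r) ∂μ =
      ∫ r in Ico 0 (t j), g r (x r) ∂μ ∧
      ∑ i ∈ Finset.range j, μ.real (Ico (t i) (t (i + 1))) = μ.real (Ico 0 (t j)) := by
    intro j
    induction j with
    | zero => simp [ht.zero]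
    | succ j ih =>
      intro hj
      have hj' : j < m := by omega
      have h0 := ht.nonneg hj'.le
      have hsub0 : Ico 0 (t j) ⊆ Icc 0 T := fun r hr =>
        ⟨hr.1, hr.2.le.trans (ht.le_last hj'.le)⟩
      rw [Finset.sum_range_succ, Finset.sum_range_succ, (ih hj'.le).1, (ih hj'.le).2,
        ← Ico_union_Ico_eq_Ico h0 (ht.lt j hj').le]
      exact ⟨(setIntegral_union Ico_disjoint_Ico_same measurableSet_Ico
        (hgint.mono_set hsub0) (hgint.mono_set (hsub j hj'))).symm,
        (measureReal_union Ico_disjoint_Ico_same measurableSet_Ico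
          (normVariationMeasure_ne_top hsub0) (normVariationMeasure_ne_top (hsub j hj'))).symm⟩
  obtain ⟨hp1, hp2⟩ := hpath m le_rfl
  rw [ht.last] at hp1 hp2
  have hIcc : ∫ r in Icc 0 T, g r (x r) ∂μ = ∫ r in Ico 0 T, g r (x r) ∂μ := by
    rw [← Ico_union_right hT]
    exact setIntegral_congr_set (union_ae_eq_left_of_ae_eq_empty (ae_eq_empty.2 hμT))
  have hμle : μ.real (Ico 0 T) ≤ μ.real (Icc 0 T) :=
    measureReal_mono Ico_subset_Icc_self (normVariationMeasure_Icc_ne_top k T)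
  have hΓ0 : 0 ≤ Γ := (abs_nonneg _).trans (hΓ 0 ⟨le_rfl, hT⟩ (x 0)
    (by linarith [hB 0 ⟨le_rfl, hT⟩]))
  have hstep : ∀ i ∈ Finset.range m, |(∫ v in (0 : ℝ)..inner ℝ (N (x (t i)))
        (preValue k (t (i + 1)) - preValue k (t i)),
        g (t i) (x (t i) - (‖jump k (t i)‖ - v) • N (x (t i)))) -
        (jumpTerm D g x k (t i) + ∫ r in Ico (t i) (t (i + 1)), g r (x r) ∂μ)| ≤
        η * (2 + Γ) * μ.real (Ico (t i) (t (i + 1))) := by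
    intro i hi
    have hi := Finset.mem_range.1 hi
    have hti : t i ∈ Icc 0 T := ⟨ht.nonneg hi.le, ht.le_last hi.le⟩
    have hxi := hB _ hti
    have hmod : ∀ r ∈ Ico (t i) (t (i + 1)),
        |g (t i) (x (t i)) - g r (x r)| ≤ η ∧ ‖N (x (t i)) - N (x r)‖ ≤ η := by
      intro r hr
      obtain ⟨h1, -, h3⟩ := ht.norm_le hi hr
      have hr' := hsub i hi hr
      refine hθ _ hti r hr' _ _ (by linarith) (by linarith [hB r hr']) ?_ ?_
      · rw [abs_sub_comm]; linarith
      · rw [norm_sub_rev]; linarith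
    refine hx.integral_segment_near hD hg hN hN1 hNn hti.1 (ht.lt i hi)
      (hx.norm_preValue_sub_le ht hi ⟨ht.lt i hi, le_rfl⟩) (fun w hw => ?_)
      (fun r hr => (hmod r hr).1) (hΓ _ hti _ (by linarith)) (fun r hr => (hmod r hr).2)
    refine (hθ _ hti _ hti w _ ?_ (by linarith) (by simp; linarith) (by linarith)).1
    linarith [norm_sub_norm_le w (x (t i))]
  have hjump := hx.abs_sum_jumpTerm_sub_le hD hg hB hθ hθ1 hη hε hjT ht
  have hsum := (Finset.abs_sum_le_sum_abs _ _).trans (Finset.sum_le_sum hstep)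
  rw [Finset.sum_sub_distrib, Finset.sum_add_distrib, ← Finset.mul_sum, hp1, hp2] at hsum
  rw [limitFunctional, ← hμ, hIcc]
  have hμ2 := mul_le_mul_of_nonneg_left hμle (show 0 ≤ η * (2 + Γ) by positivity)
  rw [abs_le] at hsum hjump ⊢
  constructor <;> nlinarith [hsum.1, hsum.2, hjump.1, hjump.2]

end Limit

/-! ### The penalized integral on one cell, and passage to the limit -/

section Final

variable {d : ℕ} {D : Set (EuclideanSpace ℝ (Fin d))} {T : ℝ} {τ : ℕ → ℝ → ℝ}
  {yn xn kn : ℕ → ℝ → EuclideanSpace ℝ (Fin d)} {y x k : ℝ → EuclideanSpace ℝ (Fin d)}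
  {g : ℝ → EuclideanSpace ℝ (Fin d) → ℝ}
  {N : EuclideanSpace ℝ (Fin d) → EuclideanSpace ℝ (Fin d)}

/-- Near a jump of the limit, the penalized path follows the segment determined by its
penalization term. -/
lemma IsSkorokhodSolution.integral_penalized_near (hD : IsBoundedConvexC2Domain D)
    (hx : IsSkorokhodSolution D y x k) {n : ℕ} {Y z K : ℝ → EuclideanSpace ℝ (Fin d)}
    (h : IsPenalizedSolution D n Y z K)
    (hg : ContinuousOn (Function.uncurry g) (Ici 0 ×ˢ univ))
    (hN1 : ∀ z, ‖N z‖ ≤ 1) (hNn : ∀ p ∈ frontier D, N p = inwardNormal D p)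
    {B C M R θ η ε Γ s a b : ℝ} (hs : s ∈ Icc 0 T) (hxs : ‖x s‖ ≤ B) (hj : ‖jump k s‖ ≤ M)
    (hR : B + M + 1 ≤ R) (hΓ : IsBoundOn g T R Γ) (hθ : IsModulusOn g N T R η (4 * θ))
    (hθ1 : 4 * θ ≤ 1) (ha : 0 ≤ a) (hab : a < b) (hbT : b ≤ T)
    (hC : penaltyVariation D n z b ≤ C) (hε : 0 ≤ ε) (hεθ : √(ε ^ 2 + 4 * ε * (C + M)) + 3 * ε ≤ θ)
    (hY : ∀ u ∈ Ico a b, |u - s| ≤ 2 * ε ∧ ‖Y u - y s‖ ≤ 2 * ε)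
    (hstart : ‖K a - preValue k s‖ ≤ ε) :
    |(∫ u in a..b, g u (z u) * ‖drift D n z u‖) -
        ∫ v in (0 : ℝ)..inner ℝ (N (x s)) (K b - K a),
          g s (x s - (‖jump k s‖ - v) • N (x s))| ≤
      η * (1 + Γ) * (penaltyVariation D n z b - penaltyVariation D n z a) := by
  have hne := hD.nonempty
  have hc := hD.convex
  set ν := N (x s) with hν
  have hsq := Real.sqrt_nonneg (ε ^ 2 + 4 * ε * (C + M))
  have hθ0 : 0 ≤ θ := by linarith
  have hB0 : 0 ≤ B := (norm_nonneg _).trans hxs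
  have hM0 : 0 ≤ M := (norm_nonneg _).trans hj
  have hgs : Continuous (g s) := by
    have : Continuous fun w => Function.uncurry g (s, w) := by
      refine ContinuousOn.comp_continuous hg (by fun_prop) fun w => ⟨hs.1, mem_univ _⟩
    exact this
  have hH : Continuous fun v => g s (x s - (‖jump k s‖ - v) • ν) := by fun_prop
  have hνj : ‖jump k s‖ • ν = jump k s := by
    by_cases hj0 : jump k s = 0
    · simp [hj0]
    · rw [hν, hNn _ (hx.mem_frontier_of_jump hD hs.1 hj0), ← hx.jump_eq_norm_smul hD hs.1]
  have hνj' : inner ℝ ν (jump k s) = ‖jump k s‖ := by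
    by_cases hj0 : jump k s = 0
    · simp [hj0]
    · have hf := hx.mem_frontier_of_jump hD hs.1 hj0
      rw [← hνj, real_inner_smul_right, real_inner_self_eq_norm_sq, hν, hNn _ hf,
        norm_inwardNormal hD hf, norm_smul, norm_inwardNormal hD hf]
      simp
  -- Both the penalized path and the segment point predicted by kⁿ are compared with the exponential
  -- ray. Their distances θ and 2θ to it add up to 3θ, within the modulus scale 4θ.
  have key : ∀ u ∈ Ico a b, ∃ l ∈ Icc (0 : ℝ) 1, ‖z u - (x s - l • jump k s)‖ ≤ θ ∧
      ‖(x s - (‖jump k s‖ - inner ℝ ν (K u - K a)) • ν) - (x s - l • jump k s)‖ ≤ 2 * θ := by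
    intro u hu
    have hu0 : 0 ≤ u := ha.trans hu.1
    set l := Real.exp (-(n * (u - a))) with hl
    have hl1 : l ≤ 1 := Real.exp_le_one_iff.2 (neg_nonpos.2
      (mul_nonneg (Nat.cast_nonneg n) (sub_nonneg.2 hu.1)))
    have h1 := hx.comparison hD h hs.1 ha (show 0 ≤ 2 * ε by positivity)
      (fun r hr => (hY r hr).2) ⟨hu.1, hu.2.le⟩
    have hVu : penaltyVariation D n z u - penaltyVariation D n z a ≤ C := by
      have e1 := penaltyVariation_mono (n := n) hne hc h.cadlag_x hu0 hu.2.le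
      have e2 := penaltyVariation_mono (n := n) hne hc h.cadlag_x le_rfl ha
      rw [penaltyVariation_zero] at e2
      linarith
    have h2 : ‖K u - (k s - l • jump k s)‖ ≤ √(ε ^ 2 + 4 * ε * (C + M)) := by
      refine Real.le_sqrt_of_sq_le (h1.trans (add_le_add ?_ ?_))
      · exact pow_le_pow_left₀ (norm_nonneg _) hstart 2
      · have := mul_le_mul_of_nonneg_left (add_le_add hVu hj) (show 0 ≤ 4 * ε by positivity)
        linarith
    refine ⟨l, ⟨(Real.exp_pos _).le, hl1⟩, ?_, ?_⟩
    · have e : z u - (x s - l • jump k s) = (K u - (k s - l • jump k s)) + (Y u - y s) := by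
        rw [h.eq_add u hu0, hx.eq_add s hs.1]; abel
      rw [e]
      linarith [norm_add_le (K u - (k s - l • jump k s)) (Y u - y s), (hY u hu).2]
    · have e1 : K u - K a = ((1 - l) • jump k s) +
          ((K u - (k s - l • jump k s)) - (K a - preValue k s)) := by
        have : k s = jump k s + preValue k s := by rw [jump_eq_sub_preValue]; abel
        rw [sub_smul, one_smul, this]; abel
      set r := (K u - (k s - l • jump k s)) - (K a - preValue k s) with hr
      have hr1 : ‖r‖ ≤ 2 * θ := by
        linarith [_root_.norm_sub_le (K u - (k s - l • jump k s)) (K a - preValue k s)]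
      have e2 : (x s - (‖jump k s‖ - inner ℝ ν (K u - K a)) • ν) - (x s - l • jump k s) =
          (inner ℝ ν r : ℝ) • ν := by
        rw [e1, inner_add_right, real_inner_smul_right, hνj', sub_smul, add_smul, mul_smul, hνj]
        module
      rw [e2, norm_smul]
      refine (mul_le_of_le_one_right (norm_nonneg _) (hN1 _)).trans ?_
      exact ((norm_inner_le_norm _ _).trans (mul_le_of_le_one_left (norm_nonneg _) (hN1 _))).trans
        hr1
  have hray : ∀ l ∈ Icc (0 : ℝ) 1, ‖x s - l • jump k s‖ ≤ B + M := by
    intro l hl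
    refine (_root_.norm_sub_le _ _).trans (add_le_add hxs ?_)
    rw [norm_smul, Real.norm_of_nonneg hl.1]
    exact (mul_le_of_le_one_left (norm_nonneg _) hl.2).trans hj
  have hball : ∀ u ∈ Ico a b,
      ‖x s - (‖jump k s‖ - inner ℝ ν (K u - K a)) • ν‖ ≤ R := by
    intro u hu
    obtain ⟨l, hl, -, h2⟩ := key u hu
    have := norm_sub_norm_le (x s - (‖jump k s‖ - inner ℝ ν (K u - K a)) • ν) (x s - l • jump k s)
    linarith [hray l hl]
  refine h.integral_near_segment hD hg hH ha hab.le (fun u hu => ?_)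
    (fun u hu => hΓ s hs _ (hball u hu)) (fun u hu hne0 => ?_)
  · obtain ⟨l, hl, h1, h2⟩ := key u hu
    have hz := norm_sub_norm_le (z u) (x s - l • jump k s)
    refine (hθ u ⟨ha.trans hu.1, hu.2.le.trans hbT⟩ s hs _ _ (by linarith [hray l hl])
      (hball u hu) (by linarith [(hY u hu).1]) ?_).1
    have := norm_sub_le_norm_sub_add_norm_sub (z u) (x s - l • jump k s)
      (x s - (‖jump k s‖ - inner ℝ ν (K u - K a)) • ν)
    rw [norm_sub_rev (x s - l • jump k s)] at this
    linarith
  · obtain ⟨l, hl, h1, -⟩ := key u hu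
    -- The ray projects to x s at every instant, so the projection of the penalized path stays near
    -- x s and its normal near ν.
    have hp := norm_proj_sub_le hne hc (z u) (x s - l • jump k s)
    rw [hx.proj_sub_smul_jump hD hs.1 hl.1] at hp
    rw [← hNn _ (proj_mem_frontier hD.isOpen hne hc hne0)]
    refine (hθ s hs s hs _ _ ?_ (by linarith) (by simpa using hθ0) (by linarith)).2
    linarith [norm_sub_norm_le (proj D (z u)) (x s)]

/-- On a fixed fine partition three errors appear: replacing the penalized integral by segment
integrals, letting the segment endpoints converge, and replacing the limiting segment integrals by
the limit functional. Only the second involves a limit in n at fixed partition; the others hold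
uniformly for large n. -/
theorem IsPenalizationScheme.tendsto_integral
    (hs : IsPenalizationScheme D T τ yn y xn kn x k)
    (hg : ContinuousOn (Function.uncurry g) (Ici 0 ×ˢ univ)) :
    Tendsto (fun n => ∫ s in (0 : ℝ)..T, g s (xn n s) * ‖drift D n (xn n) s‖) atTop
      (𝓝 (limitFunctional D T g x k)) := by
  obtain ⟨N, hN, hN1, hNn⟩ := exists_normal_extension hs.domain
  obtain ⟨C, hC0, hC⟩ := hs.exists_variation_bound
  have hx := hs.skorokhod
  have hD := hs.domain
  obtain ⟨B, hB0, hB⟩ := hx.cadlag_x.exists_bound T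
  set M := (normVariationMeasure k).real (Icc 0 T) with hM
  have hM0 : 0 ≤ M := measureReal_nonneg
  obtain ⟨Γ, hΓ0, hΓ⟩ := exists_isBoundOn hg T (B + M + 1)
  have hjT := hx.jump_eq_zero hD hs.cadlag hs.pos hs.jump_eq_zero
  rw [Metric.tendsto_nhds]
  intro δ hδ
  -- The three summands bound these errors in that order: the first is weighted by the penalty
  -- variation C, the last by the mass M of d‖k‖.
  obtain ⟨η, hη0, hηδ⟩ : ∃ η > 0, η * (1 + Γ) * C + η + η * (3 + Γ) * M < δ := by
    have hcont : Continuous fun η : ℝ => η * (1 + Γ) * C + η + η * (3 + Γ) * M := by fun_prop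
    have h0 := (hcont.tendsto 0).mono_left (nhdsWithin_le_nhds (s := Ioi 0))
    simp only [zero_mul, add_zero] at h0
    obtain ⟨η, h1, h2⟩ := ((h0.eventually (gt_mem_nhds hδ)).and self_mem_nhdsWithin).exists
    exact ⟨η, h2, h1⟩
  obtain ⟨θ', hθ'0, hθ'⟩ := exists_isModulusOn hg hN T (B + M + 1) hη0
  set θ := min θ' 1 / 4 with hθdef
  have hθ0 : 0 < θ := by positivity
  have hθ4 : 4 * θ = min θ' 1 := by rw [hθdef]; ring
  have hθ : IsModulusOn g N T (B + M + 1) η (4 * θ) := fun s h1 s' h1' w w' h2 h2' h3 h4 =>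
    hθ' s h1 s' h1' w w' h2 h2' (h3.trans (hθ4.le.trans (min_le_left _ _)))
      (h4.trans (hθ4.le.trans (min_le_left _ _)))
  have hθ1 : 4 * θ ≤ 1 := hθ4.le.trans (min_le_right _ _)
  obtain ⟨ε, hε0, hεθ⟩ : ∃ ε > 0, √(ε ^ 2 + 4 * ε * (C + M)) + 3 * ε ≤ θ := by
    have hcont : Continuous fun ε : ℝ => √(ε ^ 2 + 4 * ε * (C + M)) + 3 * ε := by fun_prop
    have h0 := (hcont.tendsto 0).mono_left (nhdsWithin_le_nhds (s := Ioi 0))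
    simp only [mul_zero, zero_mul, add_zero, ne_eq, OfNat.ofNat_ne_zero, not_false_eq_true,
      zero_pow, Real.sqrt_zero] at h0
    obtain ⟨ε, h1, h2⟩ := ((h0.eventually (gt_mem_nhds hθ0)).and self_mem_nhdsWithin).exists
    exact ⟨ε, h2, h1.le⟩
  have hsq := Real.sqrt_nonneg (ε ^ 2 + 4 * ε * (C + M))
  obtain ⟨m, t, ht, hev⟩ := hs.exists_partition hs.pos.le le_rfl hε0
  have hti : ∀ i ≤ m, t i ∈ Icc 0 T := fun i hi => ⟨ht.nonneg hi, ht.le_last hi⟩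
  have hdet := hx.abs_sum_integral_segment_sub_le hD hg hN hN1 hNn hB
    (fun s h1 w hw => hΓ s h1 w (by linarith))
    (fun s h1 s' h1' w w' h2 h2' h3 h4 => hθ s h1 s' h1' w w' (by linarith) (by linarith) h3 h4)
    hθ1 hη0.le (by linarith : 4 * ε ≤ 4 * θ) hε0.le hs.pos.le hjT ht
  have hpre : ∀ i ≤ m, Tendsto (fun n => kn n (fixedTime τ T n (t i))) atTop
      (𝓝 (preValue k (t i))) := fun i hi => hs.tendsto_preValue (hti i hi).1 (hti i hi).2
  set I : ℕ → ℝ → ℝ := fun i F => ∫ v in (0 : ℝ)..F,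
    g (t i) (x (t i) - (‖jump k (t i)‖ - v) • N (x (t i))) with hI
  have hIc : ∀ i ≤ m, Continuous (I i) := by
    intro i hi
    have hgs : Continuous (g (t i)) := by
      have : Continuous fun w => Function.uncurry g (t i, w) := by
        refine ContinuousOn.comp_continuous hg (by fun_prop) fun w => ⟨(hti i hi).1, mem_univ _⟩
      exact this
    have hH : Continuous fun v => g (t i) (x (t i) - (‖jump k (t i)‖ - v) • N (x (t i))) := by
      fun_prop
    exact intervalIntegral.continuous_primitive (fun a b => hH.intervalIntegrable a b) 0
  -- Each segment integral depends on n only through its upper limit, continuously, and that limit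
  -- is determined by kⁿ at two partition times.
  have hlim : Tendsto (fun n => ∑ i ∈ Finset.range m, I i (inner ℝ (N (x (t i)))
      (kn n (fixedTime τ T n (t (i + 1))) - kn n (fixedTime τ T n (t i))))) atTop
      (𝓝 (∑ i ∈ Finset.range m, I i (inner ℝ (N (x (t i)))
        (preValue k (t (i + 1)) - preValue k (t i))))) := by
    refine tendsto_finsetSum _ fun i hi => ?_
    have hi := Finset.mem_range.1 hi
    exact ((hIc i hi.le).tendsto _).comp (tendsto_const_nhds.inner
      ((hpre (i + 1) hi).sub (hpre i hi.le)))
  have hstart : ∀ᶠ n in atTop, ∀ i ∈ Finset.range m,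
      ‖kn n (fixedTime τ T n (t i)) - preValue k (t i)‖ ≤ ε := by
    rw [Filter.eventually_all_finset]
    intro i hi
    filter_upwards [(hpre i (Finset.mem_range.1 hi).le).eventually (Metric.ball_mem_nhds _ hε0)]
      with n hn
    rw [dist_eq_norm] at hn
    exact hn.le
  have hleT : ∀ᶠ n : ℕ in atTop, ∀ i ∈ Finset.range (m + 1), fixedTime τ T n (t i) ≤ T := by
    rw [Filter.eventually_all_finset]
    intro i hi
    have hi : i ≤ m := Nat.lt_succ_iff.1 (Finset.mem_range.1 hi)
    exact eventually_fixedTime_le hs.tendsto_timeChange (hti i hi).1 (hti i hi).2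
  have hlim' := hlim.eventually (Metric.ball_mem_nhds _ hη0)
  filter_upwards [hev, hlim', hstart, hleT, hC, eventually_ge_atTop 1]
    with n hn hlim' hstart hleT hC hn1
  have h := hs.penalized n hn1
  set V := penaltyVariation D n (xn n) with hV
  have ha : ∀ i ≤ m, 0 ≤ fixedTime τ T n (t i) := fun i hi => hs.fixedTime_nonneg n (hti i hi).1
  have hsplit : ∑ i ∈ Finset.range m, ∫ s in (fixedTime τ T n (t i))..(fixedTime τ T n (t (i + 1))),
      g s (xn n s) * ‖drift D n (xn n) s‖ =
      ∫ s in (0 : ℝ)..T, g s (xn n s) * ‖drift D n (xn n) s‖ := by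
    have hreg : IsRightRegular (fun u => g u (xn n u) * ‖drift D n (xn n) u‖) :=
      (h.cadlag_x.isRightRegular_comp hg).mul
        (isRightRegular_drift hD.nonempty hD.convex h.cadlag_x).norm
    rw [intervalIntegral.sum_integral_adjacent_intervals (a := fun i => fixedTime τ T n (t i))
      (fun i hi => hreg.intervalIntegrable (ha i hi.le) (ha (i + 1) hi))]
    rw [ht.zero, ht.last, fixedTime_self, fixedTime_zero hs.timeChange hs.pos]
  have hVsum : ∑ i ∈ Finset.range m,
      (V (fixedTime τ T n (t (i + 1))) - V (fixedTime τ T n (t i))) = V T := by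
    rw [Finset.sum_range_sub (fun i => V (fixedTime τ T n (t i))), ht.last, fixedTime_self, ht.zero,
      fixedTime_zero hs.timeChange hs.pos, hV, penaltyVariation_zero, sub_zero]
  have hint : ∀ i ∈ Finset.range m,
      |(∫ s in (fixedTime τ T n (t i))..(fixedTime τ T n (t (i + 1))),
        g s (xn n s) * ‖drift D n (xn n) s‖) - I i (inner ℝ (N (x (t i)))
        (kn n (fixedTime τ T n (t (i + 1))) - kn n (fixedTime τ T n (t i))))| ≤
        η * (1 + Γ) * (V (fixedTime τ T n (t (i + 1))) - V (fixedTime τ T n (t i))) := by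
    intro i hi
    have hi' := Finset.mem_range.1 hi
    obtain ⟨hlt, hosc⟩ := hn i hi'
    have hbT := hleT (i + 1) (Finset.mem_range.2 (by omega))
    have hj : ‖jump k (t i)‖ ≤ M := by
      simpa using hx.sum_norm_jump_le hD (T := T) {⟨t i, hti i hi'.le⟩}
    exact hx.integral_penalized_near hD h hg hN1 hNn (hti i hi'.le) (hB _ (hti i hi'.le)) hj
      le_rfl hΓ hθ hθ1 (ha i hi'.le) hlt hbT
      ((penaltyVariation_mono hD.nonempty hD.convex h.cadlag_x (ha (i + 1) hi') hbT).trans hC)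
      hε0.le hεθ hosc (hstart i hi)
  have hsum := (Finset.abs_sum_le_sum_abs _ _).trans (Finset.sum_le_sum hint)
  rw [Finset.sum_sub_distrib, hsplit, ← Finset.mul_sum, hVsum] at hsum
  rw [Real.dist_eq] at hlim'
  have hVC := mul_le_mul_of_nonneg_left hC (show 0 ≤ η * (1 + Γ) by positivity)
  rw [Real.dist_eq]
  rw [abs_le] at hsum hdet
  rw [abs_lt] at hlim' ⊢
  constructor <;> linarith [hsum.1, hsum.2, hdet.1, hdet.2, hlim'.1, hlim'.2]

end Final

end Reflection

open Reflection
theorem theorem2p4 {d : ℕ} (D : Set (EuclideanSpace ℝ (Fin d))) (hD : IsBoundedConvexC2Domain D)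
    (T : ℝ) (hT : 0 < T)
    (g : ℝ → EuclideanSpace ℝ (Fin d) → ℝ)
    (hg : ContinuousOn (Function.uncurry g) (Ici 0 ×ˢ univ))
    (yn : ℕ → ℝ → EuclideanSpace ℝ (Fin d)) (y : ℝ → EuclideanSpace ℝ (Fin d))
    (hyn : ∀ n, 1 ≤ n → IsCadlag (yn n)) (hy : IsCadlag y)
    (hconv : TendstoJ1 yn y) (hyT : jump y T = 0)
    (xn kn : ℕ → ℝ → EuclideanSpace ℝ (Fin d))
    (hxn : ∀ n, 1 ≤ n → IsPenalizedSolution D n (yn n) (xn n) (kn n))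
    (x k : ℝ → EuclideanSpace ℝ (Fin d)) (hx : IsSkorokhodSolution D y x k) :
    (∀ n, 1 ≤ n → LocallyBoundedVariationOn (kn n) (Ici 0) ∧
      IntegrableOn (fun s => g s (xn n s)) (Ioc 0 T) (variationMeasure (kn n))) ∧
    IntegrableOn (fun s => g s (x s)) (Icc 0 T) (normVariationMeasure k) ∧
    Summable (fun s : Icc (0 : ℝ) T => jumpTerm D g x k s) ∧
    Tendsto (fun n => ∫ s in Ioc 0 T, g s (xn n s) ∂(variationMeasure (kn n))) atTop
      (𝓝 (limitFunctional D T g x k)) := by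
  obtain ⟨τ, hτ, hu, hyτ⟩ := hconv
  have hs : IsPenalizationScheme D T τ yn y xn kn x k :=
    ⟨hD, hT, hτ, hu, hyτ, hy, hyT, hxn, hx⟩
  refine ⟨fun n hn => ⟨?_, ?_⟩, ?_, hx.summable_jumpTerm hD hg T, ?_⟩
  · exact locallyBoundedVariationOn_primitive
      (isRightRegular_drift hD.nonempty hD.convex (hxn n hn).cadlag_x) (hxn n hn).eq_zero_add
  · have := isLocallyFiniteMeasure_variationMeasure (kn n)
    exact (((hxn n hn).cadlag_x.isRightRegular_comp hg).integrableOn (S := T)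
      isCompact_Icc.measure_lt_top.ne).mono_set Ioc_subset_Icc_self
  · exact (hx.cadlag_x.isRightRegular_comp hg).integrableOn (normVariationMeasure_Icc_ne_top k T)
  -- For n ≥ 1 the measure d|kⁿ| has density ‖drift‖ on (0, T], so the Stieltjes integral is the
  -- ordinary integral already treated.
  · refine (hs.tendsto_integral hg).congr' ?_
    filter_upwards [eventually_ge_atTop 1] with n hn
    exact (setIntegral_variationMeasure_primitive
      (isRightRegular_drift hD.nonempty hD.convex (hxn n hn).cadlag_x) (hxn n hn).eq_zero_add
      _ hT.le).symm
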